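/- Let $p>0$ be such that $\alpha:=2/(1+p)\in[1,2)$, and put $c(\theta)=\cos\theta\,|\cos\theta|^p$, $s(\theta)=\sin\theta\,|\sin\theta|^p$. Let $\mu_0$ be a probability measure on $\mathbb R$ with distribution function $F_0$ and characteristic function $\phi_0$, and let $\mu(\cdot,t)$, $t\ge 0$, be probability measures with distribution functions $F(\cdot,t)$ whose characteristic functions $\phi(\cdot,t)$ solve $$\partial_t\phi(\xi,t)=\frac1{2\pi}\int_0^{2\pi}\phi(\xi s(\theta),t)\,\phi(\xi c(\theta),t)\,d\theta-\phi(\xi,t)\quad(t>0),\qquad \mu(\cdot,0)=\mu_0,$$ with $t\mapsto\phi(\xi,t)$ continuous on $[0,\infty)$ for every $\xi$. Let $G_\alpha$ be the distribution function with characteristic function $\hat g_\alpha(\xi)=\exp(-a_0|\xi|^\alpha)$, where $a_0>0$, and let $g_\alpha=G_\alpha'$ and $\|g_\alpha\|=\sup_x|g_\alpha(x)|$. Suppose that $F_0$ belongs to the domain of normal attraction of $G_\alpha$: for some constants $m_n$, if $X_1,X_2,\dots$ are independent with law $\mu_0$, then $n^{-1/\alpha}\sum_{i=1}^nX_i-m_n$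 converges in law to $G_\alpha$. *The random weights.* Let $\nu_t$ be such that $P_t\{\nu_t=n\}=e^{-t}(1-e^{-t})^{n-1}$ $(n\ge1)$. Given $\nu_t=n$, let $\gamma_t$ be a random binary tree with $n$ leaves with law $p_n$, where $p_1=1$ and $p_n(g)=p_j(g_l)\,p_{n-j}(g_r)/(n-1)$ if the subtrees $g_l,g_r$ of the root of $g$ have $j$ and $n-j$ leaves. Attach to the $n-1$ nodes independent angles, uniform on $[0,2\pi)$ and independent of the tree. For each leaf $j$ let $\beta_{j,t}$ be the product, along the path from the root to $j$, of $c(\theta)$ for each step to a left child and $s(\theta)$ for each step to a right child, $\theta$ being the angle of the node from which the step starts ($\beta_{1,t}=1$ if $n=1$). Put $\beta_{(\nu_t)}=\max_j|\beta_{j,t}|$, and let $E_t$ denote expectation. *Quantities of the initial datum.* Let $F_0^*(x)=\frac12\{F_0(x)+1-F_0(-x-0)\}$; let $c_0>0$ be given by $a_0=2c_0\int_0^{\infty}\frac{\sin x}{x^\alpha}dx$ (improper integral); and, for $x>0$, let $S^*(x)=1-F_0^*(x)-c_0x^{-\alpha}$ and $h^*(x)=x^\alpha S^*(x)$. Define $v_0^*$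 by $1-\mathrm{Re}\,\phi_0(\xi)=(a_0+v_0^*(\xi))|\xi|^\alpha$ for $\xi\ne0$, $v_0^*(0)=0$; let $\bar v_0^*(\xi)=\sup_{0\le x\le\xi}|v_0^*(x)|$ for $\xi\ge 0$, and $M=a_0+\sup_{\xi\ge0}|v_0^*(\xi)|$. Let $\eta\in(0,a_0)$, and let $d\in(0,1)$ be such that, with $\tilde d=(3d/(8M))^{1/\alpha}$, $$\tfrac45M^2|x|^\alpha+\bar v_0^*(|x|)\le\eta\qquad\text{whenever }|x|\le\tilde d.$$ Let $D>0$. If $\alpha=1$, suppose moreover that $\int_D^\infty|S^*(x)|dx<\infty$. Put $$H_1^*(q)=\int_0^1y^{1-\alpha}|h^*(y/q)|dy,\qquad H_2^*(q)=\int_1^\infty y^{-\alpha}|h^*(y/q)|dy,$$ $$b_1^*(x)=2x\int_D^\infty\sin(xu)S^*(u)du,\qquad k_1=\int_0^Dx|S^*(x)|dx,\qquad k_2=\sup_{x>0}\frac{|b_1^*(x)|}{x^\alpha},$$ $$N_l=\int_0^\infty e^{-(a_0-\eta)\xi^\alpha}\xi^{l-1}d\xi,\qquad A_m=\frac1{2\pi}\int_0^{2\pi}|\sin\theta|^md\theta,$$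 $$B_1=2k_1N_2+8k_1k_2N_{2+\alpha},\quad B_2=8k_1^2N_4,\quad B_3=4k_2N_{2+\alpha}+2N_2,\quad B_4=4k_2N_{1+\alpha}+2N_1,$$ $$B_5=\tfrac45M^2N_{2\alpha},\qquad B_6=\tfrac{32}{25}M^4N_{4\alpha}.$$ *The Berry–Esseen constant.* Let $\mathbf c$ be any constant such that, for all probability distribution functions $F,G$ with characteristic functions $\phi_F,\phi_G$, where $G$ is differentiable with $|G'|\le A$, and for all $T>0$, $$\sup_x|F(x)-G(x)|\le\frac1\pi\int_{-T}^T\Big|\frac{\phi_F(\xi)-\phi_G(\xi)}{\xi}\Big|d\xi+\frac{\mathbf c\,A}{T}.$$ Such constants exist. Then, for every $t\ge0$, $$\begin{aligned}\sup_{x}|F(x,t)-G_\alpha(x)|\le{}&\frac2\pi E_t\Big[\sum_{j=1}^{\nu_t}|\beta_{j,t}|^\alpha\{B_3H_1^*(|\beta_{j,t}|)+B_4H_2^*(|\beta_{j,t}|)\}\Big]+\frac{\mathbf c\,\|g_\alpha\|}{\tilde d}E_t(\beta_{(\nu_t)})\\&+\frac2\pi\Big\{B_1e^{-t(1-2A_{4/\alpha})}+B_2e^{-t(1-2A_{(8-2\alpha)/\alpha})}+B_5e^{-t(1-2A_4)}+B_6e^{-t(1-2A_6)}\Big\}\\&+\frac{e^{-t}}2\sup_x|F_0(x)+F_0(-x-0)-1|.\end{aligned}$$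 -/

import Mathlib

open MeasureTheory ProbabilityTheory Filter Topology
open scoped ENNReal BoundedContinuousFunction

noncomputable section

namespace InelasticKac

/-! ### The equation -/

/-- `c(θ) = cos θ |cos θ|^p`. -/
def cosP (p θ : ℝ) : ℝ := Real.cos θ * |Real.cos θ| ^ p

/-- `s(θ) = sin θ |sin θ|^p`. -/
def sinP (p θ : ℝ) : ℝ := Real.sin θ * |Real.sin θ| ^ p

/-- `μ(·,t)`, `t ≥ 0`, is a family of probability measures on the line, started at `μ₀`, whose
characteristic functions `φ(ξ,t)` solve
`∂ₜ φ(ξ,t) = (2π)⁻¹ ∫₀^{2π} φ(ξ s(θ),t) φ(ξ c(θ),t) dθ - φ(ξ,t)` for `t > 0`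
and are continuous in `t ≥ 0`. -/
structure IsSolution (p : ℝ) (μ₀ : Measure ℝ) (μ : ℝ → Measure ℝ) : Prop where
  isProbabilityMeasure : ∀ t, 0 ≤ t → IsProbabilityMeasure (μ t)
  initial : μ 0 = μ₀
  continuousOn : ∀ ξ : ℝ, ContinuousOn (fun t => charFun (μ t) ξ) (Set.Ici 0)
  equation : ∀ ξ t : ℝ, 0 < t → HasDerivAt (fun τ => charFun (μ τ) ξ)
    ((1 / (2 * Real.pi) : ℂ) * (∫ θ in (0 : ℝ)..(2 * Real.pi),
        charFun (μ t) (ξ * sinP p θ) * charFun (μ t) (ξ * cosP p θ)) - charFun (μ t) ξ) t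

/-- Kolmogorov distance of the distribution functions of two probability measures. -/
def kolmogorovDist (μ ν : Measure ℝ) : ℝ := ⨆ x : ℝ, |cdf μ x - cdf ν x|

/-! ### Random binary trees with random angles

A tree with `n` leaves (`n - 1` nodes) is a term of `BinaryTree Unit`, whose leaves are `nil`. -/

instance : MeasurableSpace (BinaryTree Unit) := ⊤

/-- The probability `p_n(g)` of the tree `g` among the trees with `n` leaves: the left subtree of
the root has `j` leaves with probability `1/(n-1)` for each `j = 1, …, n-1`, and, given the sizes,
the two subtrees are drawn independently in the same way. -/
def treeProb : BinaryTree Unit → ℝ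
  | .nil => 1
  | .node a l r => treeProb l * treeProb r / ((BinaryTree.node a l r).numNodes : ℝ)

/-- The law of the random tree at time `t`: `n` leaves with probability
`e^{-t} (1 - e^{-t})^{n-1}`, and then the tree `g` with probability `p_n(g)`. -/
def treeLaw (t : ℝ) : Measure (BinaryTree Unit) :=
  Measure.sum fun g : BinaryTree Unit =>
    ENNReal.ofReal (Real.exp (-t) * (1 - Real.exp (-t)) ^ g.numNodes * treeProb g) •
      Measure.dirac g

/-- The uniform law on `[0, 2π)`. -/
def angleLaw : Measure ℝ := ProbabilityTheory.cond volume (Set.Ico 0 (2 * Real.pi))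

/-- The law of the tree and the angles: the angles are independent of the tree, mutually
independent, and uniform on `[0, 2π)`. -/
def treeAngleLaw (t : ℝ) : Measure (BinaryTree Unit × (ℕ → ℝ)) :=
  (treeLaw t).prod (Measure.infinitePi fun _ : ℕ => angleLaw)

/-- The weights `β_1, …, β_n` of the leaves, from left to right: `β_j` is the product of `c(θ_k)`
(for each step to the left) and `s(θ_k)` (for each step to the right) along the path from the root
to the leaf `j`, with `θ_k` the angle of the node where the step starts.  The nodes are numbered
in preorder: the root, then the left subtree, then the right subtree. -/
def weights (p : ℝ) : BinaryTree Unit → (ℕ → ℝ) → List ℝ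
  | .nil, _ => [1]
  | .node _ l r, θ =>
      (weights p l fun k => θ (k + 1)).map (fun b => cosP p (θ 0) * b) ++
      (weights p r fun k => θ (k + 1 + l.numNodes)).map (fun b => sinP p (θ 0) * b)

/-- `E_t [ ∑_j f(|β_j|) ]`. -/
def expSum (p t : ℝ) (f : ℝ → ℝ) : ℝ :=
  ∫ ω, ((weights p ω.1 ω.2).map fun b => f |b|).sum ∂(treeAngleLaw t)

/-- `E_t [ max_j |β_j| ]`. -/
def expMax (p t : ℝ) : ℝ :=
  ∫ ω, ((weights p ω.1 ω.2).map fun b => |b|).foldr max 0 ∂(treeAngleLaw t)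

/-! ### Stable laws, normal attraction, the Berry-Esseen inequality -/

/-- `ν` is the probability measure with characteristic function `exp(-a₀ |ξ|^α)`. -/
def IsSymmStable (α a₀ : ℝ) (ν : Measure ℝ) : Prop :=
  IsProbabilityMeasure ν ∧ ∀ ξ : ℝ, charFun ν ξ = (Real.exp (-a₀ * |ξ| ^ α) : ℂ)

/-- `μ₀` belongs to the domain of normal attraction of `ν` (of exponent `α`): for suitable
centering constants `m_n` the law of `(X_1 + ⋯ + X_n) / n^{1/α} - m_n`, with `X_i` independent of
law `μ₀`, converges weakly to `ν`. -/
def InNormalDomain (α : ℝ) (μ₀ ν : Measure ℝ) : Prop :=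
  ∃ m : ℕ → ℝ, ∀ f : ℝ →ᵇ ℝ,
    Tendsto (fun n : ℕ => ∫ x : Fin n → ℝ, f ((∑ i, x i) / (n : ℝ) ^ (1 / α) - m n)
      ∂(Measure.pi fun _ : Fin n => μ₀)) atTop (𝓝 (∫ y, f y ∂ν))

/-- The supremum of the density of `ν`, i.e. of the derivative of its distribution function. -/
def densityNorm (ν : Measure ℝ) : ℝ := ⨆ x : ℝ, |deriv (cdf ν) x|

/-- `c` is an admissible constant in the Berry-Esseen smoothing inequality
`sup |F - G| ≤ π⁻¹ ∫_{-T}^{T} |φ_F(ξ) - φ_G(ξ)| / |ξ| dξ + c A / T`, for all distribution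
functions `F`, `G` with `G` differentiable and `|G'| ≤ A`, and all `T > 0` (the inequality being
void if the integral is infinite). -/
def IsBerryEsseenConst (c : ℝ) : Prop :=
  ∀ μ ν : Measure ℝ, IsProbabilityMeasure μ → IsProbabilityMeasure ν →
    ∀ A T : ℝ, 0 < T → Differentiable ℝ (cdf ν) → (∀ x, |deriv (cdf ν) x| ≤ A) →
    IntegrableOn (fun ξ : ℝ => ‖charFun μ ξ - charFun ν ξ‖ / |ξ|) (Set.Icc (-T) T) →
    ∀ x, |cdf μ x - cdf ν x| ≤
      1 / Real.pi * (∫ ξ in Set.Icc (-T) T, ‖charFun μ ξ - charFun ν ξ‖ / |ξ|) + c * A / T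

/-! ### Quantities attached to the initial law -/

/-- `F₀*(x) = (F₀(x) + 1 - F₀(-x-0)) / 2`, the distribution function of the even part of `μ₀`;
`F₀(y-0) = μ₀(-∞, y)`. -/
def cdfStar (μ₀ : Measure ℝ) (x : ℝ) : ℝ := (cdf μ₀ x + 1 - μ₀.real (Set.Iio (-x))) / 2

/-- `sup_x |F₀(x) + F₀(-x-0) - 1|`. -/
def asymmetry (μ₀ : Measure ℝ) : ℝ := ⨆ x : ℝ, |cdf μ₀ x + μ₀.real (Set.Iio (-x)) - 1|

/-- `v₀*`, given by `1 - Re φ₀(ξ) = (a₀ + v₀*(ξ)) |ξ|^α` for `ξ ≠ 0` and `v₀*(0) = 0`. -/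
def vStar (μ₀ : Measure ℝ) (α a₀ ξ : ℝ) : ℝ :=
  if ξ = 0 then 0 else (1 - (charFun μ₀ ξ).re) / |ξ| ^ α - a₀

/-- `sup_{0 ≤ x ≤ ξ} |v₀*(x)|`. -/
def vBar (μ₀ : Measure ℝ) (α a₀ ξ : ℝ) : ℝ :=
  sSup ((fun x => |vStar μ₀ α a₀ x|) '' Set.Icc 0 ξ)

/-- `M = a₀ + sup_{ξ ≥ 0} |v₀*(ξ)|`. -/
def bigM (μ₀ : Measure ℝ) (α a₀ : ℝ) : ℝ :=
  a₀ + sSup ((fun x => |vStar μ₀ α a₀ x|) '' Set.Ici 0)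

/-- `d̃ = (3 d / (8 M))^{1/α}`. -/
def dTilde (μ₀ : Measure ℝ) (α a₀ d : ℝ) : ℝ := (3 * d / (8 * bigM μ₀ α a₀)) ^ (1 / α)

/-- The remainder `S*(x) = 1 - F₀*(x) - c₀ / x^α`, for `x > 0`. -/
def sStar (μ₀ : Measure ℝ) (α c₀ x : ℝ) : ℝ := 1 - cdfStar μ₀ x - c₀ / x ^ α

/-- `h*(x) = x^α S*(x)`, for `x > 0`. -/
def hStar (μ₀ : Measure ℝ) (α c₀ x : ℝ) : ℝ := x ^ α * sStar μ₀ α c₀ x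

/-- `H₁*(q) = ∫_0^1 y^{1-α} |h*(y/q)| dy`. -/
def H1 (μ₀ : Measure ℝ) (α c₀ q : ℝ) : ℝ :=
  ∫ y in Set.Ioc (0 : ℝ) 1, y ^ (1 - α) * |hStar μ₀ α c₀ (y / q)|

/-- `H₂*(q) = ∫_1^∞ y^{-α} |h*(y/q)| dy`. -/
def H2 (μ₀ : Measure ℝ) (α c₀ q : ℝ) : ℝ :=
  ∫ y in Set.Ioi (1 : ℝ), y ^ (-α) * |hStar μ₀ α c₀ (y / q)|

/-- `b₁*(x) = 2 x ∫_D^∞ sin(x u) S*(u) du`; `S*` is absolutely integrable on `(D, ∞)` wherever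
this is used. -/
def b1 (μ₀ : Measure ℝ) (α c₀ D x : ℝ) : ℝ :=
  2 * x * ∫ u in Set.Ioi D, Real.sin (x * u) * sStar μ₀ α c₀ u

/-- `k₁ = ∫_0^D x |S*(x)| dx`. -/
def k1 (μ₀ : Measure ℝ) (α c₀ D : ℝ) : ℝ := ∫ x in Set.Ioc 0 D, x * |sStar μ₀ α c₀ x|

/-- `k₂ = sup_{x > 0} |b₁*(x)| / x^α`. -/
def k2 (μ₀ : Measure ℝ) (α c₀ D : ℝ) : ℝ :=
  sSup ((fun x => |b1 μ₀ α c₀ D x| / x ^ α) '' Set.Ioi 0)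

/-- `N_l = ∫_0^∞ exp(-(a₀ - η) ξ^α) ξ^{l-1} dξ`. -/
def bigN (α a₀ η l : ℝ) : ℝ :=
  ∫ ξ in Set.Ioi (0 : ℝ), Real.exp (-(a₀ - η) * ξ ^ α) * ξ ^ (l - 1)

/-- `A_m = (2π)⁻¹ ∫_0^{2π} |sin θ|^m dθ`. -/
def bigA (m : ℝ) : ℝ :=
  1 / (2 * Real.pi) * ∫ θ in (0 : ℝ)..(2 * Real.pi), |Real.sin θ| ^ m

/-- `B₁ = 2 k₁ N_2 + 8 k₁ k₂ N_{2+α}`. -/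
def B1 (μ₀ : Measure ℝ) (α a₀ c₀ η D : ℝ) : ℝ :=
  2 * k1 μ₀ α c₀ D * bigN α a₀ η 2 + 8 * k1 μ₀ α c₀ D * k2 μ₀ α c₀ D * bigN α a₀ η (2 + α)

/-- `B₂ = 8 k₁² N_4`. -/
def B2 (μ₀ : Measure ℝ) (α a₀ c₀ η D : ℝ) : ℝ := 8 * k1 μ₀ α c₀ D ^ 2 * bigN α a₀ η 4

/-- The factor `B₃ = 4 k₂ N_{2+α} + 2 N_2` of `H₁*`. -/
def B3 (μ₀ : Measure ℝ) (α a₀ c₀ η D : ℝ) : ℝ :=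
  4 * k2 μ₀ α c₀ D * bigN α a₀ η (2 + α) + 2 * bigN α a₀ η 2

/-- The factor `B₄ = 4 k₂ N_{1+α} + 2 N_1` of `H₂*`. -/
def B4 (μ₀ : Measure ℝ) (α a₀ c₀ η D : ℝ) : ℝ :=
  4 * k2 μ₀ α c₀ D * bigN α a₀ η (1 + α) + 2 * bigN α a₀ η 1

/-- `B₅ = (4/5) M² N_{2α}`. -/
def B5 (μ₀ : Measure ℝ) (α a₀ η : ℝ) : ℝ := 4 / 5 * bigM μ₀ α a₀ ^ 2 * bigN α a₀ η (2 * α)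

/-- `B₆ = (32/25) M⁴ N_{4α}`. -/
def B6 (μ₀ : Measure ℝ) (α a₀ η : ℝ) : ℝ := 32 / 25 * bigM μ₀ α a₀ ^ 4 * bigN α a₀ η (4 * α)

end InelasticKac

end

open InelasticKac

/-! ### Laws with integrable characteristic function -/

/-! The angle is uniform, so every term of the collision integral that contains Im φ is odd in c(θ)
or in s(θ) and integrates to zero (`collision_re_im`). Hence Im φ(·,t) = e^{-t} Im φ₀, while Re φ
solves the quadratic equation on its own, starting from Re φ₀, the characteristic function of the
symmetrized law. Wild's expansion of that equation is an average over random trees: Re φ(ξ,t) = E_t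
∏_j Re φ₀(ξ β_j) (`abs_sub_wildSum_le`, `re_charFun_of_isSolution`). By uniqueness of characteristic
functions, F(x,t) is the average of the distribution functions of ∑ β_j X_j, with independent
symmetrized X_j, plus e^{-t}(F₀ - F₀*) (`cdf_of_isSolution`). The latter term gives the asymmetry
summand of the bound.

For fixed weights the comparison with G_α is a Berry-Esseen argument (`abs_cdf_weightedLaw_sub_le`).
The identity ∑|β_j|^α = 1 holds for every tree, so when all |ξ β_j| ≤ d̃ the product equals
exp(-a₀|ξ|^α + Y), where |Y| is at most a sum of local errors and at most η|ξ|^α. Then |e^Y - 1| ≤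
|Y| e^{|Y|} bounds the difference of characteristic functions by e^{-(a₀-η)|ξ|^α} times the local
errors (`abs_prod_sub_exp_le`). A local error has two parts. The part with v₀* is controlled by
integration by parts, 1 - Re φ₀(ξ) = ∫ ξ sin(ξx) P(|X| > x) dx: the pure power tail 2c₀x^{-α}
accounts for a₀|ξ|^α, and the rest is bounded by H₁* and H₂* (`abs_vStar_mul_le`). The quadratic
part from the logarithm gives ∑|β_j|^{2α}, whose mean decays like e^{-t(1-2A_4)}
(`integral_sum_weights_rpow_le`). Taking T = d̃/β_(ν) and integrating over ξ produces the constants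
N_l and the term with max|β_j|.

This first order estimate already yields the bound with 2N_2, 2N_1 and B₅; the terms with k₁, k₂ and
B₆ are nonnegative and are added at the end.

Two auxiliary facts are needed. Normal attraction forces tails O(x^{-α}) (`exists_tail_le`, through
a Baire category argument), which makes v₀* and h* bounded. The smoothing inequality holds with
constant 8π, by convolution with a Fejér law (`isBerryEsseenConst_eight_mul_pi`). -/

open FourierTransform SchwartzMap in
theorem integral_schwartz_eq_integral_mul_fourier_charFun (μ : Measure ℝ) [IsProbabilityMeasure μ]
    (hint : Integrable (fun ξ : ℝ => charFun μ (2 * Real.pi * ξ))) (h : 𝓢(ℝ, ℂ)) :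
    ∫ x, h x ∂μ = ∫ y, h y * 𝓕 (fun ξ : ℝ => charFun μ (2 * Real.pi * ξ)) y := by
  have e1 : ∀ x : ℝ, h x = ∫ ξ : ℝ, Real.fourierChar (ξ * x) • (𝓕 h) ξ := by
    intro x
    have : h x = 𝓕⁻ (𝓕 h) x := by rw [FourierTransform.fourierInv_fourier_eq]
    rw [this, fourierInv_coe, Real.fourierInv_eq]
    refine integral_congr_ae (Eventually.of_forall fun ξ => ?_)
    simp [mul_comm]
  have e2 : ∀ ξ : ℝ, charFun μ (2 * Real.pi * ξ) = ∫ x : ℝ, (Real.fourierChar (ξ * x) : ℂ) ∂μ := by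
    intro ξ
    rw [charFun_apply_real]
    refine integral_congr_ae (Eventually.of_forall fun x => ?_)
    simp only [Real.fourierChar_apply]
    push_cast
    ring_nf
  -- Fourier inversion of h, Fubini, and then self-adjointness of the Fourier transform, which moves
  -- it from h onto the characteristic function.
  calc ∫ x, h x ∂μ = ∫ x, (∫ ξ : ℝ, Real.fourierChar (ξ * x) • (𝓕 h) ξ) ∂μ := by
        simp_rw [← e1]
    _ = ∫ ξ : ℝ, ∫ x, Real.fourierChar (ξ * x) • (𝓕 h) ξ ∂μ := by
        apply integral_integral_swap
        have hI : Integrable (fun z : ℝ × ℝ => (𝓕 h) z.2) (μ.prod volume) :=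
          (𝓕 h).integrable.comp_snd μ
        refine hI.mono ?_ (Eventually.of_forall fun z => ?_)
        · refine Continuous.aestronglyMeasurable ?_
          simp only [Function.uncurry_def, Circle.smul_def, smul_eq_mul]
          have : Continuous fun z : ℝ × ℝ => (Real.fourierChar (z.2 * z.1) : ℂ) :=
            (continuous_subtype_val.comp (Real.continuous_fourierChar.comp (by fun_prop)))
          exact this.mul ((𝓕 h).continuous.comp continuous_snd)
        · simp [Function.uncurry, Circle.norm_smul]
    _ = ∫ ξ : ℝ, (𝓕 h) ξ * charFun μ (2 * Real.pi * ξ) := by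
        refine integral_congr_ae (Eventually.of_forall fun ξ => ?_)
        simp only [Circle.smul_def, smul_eq_mul]
        rw [integral_mul_const, e2, mul_comm]
    _ = _ := by
        have := VectorFourier.integral_fourierIntegral_smul_eq_flip (L := innerₗ ℝ) (μ := volume)
          (ν := volume) Real.continuous_fourierChar continuous_inner h.integrable hint
        simpa [fourier_coe] using! this

theorem norm_fourier_charFun_le (μ : Measure ℝ) (y : ℝ) :
    ‖FourierTransform.fourier (fun ξ : ℝ => charFun μ (2 * Real.pi * ξ)) y‖
      ≤ ∫ ξ : ℝ, ‖charFun μ (2 * Real.pi * ξ)‖ := by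
  rw [Real.fourier_eq]
  refine (norm_integral_le_integral_norm _).trans (le_of_eq ?_)
  simp [Circle.norm_smul]

/-- The identity for test functions passes to the indicator of an open ball by dominated convergence
along smooth bumps supported in the ball. The density is bounded by the L¹ norm of the
characteristic function, which supplies the dominating function. -/
theorem measureReal_ball_eq_integral_fourier_charFun (μ : Measure ℝ) [IsProbabilityMeasure μ]
    (hint : Integrable (fun ξ : ℝ => charFun μ (2 * Real.pi * ξ))) (c r : ℝ) (hr : 0 < r) :
    ((μ.real (Metric.ball c r) : ℝ) : ℂ) = ∫ y in Metric.ball c r,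
      FourierTransform.fourier (fun ξ : ℝ => charFun μ (2 * Real.pi * ξ)) y := by
  set g := FourierTransform.fourier (fun ξ : ℝ => charFun μ (2 * Real.pi * ξ)) with hg
  have hgc : Continuous g := VectorFourier.fourierIntegral_continuous Real.continuous_fourierChar
    continuous_inner hint
  -- The shift by 2 keeps the inner radius positive already at n = 0. The outer radius is r itself,
  -- so the bumps vanish off the open ball.
  let b : ℕ → ContDiffBump c := fun n => ⟨r * (1 - 1 / (n + 2)), r, by
    have : (1 : ℝ) / (n + 2) < 1 := by rw [div_lt_one (by positivity)]; linarith [n.cast_nonneg (α := ℝ)]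
    exact mul_pos hr (by linarith), by
    have : (0 : ℝ) < 1 / (n + 2) := by positivity
    nlinarith⟩
  have hb : ∀ n, HasCompactSupport (fun x => ((b n x : ℝ) : ℂ)) := fun n =>
    (b n).hasCompactSupport.comp_left (g := fun x : ℝ => (x : ℂ)) (by simp)
  have hs : ∀ n, ContDiff ℝ (⊤ : ℕ∞) (fun x => ((b n x : ℝ) : ℂ)) := fun n =>
    Complex.ofRealCLM.contDiff.comp (b n).contDiff
  have key : ∀ n, ∫ x, ((b n x : ℝ) : ℂ) ∂μ = ∫ y, ((b n y : ℝ) : ℂ) * g y := fun n =>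
    integral_schwartz_eq_integral_mul_fourier_charFun μ hint ((hb n).toSchwartzMap (hs n))
  have lim : ∀ x, Tendsto (fun n => ((b n x : ℝ) : ℂ)) atTop
      (𝓝 ((Metric.ball c r).indicator (fun _ => (1 : ℂ)) x)) := by
    intro x
    by_cases hx : x ∈ Metric.ball c r
    · rw [Set.indicator_of_mem hx]
      have h1 : Tendsto (fun n : ℕ => r * (1 - 1 / ((n : ℝ) + 2))) atTop (𝓝 (r * (1 - 0))) := by
        refine tendsto_const_nhds.mul (tendsto_const_nhds.sub ?_)
        exact tendsto_const_nhds.div_atTop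
          (tendsto_atTop_add_const_right _ _ tendsto_natCast_atTop_atTop)
      have h2 : ∀ᶠ n : ℕ in atTop, dist x c < r * (1 - 1 / ((n : ℝ) + 2)) :=
        h1.eventually_const_lt (by simpa using hx)
      refine tendsto_const_nhds.congr' ?_
      filter_upwards [h2] with n hn
      have : b n x = 1 := (b n).one_of_mem_closedBall (Metric.mem_closedBall.2 hn.le)
      simp [this]
    · rw [Set.indicator_of_notMem hx]
      refine tendsto_const_nhds.congr fun n => ?_
      have : b n x = 0 := (b n).zero_of_le_dist (not_lt.1 hx)
      simp [this]
  have L : Tendsto (fun n => ∫ x, ((b n x : ℝ) : ℂ) ∂μ) atTop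
      (𝓝 (∫ x, (Metric.ball c r).indicator (fun _ => (1 : ℂ)) x ∂μ)) := by
    refine tendsto_integral_of_dominated_convergence (fun _ => 1)
      (fun n => ((hs n).continuous).aestronglyMeasurable) (integrable_const _)
      (fun n => Eventually.of_forall fun x => ?_) (Eventually.of_forall lim)
    rw [Complex.norm_real, Real.norm_of_nonneg (b n).nonneg]
    exact (b n).le_one
  have R : Tendsto (fun n => ∫ y, ((b n y : ℝ) : ℂ) * g y) atTop
      (𝓝 (∫ y, (Metric.ball c r).indicator (fun _ => (1 : ℂ)) y * g y)) := by
    refine tendsto_integral_of_dominated_convergence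
      ((Metric.ball c r).indicator fun _ => ∫ ξ : ℝ, ‖charFun μ (2 * Real.pi * ξ)‖)
      (fun n => ((hs n).continuous.mul hgc).aestronglyMeasurable) ?_
      (fun n => Eventually.of_forall fun x => ?_)
      (Eventually.of_forall fun y => (lim y).mul tendsto_const_nhds)
    · rw [integrable_indicator_iff measurableSet_ball]
      exact integrableOn_const measure_ball_lt_top.ne
    · rw [norm_mul, Complex.norm_real, Real.norm_of_nonneg (b n).nonneg]
      by_cases hx : x ∈ Metric.ball c r
      · rw [Set.indicator_of_mem hx]
        exact (mul_le_of_le_one_left (norm_nonneg _) (b n).le_one).trans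
          (norm_fourier_charFun_le μ x)
      · have : b n x = 0 := (b n).zero_of_le_dist (not_lt.1 hx)
        simp [this, Set.indicator_of_notMem hx]
  have := tendsto_nhds_unique L (R.congr fun n => (key n).symm)
  rw [integral_indicator measurableSet_ball] at this
  rw [← integral_indicator measurableSet_ball]
  rw [show ((μ.real (Metric.ball c r) : ℝ) : ℂ) = ∫ x in Metric.ball c r, (1 : ℂ) ∂μ by simp, this]
  refine integral_congr_ae (Eventually.of_forall fun y => ?_)
  by_cases hy : y ∈ Metric.ball c r <;> simp [hy]

/-- Balls of radius r have mass O(r), so there are no atoms, and open and half-open intervals have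
equal mass. The distribution function is then a primitive of a continuous function. -/
theorem hasDerivAt_cdf_fourier_charFun (μ : Measure ℝ) [IsProbabilityMeasure μ]
    (hint : Integrable (fun ξ : ℝ => charFun μ (2 * Real.pi * ξ))) (x : ℝ) :
    HasDerivAt (fun x => ((cdf μ x : ℝ) : ℂ))
      (FourierTransform.fourier (fun ξ : ℝ => charFun μ (2 * Real.pi * ξ)) x) x := by
  have hball := measureReal_ball_eq_integral_fourier_charFun μ hint
  have hbound := norm_fourier_charFun_le μ
  set g := FourierTransform.fourier (fun ξ : ℝ => charFun μ (2 * Real.pi * ξ)) with hg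
  set K := ∫ ξ : ℝ, ‖charFun μ (2 * Real.pi * ξ)‖ with hK
  have hK0 : 0 ≤ K := integral_nonneg fun _ => norm_nonneg _
  have hgc : Continuous g := VectorFourier.fourierIntegral_continuous Real.continuous_fourierChar
    continuous_inner hint
  have hatom : ∀ y, μ.real {y} = 0 := by
    intro y
    have h1 : ∀ r > 0, μ.real {y} ≤ K * (2 * r) := by
      intro r hr
      have h2 : ‖((μ.real (Metric.ball y r) : ℝ) : ℂ)‖ ≤ K * (volume.real (Metric.ball y r)) := by
        rw [hball y r hr]
        exact norm_setIntegral_le_of_norm_le_const measure_ball_lt_top fun z _ => hbound z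
      rw [Complex.norm_real, Real.norm_of_nonneg measureReal_nonneg,
        Real.volume_real_ball hr.le] at h2
      exact (measureReal_mono (by simpa using hr)).trans h2
    refine le_antisymm (le_of_forall_pos_le_add fun ε hε => ?_) measureReal_nonneg
    refine (h1 (ε / (2 * (K + 1))) (by positivity)).trans ?_
    rw [zero_add, show K * (2 * (ε / (2 * (K + 1)))) = (K / (K + 1)) * ε by field_simp]
    exact mul_le_of_le_one_left hε.le (by rw [div_le_one (by positivity)]; linarith)
  have hdiff : ∀ a b, a < b → ((cdf μ b : ℝ) : ℂ) - cdf μ a = ∫ y in a..b, g y := by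
    intro a b hab
    have e := hball ((a + b) / 2) ((b - a) / 2) (by linarith)
    rw [Real.ball_eq_Ioo, show (a + b) / 2 - (b - a) / 2 = a by ring,
      show (a + b) / 2 + (b - a) / 2 = b by ring, ← integral_Ioc_eq_integral_Ioo,
      ← intervalIntegral.integral_of_le hab.le] at e
    rw [← e, cdf_eq_real, cdf_eq_real, ← Complex.ofReal_sub]
    congr 1
    have h1 : μ.real (Set.Iic b) = μ.real (Set.Iic a) + μ.real (Set.Ioc a b) := by
      rw [← measureReal_union (by
        rw [Set.disjoint_left]; intro z hz hz'; exact absurd hz (not_le.2 hz'.1)) measurableSet_Ioc,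
        Set.Iic_union_Ioc_eq_Iic hab.le]
    have h2 : μ.real (Set.Ioc a b) = μ.real (Set.Ioo a b) + μ.real {b} := by
      rw [← measureReal_union (by simp) (measurableSet_singleton b), Set.Ioo_union_right hab]
    rw [h1, h2, hatom]; ring
  have hx : (fun y => ((cdf μ y : ℝ) : ℂ)) =ᶠ[𝓝 x]
      fun y => ((cdf μ (x - 1) : ℝ) : ℂ) + ∫ z in (x - 1)..y, g z := by
    filter_upwards [lt_mem_nhds (show x - 1 < x by linarith)] with y hy
    rw [← hdiff _ _ hy]; ring
  refine HasDerivAt.congr_of_eventuallyEq ?_ hx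
  exact (intervalIntegral.integral_hasDerivAt_right (hgc.intervalIntegrable _ _)
    (hgc.stronglyMeasurableAtFilter _ _) hgc.continuousAt).const_add _

theorem differentiable_cdf_of_integrable_charFun (μ : Measure ℝ) [IsProbabilityMeasure μ]
    (hint : Integrable (fun ξ : ℝ => charFun μ (2 * Real.pi * ξ))) : Differentiable ℝ (cdf μ) ∧
      ∀ x, |deriv (cdf μ) x| ≤ ∫ ξ : ℝ, ‖charFun μ (2 * Real.pi * ξ)‖ := by
  have h : ∀ x, HasDerivAt (cdf μ)
      (FourierTransform.fourier (fun ξ : ℝ => charFun μ (2 * Real.pi * ξ)) x).re x := fun x => 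
    Complex.reCLM.hasFDerivAt.comp_hasDerivAt x (hasDerivAt_cdf_fourier_charFun μ hint x)
  refine ⟨fun x => (h x).differentiableAt, fun x => ?_⟩
  rw [(h x).deriv]
  exact (Complex.abs_re_le_norm _).trans (norm_fourier_charFun_le μ x)

/-! ### The Fejér law -/

/-- The triangle function `(1 - |x|)⁺`. -/
noncomputable def triangle (x : ℝ) : ℝ := max 0 (1 - |x|)

/-- The Fejér density `(1 - cos 2πx) / (2π²x²)`. -/
noncomputable def fejerDensity (x : ℝ) : ℝ :=
  if x = 0 then 1 else (1 - Real.cos (2 * Real.pi * x)) / (2 * Real.pi ^ 2 * x ^ 2)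

theorem continuous_triangle : Continuous triangle := by
  unfold triangle; fun_prop

theorem triangle_nonneg (x : ℝ) : 0 ≤ triangle x := le_max_left _ _

theorem triangle_le_one (x : ℝ) : triangle x ≤ 1 :=
  max_le zero_le_one (by linarith [abs_nonneg x])

theorem triangle_of_one_le {x : ℝ} (hx : 1 ≤ |x|) : triangle x = 0 :=
  max_eq_left (by linarith)

theorem triangle_of_le_one {x : ℝ} (hx : |x| ≤ 1) : triangle x = 1 - |x| :=
  max_eq_right (by linarith)

theorem triangle_neg (x : ℝ) : triangle (-x) = triangle x := by simp [triangle]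

theorem integrable_triangle : Integrable triangle := by
  refine continuous_triangle.integrable_of_hasCompactSupport ?_
  refine HasCompactSupport.of_support_subset_isCompact (isCompact_Icc (a := -1) (b := 1)) ?_
  intro x hx
  by_contra h
  refine hx (triangle_of_one_le ?_)
  by_contra h'
  exact h (abs_le.1 (not_le.1 h').le)

theorem measurable_fejerDensity : Measurable fejerDensity := by
  unfold fejerDensity
  exact Measurable.ite (measurableSet_singleton 0) measurable_const (by fun_prop)

theorem fejerDensity_nonneg (x : ℝ) : 0 ≤ fejerDensity x := by
  unfold fejerDensity
  split_ifs
  · exact zero_le_one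
  · exact div_nonneg (by linarith [Real.cos_le_one (2 * Real.pi * x)]) (by positivity)

theorem fejerDensity_le_one (x : ℝ) : fejerDensity x ≤ 1 := by
  unfold fejerDensity
  split_ifs with h
  · exact le_rfl
  · have := Real.one_sub_sq_div_two_le_cos (x := 2 * Real.pi * x)
    rw [div_le_one (by positivity)]
    nlinarith

theorem fejerDensity_le {x : ℝ} (hx : x ≠ 0) : fejerDensity x ≤ 1 / (Real.pi ^ 2 * x ^ 2) := by
  rw [fejerDensity, if_neg hx, div_le_div_iff₀ (by positivity) (by positivity)]
  have h := Real.neg_one_le_cos (2 * Real.pi * x)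
  have : 0 ≤ Real.pi ^ 2 * x ^ 2 := by positivity
  nlinarith

theorem fejerDensity_le_two_div (x : ℝ) : fejerDensity x ≤ 2 * (1 + x ^ 2)⁻¹ := by
  rcases le_total (x ^ 2) 1 with h | h
  · refine (fejerDensity_le_one x).trans ?_
    rw [← div_eq_mul_inv, le_div_iff₀ (by positivity)]; linarith
  · have hx : x ≠ 0 := by rintro rfl; norm_num at h
    refine (fejerDensity_le hx).trans ?_
    rw [← div_eq_mul_inv, div_le_div_iff₀ (by positivity) (by positivity)]
    have h3 : 9 ≤ Real.pi ^ 2 := by nlinarith [Real.pi_gt_three]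
    nlinarith [mul_le_mul_of_nonneg_right h3 (sq_nonneg x)]

theorem integrable_fejerDensity : Integrable fejerDensity := by
  refine (integrable_inv_one_add_sq.const_mul 2).mono
    measurable_fejerDensity.aestronglyMeasurable (Eventually.of_forall fun x => ?_)
  rw [Real.norm_of_nonneg (fejerDensity_nonneg x)]
  exact (fejerDensity_le_two_div x).trans (le_abs_self _)

/-- Evenness removes the sine part and folds the integral onto [0,1], where it has an explicit
primitive. -/
theorem fourier_triangle (y : ℝ) :
    FourierTransform.fourier (fun x : ℝ => (triangle x : ℂ)) y = fejerDensity y := by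
  have hI : ∀ c : ℝ, ∫ x in (0 : ℝ)..1, (1 - x) * Real.cos (c * x) =
      if c = 0 then 1 / 2 else (1 - Real.cos c) / c ^ 2 := by
    intro c
    split_ifs with hc
    · simp only [hc, zero_mul, Real.cos_zero, mul_one]
      rw [intervalIntegral.integral_sub (by simp) (by simp)]
      simp
      norm_num
    · have hd : ∀ x ∈ Set.uIcc (0 : ℝ) 1, HasDerivAt
          (fun x => (1 - x) * Real.sin (c * x) / c - Real.cos (c * x) / c ^ 2)
          ((1 - x) * Real.cos (c * x)) x := by
        intro x _
        have h1 : HasDerivAt (fun x => c * x) c x := by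
          simpa using (hasDerivAt_id x).const_mul c
        have h2 := (((hasDerivAt_id x).const_sub 1).mul h1.sin).div_const c
        have h3 := h1.cos.div_const (c ^ 2)
        refine (h2.sub h3).congr_deriv ?_
        simp only [id]
        field_simp
        ring
      rw [intervalIntegral.integral_eq_sub_of_hasDerivAt hd
        (Continuous.intervalIntegrable (by fun_prop) _ _)]
      simp
      ring
  have hswap : FourierTransform.fourier (fun x : ℝ => (triangle x : ℂ)) y =
      ∫ x : ℝ, ((triangle x * Real.cos (2 * Real.pi * y * x) : ℝ) : ℂ) := by
    have e : ∀ x : ℝ, (Real.fourierChar (-(x * y))) • (triangle x : ℂ) =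
        ((triangle x * Real.cos (2 * Real.pi * y * x) : ℝ) : ℂ)
        - Complex.I * ((triangle x * Real.sin (2 * Real.pi * y * x) : ℝ) : ℂ) := by
      intro x
      rw [Circle.smul_def, Real.fourierChar_apply, smul_eq_mul, Complex.exp_mul_I]
      rw [show 2 * Real.pi * -(x * y) = -(2 * Real.pi * y * x) by ring]
      push_cast
      rw [Complex.cos_neg, Complex.sin_neg]
      ring
    have hb : ∀ f : ℝ → ℝ, Continuous f → (∀ x, |f x| ≤ 1) →
        Integrable fun x => triangle x * f x := fun f hf hf1 => by
      refine integrable_triangle.mono (continuous_triangle.mul hf).aestronglyMeasurable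
        (Eventually.of_forall fun x => ?_)
      rw [norm_mul]
      exact mul_le_of_le_one_right (norm_nonneg _) (hf1 x)
    have hcos := hb (fun x => Real.cos (2 * Real.pi * y * x)) (by fun_prop)
      fun x => Real.abs_cos_le_one _
    have hsin := hb (fun x => Real.sin (2 * Real.pi * y * x)) (by fun_prop)
      fun x => Real.abs_sin_le_one _
    rw [Real.fourier_real_eq]
    simp_rw [e]
    rw [integral_sub hcos.ofReal (hsin.ofReal.const_mul _), integral_const_mul]
    have hodd : ∫ x : ℝ, ((triangle x * Real.sin (2 * Real.pi * y * x) : ℝ) : ℂ) = 0 := by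
      have := integral_neg_eq_self
        (fun x : ℝ => ((triangle x * Real.sin (2 * Real.pi * y * x) : ℝ) : ℂ)) volume
      simp only [triangle_neg, mul_neg, Real.sin_neg, Complex.ofReal_neg, integral_neg] at this
      have h2 := self_eq_neg.1 this.symm
      exact h2
    rw [hodd, mul_zero, sub_zero]
  rw [hswap, integral_complex_ofReal]
  congr 1
  have heven : ∫ x : ℝ, triangle x * Real.cos (2 * Real.pi * y * x) =
      2 * ∫ x in Set.Ioi (0 : ℝ), triangle x * Real.cos (2 * Real.pi * y * x) := by
    rw [← integral_comp_abs]
    refine integral_congr_ae (Eventually.of_forall fun x => ?_)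
    simp only [triangle, abs_abs]
    rcases abs_choice x with h | h <;> simp [h]
  have h01 : ∫ x in Set.Ioi (0 : ℝ), triangle x * Real.cos (2 * Real.pi * y * x) =
      ∫ x in (0 : ℝ)..1, (1 - x) * Real.cos (2 * Real.pi * y * x) := by
    rw [intervalIntegral.integral_of_le zero_le_one]
    rw [setIntegral_eq_of_subset_of_forall_sdiff_eq_zero measurableSet_Ioi
      (show Set.Ioc (0 : ℝ) 1 ⊆ Set.Ioi 0 from fun x hx => hx.1)]
    · refine setIntegral_congr_fun measurableSet_Ioc fun x hx => ?_
      have : |x| = x := abs_of_pos hx.1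
      simp only [triangle_of_le_one (this.trans_le hx.2), this]
    · intro x hx
      have hx1 : 1 < x := by
        by_contra h; exact hx.2 ⟨hx.1, not_lt.1 h⟩
      rw [triangle_of_one_le (hx1.le.trans (le_abs_self x)), zero_mul]
  rw [heven, h01, hI, fejerDensity]
  by_cases hy : y = 0
  · simp [hy]
  · rw [if_neg hy, if_neg (by simp [Real.pi_ne_zero, hy])]
    field_simp

/-- Inversion applies because both functions are integrable. Its value at 0 gives total mass one,
and its full form gives a compactly supported characteristic function. -/
theorem fourierInv_fejerDensity :
    FourierTransformInv.fourierInv (fun x : ℝ => (fejerDensity x : ℂ))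
      = fun x : ℝ => (triangle x : ℂ) := by
  have h : FourierTransform.fourier (fun x : ℝ => (triangle x : ℂ))
      = fun x : ℝ => (fejerDensity x : ℂ) := funext fourier_triangle
  rw [← h]
  exact Continuous.fourierInv_fourier_eq (Complex.continuous_ofReal.comp continuous_triangle)
    integrable_triangle.ofReal (h ▸ integrable_fejerDensity.ofReal)

theorem integral_fejerDensity : ∫ x, fejerDensity x = 1 := by
  have := congrFun fourierInv_fejerDensity 0
  rw [Real.fourierInv_eq] at this
  simp only [inner_zero_right, AddChar.map_zero_eq_one, one_smul] at this
  rw [integral_complex_ofReal] at this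
  have h := Complex.ofReal_injective this
  rw [h, triangle_of_le_one (by simp)]; simp

/-- The Fejér law, with density `fejerDensity`. -/
noncomputable def fejerLaw : Measure ℝ :=
  volume.withDensity fun x => ENNReal.ofReal (fejerDensity x)

instance : IsProbabilityMeasure fejerLaw := by
  refine ⟨?_⟩
  rw [fejerLaw, withDensity_apply _ MeasurableSet.univ, Measure.restrict_univ,
    ← ofReal_integral_eq_lintegral_ofReal integrable_fejerDensity
      (Eventually.of_forall fejerDensity_nonneg), integral_fejerDensity, ENNReal.ofReal_one]

theorem charFun_fejerLaw (ξ : ℝ) : charFun fejerLaw ξ = triangle (ξ / (2 * Real.pi)) := by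
  rw [charFun_apply_real, fejerLaw]
  rw [integral_withDensity_eq_integral_toReal_smul
    measurable_fejerDensity.ennreal_ofReal (Eventually.of_forall fun _ => ENNReal.ofReal_lt_top)]
  have := congrFun fourierInv_fejerDensity (ξ / (2 * Real.pi))
  rw [← this, Real.fourierInv_eq']
  refine integral_congr_ae (Eventually.of_forall fun x => ?_)
  simp only [ENNReal.toReal_ofReal (fejerDensity_nonneg x), Complex.real_smul, smul_eq_mul]
  rw [mul_comm, RCLike.inner_apply]
  congr 3
  simp only [conj_trivial]
  push_cast
  field_simp

theorem fejerLaw_real_abs_gt_le {h : ℝ} (hh : 0 < h) :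
    fejerLaw.real {x | h < |x|} ≤ 2 / (Real.pi ^ 2 * h) := by
  have hms : MeasurableSet {x : ℝ | h < |x|} := measurableSet_lt measurable_const measurable_norm
  have e : fejerLaw.real {x | h < |x|} = ∫ x in {x : ℝ | h < |x|}, fejerDensity x := by
    rw [measureReal_def, fejerLaw, withDensity_apply _ hms,
      ← ofReal_integral_eq_lintegral_ofReal integrable_fejerDensity.integrableOn
      (Eventually.of_forall fejerDensity_nonneg), ENNReal.toReal_ofReal
        (integral_nonneg fejerDensity_nonneg)]
  have hset : {x : ℝ | h < |x|} = Set.Ioi h ∪ Set.Iio (-h) := by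
    ext x; simp only [Set.mem_ofPred_eq, lt_abs, Set.mem_union, Set.mem_Ioi, Set.mem_Iio]
    exact or_congr_right lt_neg
  have hneg : ∫ x in Set.Iio (-h), fejerDensity x = ∫ x in Set.Ioi h, fejerDensity x := by
    rw [← integral_Iic_eq_integral_Iio, ← integral_comp_neg_Ioi]
    refine setIntegral_congr_fun measurableSet_Ioi fun x _ => ?_
    simp [fejerDensity]
  have hpos : ∫ x in Set.Ioi h, fejerDensity x ≤ 1 / (Real.pi ^ 2 * h) := by
    have h1 := integrableOn_Ioi_rpow_of_lt (show (-2 : ℝ) < -1 by norm_num) hh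
    calc ∫ x in Set.Ioi h, fejerDensity x
        ≤ ∫ x in Set.Ioi h, (1 / Real.pi ^ 2) * x ^ (-2 : ℝ) := by
          refine setIntegral_mono_on integrable_fejerDensity.integrableOn (h1.const_mul _)
            measurableSet_Ioi fun x hx => ?_
          have hx0 : 0 < x := hh.trans hx
          refine (fejerDensity_le hx0.ne').trans (le_of_eq ?_)
          rw [Real.rpow_neg hx0.le, Real.rpow_two]
          field_simp
      _ = 1 / (Real.pi ^ 2 * h) := by
          rw [integral_const_mul, integral_Ioi_rpow_of_lt (by norm_num) hh]
          norm_num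
          rw [Real.rpow_neg_one]
          ring
  rw [e, hset, setIntegral_union (by
    rw [Set.disjoint_left]; intro x hx hx'; simp only [Set.mem_Ioi, Set.mem_Iio] at hx hx'; linarith)
    measurableSet_Iio integrable_fejerDensity.integrableOn integrable_fejerDensity.integrableOn,
    hneg]
  calc _ ≤ 1 / (Real.pi ^ 2 * h) + 1 / (Real.pi ^ 2 * h) := add_le_add hpos hpos
    _ = _ := by ring

/-! ### The Berry-Esseen smoothing inequality -/

theorem cdf_conv (μ V : Measure ℝ) [IsProbabilityMeasure μ] [IsProbabilityMeasure V] (x : ℝ) :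
    cdf (μ.conv V) x = ∫ y, cdf μ (x - y) ∂V := by
  have hm : Measurable fun z : ℝ × ℝ => z.1 + z.2 := by fun_prop
  rw [cdf_eq_real, measureReal_def, Measure.conv, Measure.map_apply hm measurableSet_Iic,
    Measure.prod_apply_symm (hm measurableSet_Iic), ← integral_toReal]
  · refine integral_congr_ae (Eventually.of_forall fun y => ?_)
    simp only
    rw [cdf_eq_real, measureReal_def]
    congr 2
    ext z
    simp [le_sub_iff_add_le]
  · exact (measurable_measure_prodMk_right (hm measurableSet_Iic)).aemeasurable
  · exact Eventually.of_forall fun _ => measure_lt_top _ _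

theorem abs_cdf_sub_cdf_le_one (μ ν : Measure ℝ) (x : ℝ) : |cdf μ x - cdf ν x| ≤ 1 := by
  rw [abs_le]
  constructor <;> linarith [cdf_nonneg μ x, cdf_nonneg ν x, cdf_le_one μ x, cdf_le_one ν x]

theorem bddAbove_abs_cdf_sub_cdf (μ ν : Measure ℝ) :
    BddAbove (Set.range fun x => |cdf μ x - cdf ν x|) :=
  ⟨1, by rintro _ ⟨x, rfl⟩; exact abs_cdf_sub_cdf_le_one μ ν x⟩

theorem abs_cdf_sub_cdf_le_kolmogorovDist (μ ν : Measure ℝ) (x : ℝ) :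
    |cdf μ x - cdf ν x| ≤ kolmogorovDist μ ν :=
  le_ciSup (bddAbove_abs_cdf_sub_cdf μ ν) x

/-- Smoothing by a law that puts mass at least `3/4` on `[-h, h]`. -/
theorem kolmogorovDist_le_of_conv (μ ν V : Measure ℝ) [IsProbabilityMeasure μ]
    [IsProbabilityMeasure ν] [IsProbabilityMeasure V] {A B h : ℝ}
    (hG : ∀ x y, x ≤ y → cdf ν y - cdf ν x ≤ A * (y - x)) (hh : 0 ≤ h)
    (hV : V.real {y | h < |y|} ≤ 1 / 4)
    (hB : ∀ x, |cdf (μ.conv V) x - cdf (ν.conv V) x| ≤ B) :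
    kolmogorovDist μ ν ≤ 2 * B + 4 * A * h := by
  have hms : MeasurableSet {x : ℝ | h < |x|} := measurableSet_lt measurable_const measurable_norm
  have hA : 0 ≤ A := by
    have := hG 0 1 zero_le_one
    have := (monotone_cdf ν) (zero_le_one (α := ℝ))
    linarith
  set S := kolmogorovDist μ ν with hS
  have hΔS : ∀ x, |cdf μ x - cdf ν x| ≤ S := abs_cdf_sub_cdf_le_kolmogorovDist μ ν
  have hS0 : 0 ≤ S := (abs_nonneg _).trans (hΔS 0)
  have hint : ∀ (ρ : Measure ℝ) (x : ℝ), Integrable (fun y => cdf ρ (x - y)) V := by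
    intro ρ x
    refine (integrable_const (1 : ℝ)).mono
      ((monotone_cdf ρ).measurable.comp (by fun_prop)).aestronglyMeasurable
      (Eventually.of_forall fun y => ?_)
    rw [Real.norm_of_nonneg (cdf_nonneg _ _)]
    simpa using cdf_le_one ρ _
  have hB' : ∀ x, |∫ y, (cdf μ (x - y) - cdf ν (x - y)) ∂V| ≤ B := by
    intro x
    rw [integral_sub (hint μ x) (hint ν x), ← cdf_conv, ← cdf_conv]
    exact hB x
  -- If F - G = a ≥ 0 at x, then F - G ≥ a - 2Ah on [x, x+2h], as F increases and G has slope at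
  -- most A. Averaging around x + h, mass at least 3/4 sees this lower bound and the rest sees at
  -- least -S, which costs at most 2S · 1/4. If F - G is negative at x, the same works around x - h.
  have key : ∀ (f : ℝ → ℝ) (a : ℝ), Integrable f V → a ≤ S → (∀ y, |y| ≤ h → a - 2 * A * h ≤ f y) →
      (∀ y, -S ≤ f y) → a ≤ |∫ y, f y ∂V| + 2 * A * h + S / 2 := by
    intro f a hf haS h1 h2
    have hi : Integrable (fun y => (a - 2 * A * h) -
        {y : ℝ | h < |y|}.indicator (fun _ => 2 * S) y) V :=
      (integrable_const _).sub ((integrable_const _).indicator hms)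
    have : ∫ y, ((a - 2 * A * h) - {y : ℝ | h < |y|}.indicator (fun _ => 2 * S) y) ∂V
        ≤ ∫ y, f y ∂V := by
      refine integral_mono hi hf fun y => ?_
      by_cases hy : h < |y|
      · rw [Set.indicator_of_mem (show y ∈ {y : ℝ | h < |y|} from hy)]
        have := h2 y
        have : 0 ≤ A * h := mul_nonneg hA hh
        linarith
      · rw [Set.indicator_of_notMem (show y ∉ {y : ℝ | h < |y|} from hy), sub_zero]
        exact h1 y (not_lt.1 hy)
    rw [integral_sub (integrable_const _) ((integrable_const _).indicator hms),
      integral_indicator_const _ hms] at this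
    simp only [integral_const, probReal_univ, smul_eq_mul] at this
    have := le_abs_self (∫ y, f y ∂V)
    nlinarith
  have hpt : ∀ x, |cdf μ x - cdf ν x| ≤ B + 2 * A * h + S / 2 := by
    intro x
    have hmono := monotone_cdf μ
    rcases le_total 0 (cdf μ x - cdf ν x) with hx | hx
    · have := key (fun y => cdf μ (x + h - y) - cdf ν (x + h - y)) |cdf μ x - cdf ν x|
        ((hint μ _).sub (hint ν _)) (hΔS x) (fun y hy => ?_)
        (fun y => (abs_le.1 (hΔS _)).1)
      · have := hB' (x + h)
        linarith
      · rw [abs_of_nonneg hx]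
        obtain ⟨h1, h2⟩ := abs_le.1 hy
        have e1 := hmono (show x ≤ x + h - y by linarith)
        have e2 := hG x (x + h - y) (by linarith)
        have e3 : A * (x + h - y - x) ≤ A * (2 * h) := mul_le_mul_of_nonneg_left (by linarith) hA
        linarith
    · have := key (fun y => -(cdf μ (x - h - y) - cdf ν (x - h - y))) |cdf μ x - cdf ν x|
        ((hint μ _).sub (hint ν _)).neg (hΔS x) (fun y hy => ?_)
        (fun y => neg_le_neg (abs_le.1 (hΔS _)).2)
      · have h3 := hB' (x - h)
        rw [integral_neg, abs_neg] at this
        linarith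
      · rw [abs_of_nonpos hx]
        obtain ⟨h1, h2⟩ := abs_le.1 hy
        have e1 := hmono (show x - h - y ≤ x by linarith)
        have e2 := hG (x - h - y) x (by linarith)
        have e3 : A * (x - (x - h - y)) ≤ A * (2 * h) := mul_le_mul_of_nonneg_left (by linarith) hA
        linarith
  -- The supremum occurs on both sides, and the half on the right is absorbed; S is finite since S ≤
  -- 1.
  have : S ≤ B + 2 * A * h + S / 2 := ciSup_le hpt
  linarith

/-- The Fejér law with characteristic function supported in `[-T, T]`. -/
noncomputable def fejerLawScaled (T : ℝ) : Measure ℝ := fejerLaw.map fun x => (2 * Real.pi / T) * x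

instance (T : ℝ) : IsProbabilityMeasure (fejerLawScaled T) :=
  Measure.isProbabilityMeasure_map (by fun_prop)

theorem charFun_fejerLawScaled {T : ℝ} (ξ : ℝ) :
    charFun (fejerLawScaled T) ξ = triangle (ξ / T) := by
  rw [fejerLawScaled, charFun_map_mul, charFun_fejerLaw]
  congr 2
  field_simp

/-- In the unscaled law this is the tail beyond 1, at most 2/π² ≤ 1/4. It fixes h = 2π/T in
`kolmogorovDist_le_of_conv`. -/
theorem fejerLawScaled_real_abs_gt_le {T : ℝ} (hT : 0 < T) :
    (fejerLawScaled T).real {y | 2 * Real.pi / T < |y|} ≤ 1 / 4 := by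
  have hms : MeasurableSet {x : ℝ | 2 * Real.pi / T < |x|} :=
    measurableSet_lt measurable_const measurable_norm
  have hp : 0 < 2 * Real.pi / T := by positivity
  rw [fejerLawScaled, map_measureReal_apply (by fun_prop) hms]
  have : (fun x => (2 * Real.pi / T) * x) ⁻¹' {x : ℝ | 2 * Real.pi / T < |x|} = {x | 1 < |x|} := by
    ext x
    simp only [Set.mem_preimage, Set.mem_ofPred_eq, abs_mul, abs_of_pos hp]
    exact lt_mul_iff_one_lt_right hp
  rw [this]
  refine (fejerLaw_real_abs_gt_le one_pos).trans ?_
  rw [div_le_div_iff₀ (by positivity) (by norm_num)]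
  nlinarith [Real.pi_gt_three]

theorem integrable_charFun_conv_fejerLawScaled (μ : Measure ℝ) [IsProbabilityMeasure μ] {T : ℝ}
    (hT : 0 < T) : Integrable fun ξ : ℝ => charFun (μ.conv (fejerLawScaled T)) ξ := by
  have h : Integrable fun ξ : ℝ => triangle (ξ / T) := integrable_triangle.comp_div hT.ne'
  refine h.mono measurable_charFun.aestronglyMeasurable (Eventually.of_forall fun ξ => ?_)
  rw [charFun_conv, norm_mul, charFun_fejerLawScaled, Complex.norm_real]
  exact mul_le_of_le_one_left (norm_nonneg _) (norm_charFun_le_one _)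

/-- After smoothing, the difference D of characteristic functions lives on [-T, T]. The difference
of distribution functions is the Fourier transform of D(2πξ)/(-2πiξ): both have the same derivative
and both vanish at +∞. The bound is the L¹ norm of that function, and the substitution s = 2πξ
produces 1/(2π). -/
theorem abs_cdf_conv_sub_cdf_conv_le (μ ν : Measure ℝ) [IsProbabilityMeasure μ]
    [IsProbabilityMeasure ν] {T : ℝ} (hT : 0 < T)
    (hint : IntegrableOn (fun ξ : ℝ => ‖charFun μ ξ - charFun ν ξ‖ / |ξ|) (Set.Icc (-T) T)) (x : ℝ) :
    |cdf (μ.conv (fejerLawScaled T)) x - cdf (ν.conv (fejerLawScaled T)) x| ≤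
      1 / (2 * Real.pi) * ∫ ξ in Set.Icc (-T) T, ‖charFun μ ξ - charFun ν ξ‖ / |ξ| := by
  set V := fejerLawScaled T with hV
  have h2pi : (2 * Real.pi) ≠ 0 := by positivity
  have hμ : Integrable fun ξ : ℝ => charFun (μ.conv V) (2 * Real.pi * ξ) :=
    (integrable_charFun_conv_fejerLawScaled μ hT).comp_mul_left' h2pi
  have hν : Integrable fun ξ : ℝ => charFun (ν.conv V) (2 * Real.pi * ξ) :=
    (integrable_charFun_conv_fejerLawScaled ν hT).comp_mul_left' h2pi
  set k : ℝ → ℝ := fun s => (Set.Icc (-T) T).indicator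
    (fun ξ => ‖charFun μ ξ - charFun ν ξ‖ / |ξ|) s with hk
  have hkint : Integrable k := (integrable_indicator_iff measurableSet_Icc).2 hint
  set D : ℝ → ℂ := fun s => charFun (μ.conv V) s - charFun (ν.conv V) s with hD
  have hDm : Measurable D := measurable_charFun.sub measurable_charFun
  have hDk : ∀ s, ‖D s‖ / |s| ≤ k s := by
    intro s
    simp only [hD, hk, charFun_conv, ← sub_mul, norm_mul, charFun_fejerLawScaled, hV,
      Complex.norm_real, Real.norm_of_nonneg (triangle_nonneg _)]
    by_cases hs : s ∈ Set.Icc (-T) T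
    · rw [Set.indicator_of_mem hs]
      gcongr
      exact mul_le_of_le_one_right (norm_nonneg _) (triangle_le_one _)
    · rw [Set.indicator_of_notMem hs, triangle_of_one_le, mul_zero, zero_div]
      rw [abs_div, abs_of_pos hT, one_le_div hT]
      by_contra h
      exact hs (abs_le.1 (not_le.1 h).le)
  -- At ξ = 0 the division gives 0, which is harmless because D(0) = 0.
  set θ : ℝ → ℂ := fun ξ => D (2 * Real.pi * ξ) / (-2 * Real.pi * Complex.I * ξ) with hθ
  have hθn : ∀ ξ, ‖θ ξ‖ ≤ k (2 * Real.pi * ξ) := by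
    intro ξ
    refine le_trans (le_of_eq ?_) (hDk _)
    simp [hθ, abs_mul]
  have hkint' : Integrable fun ξ => k (2 * Real.pi * ξ) := hkint.comp_mul_left' h2pi
  have hθm : Measurable θ := (hDm.comp (by fun_prop)).div (by fun_prop)
  have hθint : Integrable θ := hkint'.mono' hθm.aestronglyMeasurable
    (Eventually.of_forall hθn)
  have hθmul : ∀ ξ : ℝ, (-2 * Real.pi * Complex.I * ξ) • θ ξ = D (2 * Real.pi * ξ) := by
    intro ξ
    by_cases hξ : ξ = 0
    · subst hξ; simp [hD]
    · have : (-2 * Real.pi * Complex.I * ξ : ℂ) ≠ 0 := by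
        simp [Real.pi_ne_zero, hξ, Complex.I_ne_zero]
      rw [smul_eq_mul, hθ]
      exact mul_div_cancel₀ _ this
  have hθint' : Integrable fun ξ : ℝ => ξ • θ ξ := by
    have : (fun ξ : ℝ => ξ • θ ξ) = fun ξ => (-2 * Real.pi * Complex.I : ℂ)⁻¹ *
        (charFun (μ.conv V) (2 * Real.pi * ξ) - charFun (ν.conv V) (2 * Real.pi * ξ)) := by
      funext ξ
      rw [show charFun (μ.conv V) (2 * Real.pi * ξ) - charFun (ν.conv V) (2 * Real.pi * ξ)
        = D (2 * Real.pi * ξ) from rfl, ← hθmul, Complex.real_smul, smul_eq_mul]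
      have : (-2 * Real.pi * Complex.I : ℂ) ≠ 0 := by
        simp [Real.pi_ne_zero, Complex.I_ne_zero]
      field_simp
    rw [this]
    exact (hμ.sub hν).const_mul _
  have hder : ∀ y, HasDerivAt (fun y => ((cdf (μ.conv V) y : ℝ) : ℂ) - (cdf (ν.conv V) y : ℝ)
      - FourierTransform.fourier θ y) 0 y := by
    intro y
    have h1 := (hasDerivAt_cdf_fourier_charFun (μ.conv V) hμ y).sub
      (hasDerivAt_cdf_fourier_charFun (ν.conv V) hν y)
    have h2 := Real.hasDerivAt_fourier hθint hθint' y
    refine (h1.sub h2).congr_deriv ?_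
    rw [funext hθmul, Real.fourier_eq, Real.fourier_eq, Real.fourier_eq,
      ← integral_sub ((Real.fourierIntegral_convergent_iff _).2 hμ)
        ((Real.fourierIntegral_convergent_iff _).2 hν), sub_eq_zero]
    simp only [hD, smul_sub]
  have hconst := is_const_of_deriv_eq_zero (fun y => (hder y).differentiableAt)
    (fun y => (hder y).deriv)
  -- Riemann-Lebesgue for θ; it identifies the constant as 0.
  have hlim : Tendsto (fun y => ((cdf (μ.conv V) y : ℝ) : ℂ) - (cdf (ν.conv V) y : ℝ)
      - FourierTransform.fourier θ y) atTop (𝓝 0) := by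
    have h1 := (Complex.continuous_ofReal.tendsto 1).comp (tendsto_cdf_atTop (μ.conv V))
    have h2 := (Complex.continuous_ofReal.tendsto 1).comp (tendsto_cdf_atTop (ν.conv V))
    have h3 := (Real.zero_at_infty_fourier θ).mono_left atTop_le_cocompact
    simpa using! (h1.sub h2).sub h3
  have hzero : ((cdf (μ.conv V) x : ℝ) : ℂ) - (cdf (ν.conv V) x : ℝ)
      - FourierTransform.fourier θ x = 0 :=
    tendsto_nhds_unique (tendsto_const_nhds.congr fun y => hconst x y) hlim
  rw [sub_eq_zero] at hzero
  calc |cdf (μ.conv V) x - cdf (ν.conv V) x|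
      = ‖FourierTransform.fourier θ x‖ := by
        rw [← hzero, ← Complex.ofReal_sub, Complex.norm_real, Real.norm_eq_abs]
    _ ≤ ∫ ξ, ‖θ ξ‖ := by
        rw [Real.fourier_eq]
        refine (norm_integral_le_integral_norm _).trans (le_of_eq ?_)
        simp [Circle.norm_smul]
    _ ≤ ∫ ξ, k (2 * Real.pi * ξ) := integral_mono hθint.norm hkint' hθn
    _ = _ := by
        rw [Measure.integral_comp_mul_left, smul_eq_mul, hk,
          integral_indicator measurableSet_Icc, one_div, abs_of_pos (by positivity)]

/-- With B = (2π)⁻¹∫ and h = 2π/T, the bound 2B + 4Ah is exactly π⁻¹∫ + 8πA/T. -/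
theorem isBerryEsseenConst_eight_mul_pi : IsBerryEsseenConst (8 * Real.pi) := by
  intro μ ν hμ hν A T hT hd hA hint x
  have hG : ∀ x y, x ≤ y → cdf ν y - cdf ν x ≤ A * (y - x) := fun x y hxy => by
    have := Convex.norm_image_sub_le_of_norm_deriv_le (f := cdf ν) (C := A) (s := Set.univ)
      (fun z _ => hd z) (fun z _ => hA z) convex_univ (Set.mem_univ x) (Set.mem_univ y)
    rw [Real.norm_eq_abs, Real.norm_eq_abs, abs_of_nonneg (sub_nonneg.2 hxy)] at this
    exact (le_abs_self _).trans this
  have := kolmogorovDist_le_of_conv μ ν (fejerLawScaled T) hG (by positivity)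
    (fejerLawScaled_real_abs_gt_le hT) (abs_cdf_conv_sub_cdf_conv_le μ ν hT hint)
  refine (abs_cdf_sub_cdf_le_kolmogorovDist μ ν x).trans (this.trans (le_of_eq ?_))
  field_simp
  ring

/-! ### Tails of laws in the domain of normal attraction -/

theorem charFun_re (μ : Measure ℝ) [IsProbabilityMeasure μ] (ξ : ℝ) :
    (charFun μ ξ).re = ∫ x, Real.cos (ξ * x) ∂μ := by
  have hI : Integrable (fun x : ℝ => Complex.exp (ξ * x * Complex.I)) μ := by
    refine (integrable_const (1 : ℝ)).mono (by fun_prop) (Eventually.of_forall fun x => ?_)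
    rw [← Complex.ofReal_mul, Complex.norm_exp_ofReal_mul_I]
    simp
  rw [charFun_apply_real, ← RCLike.re_eq_complex_re, ← integral_re hI]
  refine integral_congr_ae (Eventually.of_forall fun x => ?_)
  simp only [RCLike.re_eq_complex_re]
  rw [← Complex.ofReal_mul, Complex.exp_ofReal_mul_I_re]

theorem integrable_cos_mul (μ : Measure ℝ) [IsProbabilityMeasure μ] (ξ : ℝ) :
    Integrable (fun x => Real.cos (ξ * x)) μ :=
  (integrable_const (1 : ℝ)).mono (by fun_prop)
    (Eventually.of_forall fun x => by simpa using Real.abs_cos_le_one _)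

theorem one_sub_charFun_re (μ : Measure ℝ) [IsProbabilityMeasure μ] (ξ : ℝ) :
    1 - (charFun μ ξ).re = ∫ x, (1 - Real.cos (ξ * x)) ∂μ := by
  rw [integral_sub (integrable_const _) (integrable_cos_mul μ ξ), charFun_re]
  simp

/-- Since 2(1 - cos a) = |1 - e^{ia}|², this is the triangle inequality for |e^{ib} - e^{ia}|
followed by (x+y)² ≤ 2x² + 2y². -/
theorem one_sub_cos_sub_le (a b : ℝ) :
    1 - Real.cos (a - b) ≤ 2 * (1 - Real.cos a) + 2 * (1 - Real.cos b) := by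
  rw [Real.cos_sub]
  nlinarith [sq_nonneg (Real.cos a + Real.cos b - 2), sq_nonneg (Real.sin a + Real.sin b),
    Real.sin_sq_add_cos_sq a, Real.sin_sq_add_cos_sq b, Real.cos_le_one a, Real.cos_le_one b,
    sq_nonneg (Real.sin a - Real.sin b), mul_nonneg (sub_nonneg.2 (Real.cos_le_one a))
    (sub_nonneg.2 (Real.cos_le_one b))]

theorem one_sub_charFun_re_sub_le (μ : Measure ℝ) [IsProbabilityMeasure μ] (ξ ζ : ℝ) :
    1 - (charFun μ (ξ - ζ)).re ≤ 2 * (1 - (charFun μ ξ).re) + 2 * (1 - (charFun μ ζ).re) := by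
  have hi : ∀ ξ : ℝ, Integrable (fun x => 1 - Real.cos (ξ * x)) μ := fun ξ =>
    (integrable_const _).sub (integrable_cos_mul μ ξ)
  simp only [one_sub_charFun_re]
  rw [← integral_const_mul, ← integral_const_mul,
    ← integral_add ((hi ξ).const_mul 2) ((hi ζ).const_mul 2)]
  refine integral_mono (hi _) (((hi ξ).const_mul 2).add ((hi ζ).const_mul 2)) fun x => ?_
  simp only [sub_mul]
  exact one_sub_cos_sub_le _ _

theorem norm_charFun_map_sum_div_sub (μ₀ : Measure ℝ) [IsProbabilityMeasure μ₀] (n : ℕ)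
    (b m ξ : ℝ) :
    ‖charFun ((Measure.pi fun _ : Fin n => μ₀).map fun x => (∑ i, x i) / b - m) ξ‖ =
      ‖charFun μ₀ (ξ / b)‖ ^ n := by
  have e2 : ((Measure.pi fun _ : Fin n => μ₀).map fun x => (∑ i, x i) / b - m) =
      (((Measure.pi fun _ : Fin n => μ₀).map fun x => ∑ i, x i).map
        (b⁻¹ * ·)).map (· + (-m)) := by
    rw [Measure.map_map (by fun_prop) (by fun_prop), Measure.map_map (by fun_prop) (by fun_prop)]
    congr 1
    funext x
    simp [div_eq_inv_mul, sub_eq_add_neg]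
  have e3 : ∀ ζ : ℝ, charFun ((Measure.pi fun _ : Fin n => μ₀).map fun x => ∑ i, x i) ζ
      = charFun μ₀ ζ ^ n := fun ζ => by
    rw [charFun_map_sum_pi_eq_prod, Finset.prod_apply]
    simp
  rw [e2, charFun_map_add_const, charFun_map_mul, e3, norm_mul,
    Complex.norm_exp_ofReal_mul_I, mul_one, norm_pow, div_eq_inv_mul]

theorem tendsto_charFun_of_forall_integral_tendsto (μs : ℕ → Measure ℝ) (ν : Measure ℝ)
    [hμs : ∀ n, IsProbabilityMeasure (μs n)] [hν : IsProbabilityMeasure ν]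
    (h : ∀ f : ℝ →ᵇ ℝ, Tendsto (fun n => ∫ x, f x ∂(μs n)) atTop (𝓝 (∫ x, f x ∂ν))) (ξ : ℝ) :
    Tendsto (fun n => charFun (μs n) ξ) atTop (𝓝 (charFun ν ξ)) :=
  ProbabilityMeasure.tendsto_iff_tendsto_charFun (μ := fun n => ⟨μs n, hμs n⟩) (μ₀ := ⟨ν, hν⟩)
    |>.1 (ProbabilityMeasure.tendsto_iff_forall_integral_tendsto.2 h) ξ

/-- The centering m_n contributes only a phase, so it disappears on taking moduli. -/
theorem tendsto_norm_charFun_pow {α a₀ : ℝ} {μ₀ ν : Measure ℝ} [IsProbabilityMeasure μ₀]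
    (hν : IsSymmStable α a₀ ν) (h : InNormalDomain α μ₀ ν) (ξ : ℝ) :
    Tendsto (fun n : ℕ => ‖charFun μ₀ (ξ / (n : ℝ) ^ (1 / α))‖ ^ n) atTop
      (𝓝 (Real.exp (-a₀ * |ξ| ^ α))) := by
  obtain ⟨m, hm⟩ := h
  have := hν.1
  generalize hb : (fun n : ℕ => (n : ℝ) ^ (1 / α)) = b at *
  have hb' : ∀ n : ℕ, (n : ℝ) ^ (1 / α) = b n := fun n => congrFun hb n
  simp only [hb'] at hm ⊢
  have hmeas : ∀ n : ℕ, Measurable fun x : Fin n → ℝ => (∑ i, x i) / b n - m n :=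
    fun n => by fun_prop
  have hprob : ∀ n : ℕ, IsProbabilityMeasure
      ((Measure.pi fun _ : Fin n => μ₀).map fun x => (∑ i, x i) / b n - m n) := fun n =>
    Measure.isProbabilityMeasure_map (hmeas n).aemeasurable
  have hφ := (tendsto_charFun_of_forall_integral_tendsto (fun n : ℕ =>
    (Measure.pi fun _ : Fin n => μ₀).map fun x => (∑ i, x i) / b n - m n) ν (fun f => by
      simp only [integral_map (hmeas _).aemeasurable f.continuous.aestronglyMeasurable]
      exact hm f) ξ).norm
  simp only [norm_charFun_map_sum_div_sub] at hφ
  rwa [hν.2, Complex.norm_real, Real.norm_of_nonneg (Real.exp_pos _).le] at hφ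

/-- |φ|² is the characteristic function of X - X', hence a real one, to which the subadditivity of 1
- Re φ applies. -/
theorem symmetrization_charFun (μ : Measure ℝ) [IsProbabilityMeasure μ] (ξ : ℝ) :
    charFun (μ.conv (μ.map (-1 * ·))) ξ = ((‖charFun μ ξ‖ ^ 2 : ℝ) : ℂ) := by
  have : IsProbabilityMeasure (μ.map (-1 * ·)) := Measure.isProbabilityMeasure_map (by fun_prop)
  rw [charFun_conv, charFun_map_mul, neg_one_mul, charFun_neg, Complex.mul_conj,
    Complex.normSq_eq_norm_sq]

/-- A real function with `n (1 - ψ(ξ n^{-1/α}))` bounded for every `ξ` satisfies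
`1 - ψ(s) = O(s^α)`, if `1 - ψ` is subadditive up to a constant. -/
theorem exists_one_sub_le_mul_rpow {α : ℝ} (hα : 0 < α) (ψ : ℝ → ℝ) (hψ : Continuous ψ)
    (h0 : ∀ s, 0 ≤ ψ s)
    (hsub : ∀ s t, 1 - ψ (s - t) ≤ 2 * (1 - ψ s) + 2 * (1 - ψ t))
    (hb : ∀ ξ, ∃ K : ℕ, ∀ n : ℕ, n * (1 - ψ (ξ / (n : ℝ) ^ (1 / α))) ≤ K) :
    ∃ C, 0 ≤ C ∧ ∀ s, 0 < s → 1 - ψ s ≤ C * s ^ α := by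
  -- The bound K depends on ξ. These closed sets cover the line, so by Baire one of them contains a
  -- ball.
  let E : ℕ → Set ℝ := fun K => {ξ | ∀ n : ℕ, n * (1 - ψ (ξ / (n : ℝ) ^ (1 / α))) ≤ K}
  have hE : ∀ K, IsClosed (E K) := fun K => by
    simp only [E, Set.ofPred_forall]
    exact isClosed_iInter fun n => isClosed_le (by fun_prop) continuous_const
  have hU : ⋃ K, E K = Set.univ := by
    ext ξ
    simpa [E] using hb ξ
  obtain ⟨K, ξ₀, hξ₀⟩ := nonempty_interior_of_iUnion_of_closed hE hU
  obtain ⟨r, hr, hball⟩ := Metric.isOpen_iff.1 isOpen_interior ξ₀ hξ₀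
  -- Differences of points of that ball fill a neighbourhood of 0, and subadditivity turns the two
  -- bounds K into 2K + 2K.
  have hunif : ∀ ξ, |ξ| < r → ∀ n : ℕ, n * (1 - ψ (ξ / (n : ℝ) ^ (1 / α))) ≤ 4 * K := by
    intro ξ hξ n
    have h1 : ξ₀ + ξ ∈ E K := interior_subset (hball (by simpa [Real.dist_eq] using hξ))
    have h2 : ξ₀ ∈ E K := interior_subset hξ₀
    have h3 := hsub ((ξ₀ + ξ) / (n : ℝ) ^ (1 / α)) (ξ₀ / (n : ℝ) ^ (1 / α))
    rw [← sub_div, add_sub_cancel_left] at h3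
    have h4 := mul_le_mul_of_nonneg_left h3 n.cast_nonneg
    have := h1 n
    have := h2 n
    linarith
  -- For s ≤ r/2 take n = ⌊y⌋ with y = (r/(2s))^α: then s n^{1/α} < r and y ≤ 2n, so 4K/n ≤ 8K/y.
  -- The summand 1 covers s > r/2, where 1 - ψ ≤ 1 suffices.
  refine ⟨(8 * K + 1) * (2 / r) ^ α, by positivity, fun s hs => ?_⟩
  have hrw : (2 / r) ^ α * s ^ α = (s / (r / 2)) ^ α := by
    rw [← Real.mul_rpow (by positivity) hs.le]; congr 1; field_simp
  rw [mul_assoc, hrw]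
  have hr2 : 0 < r / 2 := by positivity
  rcases le_or_gt s (r / 2) with h | h
  · set y := (r / 2 / s) ^ α with hy
    have hy1 : 1 ≤ y := Real.one_le_rpow ((one_le_div hs).2 h) hα.le
    have hinv : (s / (r / 2)) ^ α = y⁻¹ := by
      rw [hy, ← Real.inv_rpow (by positivity), inv_div]
    set n := ⌊y⌋₊ with hn
    have hn1 : 1 ≤ n := Nat.one_le_floor_iff y |>.2 hy1
    have hn0 : (0 : ℝ) < n := by exact_mod_cast hn1
    have hny : (n : ℝ) ≤ y := Nat.floor_le (by linarith)
    have hyn : y ≤ 2 * n := by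
      have := Nat.lt_floor_add_one y
      have : (1 : ℝ) ≤ n := by exact_mod_cast hn1
      linarith
    have hpow : 0 < (n : ℝ) ^ (1 / α) := by positivity
    have hle : (n : ℝ) ^ (1 / α) ≤ r / 2 / s := by
      calc (n : ℝ) ^ (1 / α) ≤ y ^ (1 / α) := Real.rpow_le_rpow hn0.le hny (by positivity)
        _ = r / 2 / s := by
          rw [hy, ← Real.rpow_mul (by positivity), mul_one_div_cancel hα.ne', Real.rpow_one]
    have hxi : |s * (n : ℝ) ^ (1 / α)| < r := by
      rw [abs_of_pos (by positivity)]
      calc s * (n : ℝ) ^ (1 / α) ≤ s * (r / 2 / s) := by gcongr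
        _ = r / 2 := by field_simp
        _ < r := by linarith
    have := hunif _ hxi n
    rw [mul_div_cancel_right₀ _ hpow.ne'] at this
    rw [hinv]
    have hK : (0 : ℝ) ≤ K := K.cast_nonneg
    calc 1 - ψ s ≤ 4 * K / n := by rw [le_div_iff₀ hn0]; linarith
      _ ≤ 8 * K / y := by
        rw [div_le_div_iff₀ hn0 (by linarith)]
        nlinarith
      _ ≤ (8 * K + 1) * y⁻¹ := by
        rw [div_eq_mul_inv]
        gcongr
        linarith
  · have h1 : 1 ≤ (s / (r / 2)) ^ α := Real.one_le_rpow ((one_le_div hr2).2 h.le) hα.le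
    have hK : (0 : ℝ) ≤ K := K.cast_nonneg
    have := h0 s
    nlinarith

/-- From ψ ≤ e^{-(1-ψ)}, a lower bound L/2 on ψⁿ gives n(1 - ψ) ≤ -log(L/2). The finitely many
earlier n are bounded by N, because ψ ≥ 0. -/
theorem bounded_of_tendsto_pow {ψ : ℕ → ℝ} (h0 : ∀ n, 0 ≤ ψ n) {L : ℝ} (hL : 0 < L)
    (h : Tendsto (fun n => ψ n ^ n) atTop (𝓝 L)) : ∃ K : ℕ, ∀ n : ℕ, n * (1 - ψ n) ≤ K := by
  obtain ⟨N, hN⟩ := eventually_atTop.1 (h.eventually_const_lt (half_lt_self hL))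
  obtain ⟨K, hK⟩ := exists_nat_ge (-Real.log (L / 2))
  refine ⟨max N K, fun n => ?_⟩
  push_cast
  rcases le_total n N with hn | hn
  · refine le_max_of_le_left ?_
    have : (n : ℝ) ≤ N := by exact_mod_cast hn
    have := h0 n
    nlinarith [n.cast_nonneg (α := ℝ)]
  · refine le_max_of_le_right (le_trans ?_ hK)
    have h1 : ψ n ≤ Real.exp (-(1 - ψ n)) := by
      have := Real.add_one_le_exp (-(1 - ψ n)); linarith
    have h2 : L / 2 < Real.exp (-(n * (1 - ψ n))) := by
      refine (hN n hn).trans_le ((pow_le_pow_left₀ (h0 n) h1 n).trans (le_of_eq ?_))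
      rw [← Real.exp_nat_mul]; congr 1; ring
    have := (Real.log_lt_iff_lt_exp (by positivity)).2 h2
    linarith

theorem exists_symmetrization_charFun_le {α a₀ : ℝ} (hα : 0 < α) {μ₀ ν : Measure ℝ}
    [IsProbabilityMeasure μ₀] (hν : IsSymmStable α a₀ ν) (h : InNormalDomain α μ₀ ν) :
    ∃ C, 0 ≤ C ∧ ∀ s, 0 < s → 1 - ‖charFun μ₀ s‖ ^ 2 ≤ C * s ^ α := by
  have : IsProbabilityMeasure (μ₀.map (-1 * ·)) := Measure.isProbabilityMeasure_map (by fun_prop)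
  refine exists_one_sub_le_mul_rpow hα (fun s => ‖charFun μ₀ s‖ ^ 2)
    (continuous_charFun.norm.pow 2) (fun s => by positivity) (fun s t => ?_) (fun ξ => ?_)
  · simpa only [symmetrization_charFun, Complex.ofReal_re] using
      one_sub_charFun_re_sub_le (μ₀.conv (μ₀.map (-1 * ·))) s t
  · refine bounded_of_tendsto_pow (ψ := fun n : ℕ => ‖charFun μ₀ (ξ / (n : ℝ) ^ (1 / α))‖ ^ 2)
      (fun n => by positivity) (L := Real.exp (-a₀ * |ξ| ^ α) ^ 2) (by positivity) ?_
    refine ((tendsto_norm_charFun_pow hν h ξ).pow 2).congr fun n => ?_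
    rw [← pow_mul, ← pow_mul, mul_comm]

/-- The tail of X - X' beyond x is bounded by an average of 1 - |φ|² over |t| ≤ 2/x. To
desymmetrize, choose k with P(|X'| ≤ k) ≥ 1/2: on that independent event |X| > x + k forces |X - X'|
> x. -/
theorem exists_tail_le_of_symmetrization {α C : ℝ} (hα : 0 < α) (μ : Measure ℝ)
    [IsProbabilityMeasure μ] (hC0 : 0 ≤ C) (hC : ∀ s, 0 < s → 1 - ‖charFun μ s‖ ^ 2 ≤ C * s ^ α) :
    ∃ C', 0 ≤ C' ∧ ∀ x, 0 < x → μ.real {y | x < |y|} ≤ C' * x ^ (-α) := by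
  have : IsProbabilityMeasure (μ.map (-1 * ·)) := Measure.isProbabilityMeasure_map (by fun_prop)
  set ρ := μ.conv (μ.map (-1 * ·)) with hρ
  have hms : ∀ x : ℝ, MeasurableSet {y : ℝ | x < |y|} := fun x =>
    measurableSet_lt measurable_const measurable_norm
  have htail : ∀ x, 0 < x → ρ.real {y | x < |y|} ≤ 2 * C * 2 ^ α * x ^ (-α) := by
    intro x hx
    refine (measureReal_abs_gt_le_integral_charFun hx).trans ?_
    have hbd : ‖∫ t in (-2 * x⁻¹)..(2 * x⁻¹), 1 - charFun ρ t‖ ≤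
        (C * (2 * x⁻¹) ^ α) * |2 * x⁻¹ - -2 * x⁻¹| := by
      refine intervalIntegral.norm_integral_le_of_norm_le_const fun t ht => ?_
      rw [symmetrization_charFun, ← Complex.ofReal_one, ← Complex.ofReal_sub, Complex.norm_real,
        Real.norm_of_nonneg (sub_nonneg.2 (pow_le_one₀ (norm_nonneg _) (norm_charFun_le_one t)))]
      have hx' : 0 < x⁻¹ := inv_pos.2 hx
      rw [Set.uIoc_of_le (by linarith)] at ht
      have habs : |t| ≤ 2 * x⁻¹ := abs_le.2 ⟨by linarith [ht.1], ht.2⟩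
      rcases eq_or_ne t 0 with rfl | ht0
      · simp only [charFun_zero, probReal_univ, Complex.ofReal_one, norm_one, one_pow, sub_self]
        positivity
      · have he : ‖charFun μ t‖ = ‖charFun μ |t|‖ := by
          rcases abs_choice t with h | h <;> rw [h]
          rw [charFun_neg, RCLike.norm_conj]
        rw [he]
        refine (hC _ (abs_pos.2 ht0)).trans ?_
        gcongr
    have hx' : 0 < x⁻¹ := inv_pos.2 hx
    calc 2⁻¹ * x * ‖∫ t in (-2 * x⁻¹)..(2 * x⁻¹), 1 - charFun ρ t‖
        ≤ 2⁻¹ * x * ((C * (2 * x⁻¹) ^ α) * |2 * x⁻¹ - -2 * x⁻¹|) := by gcongr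
      _ = 2 * C * 2 ^ α * x ^ (-α) := by
        rw [show 2 * x⁻¹ - -2 * x⁻¹ = 4 * x⁻¹ by ring, abs_of_pos (by positivity),
          Real.mul_rpow (by norm_num) hx'.le, Real.inv_rpow hx.le, Real.rpow_neg hx.le]
        field_simp
        ring
  obtain ⟨k, hk0, hk⟩ : ∃ k : ℝ, 0 < k ∧ 1 / 2 ≤ μ.real {y | |y| ≤ k} := by
    have hmono : Monotone fun n : ℕ => {y : ℝ | |y| ≤ n} := fun m n hmn y hy => by
      have : (m : ℝ) ≤ n := by exact_mod_cast hmn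
      exact le_trans (show |y| ≤ m from hy) this
    have hlim := tendsto_measure_iUnion_atTop (μ := μ) hmono
    have hU : ⋃ n : ℕ, {y : ℝ | |y| ≤ n} = Set.univ := by
      ext y; simpa using exists_nat_ge |y|
    rw [hU, measure_univ] at hlim
    have h2 := (ENNReal.tendsto_toReal ENNReal.one_ne_top).comp hlim
    obtain ⟨n, hn1, hn2⟩ := ((h2.eventually_const_lt
      (show (1 / 2 : ℝ) < (1 : ℝ≥0∞).toReal by norm_num)).and (eventually_ge_atTop 1)).exists
    exact ⟨n, by exact_mod_cast hn2, hn1.le⟩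
  have hprod : ∀ x, μ.real {y | x + k < |y|} ≤ 2 * ρ.real {y | x < |y|} := by
    intro x
    have hsub : {y : ℝ | x + k < |y|} ×ˢ {y : ℝ | |y| ≤ k} ⊆
        (fun z : ℝ × ℝ => z.1 + -1 * z.2) ⁻¹' {y | x < |y|} := by
      rintro ⟨y, z⟩ ⟨hy, hz⟩
      simp only [Set.mem_ofPred_eq, Set.mem_preimage] at hy hz ⊢
      have := abs_sub_abs_le_abs_sub y z
      rw [show y + -1 * z = y - z by ring]
      linarith
    have hρe : ρ = (μ.prod μ).map (fun z : ℝ × ℝ => z.1 + -1 * z.2) := by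
      have : μ.prod (μ.map (-1 * ·)) = (μ.prod μ).map (Prod.map id (-1 * ·)) := by
        rw [← Measure.map_prod_map _ _ measurable_id (by fun_prop), Measure.map_id]
      rw [hρ, Measure.conv, this, Measure.map_map (by fun_prop) (by fun_prop)]
      rfl
    have h1 : (μ.prod μ).real ({y : ℝ | x + k < |y|} ×ˢ {y : ℝ | |y| ≤ k}) ≤
        ρ.real {y | x < |y|} := by
      rw [hρe, map_measureReal_apply (by fun_prop) (hms x)]
      exact measureReal_mono hsub
    rw [measureReal_prod_prod] at h1
    have h0 : 0 ≤ μ.real {y : ℝ | x + k < |y|} := measureReal_nonneg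
    nlinarith
  -- For x ≥ 2k one has x/2 + k ≤ x, which gives the first summand. For x ≤ 2k the second summand
  -- makes the bound at least 1.
  refine ⟨4 * C * 2 ^ α * 2 ^ α + (2 * k) ^ α, by positivity, fun x hx => ?_⟩
  have hxα : 0 < x ^ (-α) := Real.rpow_pos_of_pos hx _
  rcases le_total x (2 * k) with h | h
  · have h1 : 1 ≤ (2 * k) ^ α * x ^ (-α) := by
      rw [Real.rpow_neg hx.le, ← div_eq_mul_inv, one_le_div (by positivity)]
      exact Real.rpow_le_rpow hx.le h hα.le
    have h2 : 0 ≤ 4 * C * 2 ^ α * 2 ^ α * x ^ (-α) := by positivity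
    have h3 : μ.real {y | x < |y|} ≤ 1 := measureReal_le_one
    linarith
  · have h1 : μ.real {y | x < |y|} ≤ 2 * ρ.real {y | x / 2 < |y|} := by
      refine le_trans (measureReal_mono fun y hy => ?_) (hprod (x / 2))
      simp only [Set.mem_ofPred_eq] at hy ⊢
      linarith
    have h2 := htail (x / 2) (by positivity)
    have h3 : (x / 2) ^ (-α) = 2 ^ α * x ^ (-α) := by
      rw [Real.div_rpow hx.le (by norm_num), Real.rpow_neg (by norm_num : (0 : ℝ) ≤ 2)]
      field_simp
    rw [h3] at h2
    have h4 : 0 ≤ (2 * k) ^ α * x ^ (-α) := by positivity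
    linarith

theorem exists_tail_le {α a₀ : ℝ} (hα : 0 < α) {μ₀ ν : Measure ℝ}
    [IsProbabilityMeasure μ₀] (hν : IsSymmStable α a₀ ν) (h : InNormalDomain α μ₀ ν) :
    ∃ C, 0 ≤ C ∧ ∀ x, 0 < x → μ₀.real {y | x < |y|} ≤ C * x ^ (-α) := by
  obtain ⟨C, hC0, hC⟩ := exists_symmetrization_charFun_le hα hν h
  exact exists_tail_le_of_symmetrization hα μ₀ hC0 hC

/-! ### Integration by parts against the tail -/

/-- Fubini applied to g(min(Y,R)) - g(0) = ∫_0^R g'(x) 1{x < Y} dx. Truncation at R removes any need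
for moments of Y. -/
theorem integral_comp_min_sub_eq {Ω : Type*} [MeasurableSpace Ω] (P : Measure Ω)
    [IsProbabilityMeasure P] {Y : Ω → ℝ} (hY : Measurable Y) (hY0 : ∀ ω, 0 ≤ Y ω)
    {g g' : ℝ → ℝ} (hg : ∀ x, HasDerivAt g (g' x) x) (hg' : Continuous g') {R : ℝ} (hR : 0 ≤ R) :
    ∫ ω, (g (min (Y ω) R) - g 0) ∂P = ∫ x in (0 : ℝ)..R, g' x * P.real {ω | x < Y ω} := by
  have e1 : ∀ ω, g (min (Y ω) R) - g 0 =
      ∫ x in Set.Ioc 0 R, {x | x < Y ω}.indicator g' x := by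
    intro ω
    rw [setIntegral_indicator (show MeasurableSet {x : ℝ | x < Y ω} from measurableSet_Iio)]
    have hset : (Set.Ioc 0 R ∩ {x | x < Y ω} : Set ℝ) =ᵐ[volume]
        (Set.Ioc 0 (min (Y ω) R) : Set ℝ) := by
      have h1 : (Set.Iio (Y ω) : Set ℝ) =ᵐ[volume] (Set.Iic (Y ω) : Set ℝ) := Iio_ae_eq_Iic
      have h2 : Set.Ioc 0 (min (Y ω) R) = Set.Ioc 0 R ∩ Set.Iic (Y ω) := by
        ext x
        simp only [Set.mem_inter_iff, Set.mem_Ioc, Set.mem_Iic, le_min_iff]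
        tauto
      rw [h2]
      exact ae_eq_set_inter (EventuallyEq.refl _ (Set.Ioc 0 R)) h1
    rw [setIntegral_congr_set hset, ← intervalIntegral.integral_of_le (le_min (hY0 ω) hR),
      intervalIntegral.integral_eq_sub_of_hasDerivAt (fun x _ => hg x)
        (hg'.intervalIntegrable _ _)]
  have hset : MeasurableSet {z : Ω × ℝ | z.2 < Y z.1} :=
    measurableSet_lt measurable_snd (hY.comp measurable_fst)
  have hg'i : Integrable g' (volume.restrict (Set.Ioc 0 R)) :=
    (hg'.integrableOn_Icc).mono_set Set.Ioc_subset_Icc_self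
  simp_rw [e1]
  rw [integral_integral_swap, intervalIntegral.integral_of_le hR]
  · refine integral_congr_ae (Eventually.of_forall fun x => ?_)
    have : ∀ ω, {x | x < Y ω}.indicator g' x = {ω | x < Y ω}.indicator (fun _ => g' x) ω := by
      intro ω
      by_cases h : x < Y ω <;> simp [Set.indicator, h]
    simp_rw [this]
    rw [integral_indicator_const _ (measurableSet_lt measurable_const hY), smul_eq_mul, mul_comm]
  · refine (hg'i.comp_snd P).mono ?_ (Eventually.of_forall fun z => ?_)
    · have : Function.uncurry (fun (ω : Ω) (x : ℝ) => {x | x < Y ω}.indicator g' x) =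
          {z : Ω × ℝ | z.2 < Y z.1}.indicator (fun z => g' z.2) := by
        funext z
        by_cases h : z.2 < Y z.1 <;> simp [Function.uncurry, Set.indicator, h]
      rw [this]
      exact ((hg'.measurable.comp measurable_snd).indicator hset).aestronglyMeasurable
    · exact norm_indicator_le_norm_self _ _

/-- Integration by parts with g(x) = 1 - cos(ξx). The integral is a limit in R because sin(ξx) times
the tail need not be absolutely integrable, as with a tail of order 1/x. -/
theorem tendsto_integral_sin_mul_tail {Ω : Type*} [MeasurableSpace Ω] (P : Measure Ω)
    [IsProbabilityMeasure P] {Y : Ω → ℝ} (hY : Measurable Y) (hY0 : ∀ ω, 0 ≤ Y ω) (ξ : ℝ) :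
    Tendsto (fun R : ℝ => ∫ x in (0 : ℝ)..R, ξ * Real.sin (ξ * x) * P.real {ω | x < Y ω}) atTop
      (𝓝 (∫ ω, (1 - Real.cos (ξ * Y ω)) ∂P)) := by
  have hg : ∀ x, HasDerivAt (fun x => 1 - Real.cos (ξ * x)) (ξ * Real.sin (ξ * x)) x := by
    intro x
    have h1 : HasDerivAt (fun x => ξ * x) ξ x := by simpa using (hasDerivAt_id x).const_mul ξ
    refine (h1.cos.const_sub 1).congr_deriv ?_
    ring
  have h1 : Tendsto (fun R : ℝ => ∫ ω, (1 - Real.cos (ξ * min (Y ω) R)) ∂P) atTop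
      (𝓝 (∫ ω, (1 - Real.cos (ξ * Y ω)) ∂P)) := by
    refine tendsto_integral_filter_of_dominated_convergence (fun _ => 2)
      (Eventually.of_forall fun R => ?_) (Eventually.of_forall fun R => ?_) (integrable_const _) ?_
    · exact Measurable.aestronglyMeasurable (by fun_prop)
    · refine Eventually.of_forall fun ω => ?_
      rw [Real.norm_eq_abs, abs_le]
      constructor <;> linarith [Real.cos_le_one (ξ * min (Y ω) R),
        Real.neg_one_le_cos (ξ * min (Y ω) R)]
    · refine Eventually.of_forall fun ω => tendsto_const_nhds.congr' ?_
      filter_upwards [eventually_ge_atTop (Y ω)] with R hR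
      rw [min_eq_left hR]
  refine h1.congr' ?_
  filter_upwards [eventually_ge_atTop 0] with R hR
  rw [← integral_comp_min_sub_eq P hY hY0 hg (by fun_prop) hR]
  simp

/-- 1 - cos u ≤ min(u²/2, 2), so the square truncated at |x| = 2/ξ dominates. The layer-cake formula
leaves ∫_0^{2/ξ} x^{1-α} dx, finite because α < 2. -/
theorem one_sub_charFun_re_le {α C : ℝ} (hα : α < 2) (μ : Measure ℝ) [IsProbabilityMeasure μ]
    (hC : ∀ x, 0 < x → μ.real {y | x < |y|} ≤ C * x ^ (-α)) {ξ : ℝ} (hξ : 0 < ξ) :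
    1 - (charFun μ ξ).re ≤ C * 2 ^ (2 - α) / (2 - α) * ξ ^ α := by
  have hg : ∀ x, HasDerivAt (fun x => ξ ^ 2 * x ^ 2 / 2) (ξ ^ 2 * x) x := by
    intro x
    refine (((hasDerivAt_pow 2 x).const_mul (ξ ^ 2)).div_const 2).congr_deriv ?_
    push_cast; ring
  have hR : 0 < 2 / ξ := by positivity
  have key := integral_comp_min_sub_eq μ (Y := fun y => |y|) measurable_norm
    (fun y => abs_nonneg y) hg (by fun_prop) hR.le
  rw [one_sub_charFun_re]
  have hi : Integrable (fun x => 1 - Real.cos (ξ * x)) μ :=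
    (integrable_const _).sub (integrable_cos_mul μ ξ)
  have hbd : ∀ y : ℝ, 0 ≤ ξ ^ 2 * (min |y| (2 / ξ)) ^ 2 / 2 ∧
      ξ ^ 2 * (min |y| (2 / ξ)) ^ 2 / 2 ≤ 2 := fun y => by
    refine ⟨by positivity, ?_⟩
    have : (min |y| (2 / ξ)) ^ 2 ≤ (2 / ξ) ^ 2 :=
      pow_le_pow_left₀ (le_min (abs_nonneg y) hR.le) (min_le_right _ _) 2
    calc _ ≤ ξ ^ 2 * (2 / ξ) ^ 2 / 2 := by gcongr
      _ = 2 := by field_simp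
  have hi2 : Integrable (fun y : ℝ => ξ ^ 2 * (min |y| (2 / ξ)) ^ 2 / 2 - ξ ^ 2 * 0 ^ 2 / 2) μ := by
    refine (integrable_const (2 : ℝ)).mono (Measurable.aestronglyMeasurable (by fun_prop))
      (Eventually.of_forall fun y => ?_)
    have := hbd y
    rw [Real.norm_eq_abs, Real.norm_eq_abs]
    exact abs_le_abs_of_nonneg (by simpa using this.1) (by simpa using this.2)
  calc ∫ x, (1 - Real.cos (ξ * x)) ∂μ
      ≤ ∫ y, (ξ ^ 2 * (min |y| (2 / ξ)) ^ 2 / 2 - ξ ^ 2 * 0 ^ 2 / 2) ∂μ := by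
        refine integral_mono hi hi2 fun y => ?_
        simp only
        rcases le_total |y| (2 / ξ) with h | h
        · rw [min_eq_left h, sq_abs]
          have := Real.one_sub_sq_div_two_le_cos (x := ξ * y)
          nlinarith
        · rw [min_eq_right h]
          have : ξ ^ 2 * (2 / ξ) ^ 2 / 2 = 2 := by field_simp
          rw [this]
          linarith [Real.neg_one_le_cos (ξ * y)]
    _ = ∫ x in (0 : ℝ)..(2 / ξ), ξ ^ 2 * x * μ.real {y | x < |y|} := key
    _ ≤ ∫ x in (0 : ℝ)..(2 / ξ), (C * ξ ^ 2) * x ^ (1 - α) := by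
        refine intervalIntegral.integral_mono_on_of_le_Ioo hR.le ?_ ?_ fun x hx => ?_
        · have hanti : Antitone fun x : ℝ => μ.real {y | x < |y|} := fun a b hab =>
            measureReal_mono fun y hy => lt_of_le_of_lt hab hy
          exact (hanti.intervalIntegrable (a := 0) (b := 2 / ξ)).continuousOn_mul
            (by fun_prop)
        · exact (intervalIntegral.intervalIntegrable_rpow' (by linarith)).const_mul _
        · have := hC x hx.1
          have hx0 : 0 < x := hx.1
          calc ξ ^ 2 * x * μ.real {y | x < |y|} ≤ ξ ^ 2 * x * (C * x ^ (-α)) := by gcongr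
            _ = _ := by
              rw [show 1 - α = 1 + -α by ring, Real.rpow_add hx0, Real.rpow_one]
              ring
    _ = _ := by
        rw [intervalIntegral.integral_const_mul, integral_rpow (Or.inl (by linarith)),
          Real.zero_rpow (by linarith), sub_zero, Real.div_rpow (by norm_num) hξ.le,
          show 1 - α + 1 = 2 - α by ring, Real.rpow_sub hξ]
        rw [Real.rpow_two]
        have h1 : 0 < ξ ^ α := by positivity
        have h2 : 2 - α ≠ 0 := by linarith
        field_simp

/-! ### Random trees -/

instance : Countable (BinaryTree Unit) := by
  rw [← Set.countable_univ_iff]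
  have : (Set.univ : Set (BinaryTree Unit)) =
      ⋃ n, (BinaryTree.treesOfNumNodesEq n : Set (BinaryTree Unit)) := by
    ext g; simp
  rw [this]
  exact Set.countable_iUnion fun n => (BinaryTree.treesOfNumNodesEq n).countable_toSet

theorem treeProb_nonneg : ∀ g, 0 ≤ treeProb g
  | .nil => zero_le_one
  | .node _ l r => div_nonneg (mul_nonneg (treeProb_nonneg l) (treeProb_nonneg r))
      (Nat.cast_nonneg _)

/-- A tree with n + 1 nodes is a root with an ordered pair of subtrees whose node numbers add to n.
The factor n + 1 clears the denominator of `treeProb`. All recursions over trees below rest on this.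
-/
theorem sum_treesOfNumNodesEq_succ (n : ℕ) (h : BinaryTree Unit → ℝ) :
    ((n : ℝ) + 1) * ∑ g ∈ BinaryTree.treesOfNumNodesEq (n + 1), treeProb g * h g =
      ∑ ij ∈ Finset.HasAntidiagonal.antidiagonal n, ∑ l ∈ BinaryTree.treesOfNumNodesEq ij.1,
        ∑ r ∈ BinaryTree.treesOfNumNodesEq ij.2,
          treeProb l * treeProb r * h (.node () l r) := by
  rw [BinaryTree.treesOfNumNodesEq_succ, Finset.sum_biUnion, Finset.mul_sum]
  · refine Finset.sum_congr rfl fun ij hij => ?_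
    rw [Finset.sum_map, Finset.sum_product, Finset.mul_sum]
    refine Finset.sum_congr rfl fun l hl => ?_
    rw [Finset.mul_sum]
    refine Finset.sum_congr rfl fun r hr => ?_
    rw [BinaryTree.mem_treesOfNumNodesEq] at hl hr
    rw [Finset.HasAntidiagonal.mem_antidiagonal] at hij
    have hn : (((BinaryTree.node () l r).numNodes : ℕ) : ℝ) = n + 1 := by
      rw [BinaryTree.numNodes, hl, hr, hij]; push_cast; ring
    change ((n : ℝ) + 1) * (treeProb (.node () l r) * h (.node () l r)) = _
    rw [treeProb, hn]
    have : (n : ℝ) + 1 ≠ 0 := by positivity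
    field_simp
  · intro x hx y hy hxy
    rw [Function.onFun, Finset.disjoint_left]
    intro g hg hg'
    simp only [Finset.mem_map, Finset.mem_product, BinaryTree.mem_treesOfNumNodesEq,
      Prod.exists] at hg hg'
    obtain ⟨a, b, ⟨h1, h2⟩, rfl⟩ := hg
    obtain ⟨a', b', ⟨h3, h4⟩, h5⟩ := hg'
    obtain ⟨-, h6, h7⟩ := BinaryTree.node.inj h5
    have h6' : a' = a := h6
    have h7' : b' = b := h7
    exact hxy (Prod.ext (by rw [← h1, ← h3, h6']) (by rw [← h2, ← h4, h7']))

theorem sum_treeProb_treesOfNumNodesEq (n : ℕ) :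
    ∑ g ∈ BinaryTree.treesOfNumNodesEq n, treeProb g = 1 := by
  induction n using Nat.strong_induction_on with
  | _ n ih =>
    cases n with
    | zero => simp [treeProb]
    | succ n =>
      have h := sum_treesOfNumNodesEq_succ n fun _ => 1
      simp only [mul_one] at h
      have : ∀ ij ∈ Finset.HasAntidiagonal.antidiagonal n, ∑ l ∈ BinaryTree.treesOfNumNodesEq ij.1,
          ∑ r ∈ BinaryTree.treesOfNumNodesEq ij.2, treeProb l * treeProb r = 1 := by
        intro ij hij
        rw [Finset.HasAntidiagonal.mem_antidiagonal] at hij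
        rw [← Finset.sum_mul_sum, ih _ (by omega), ih _ (by omega), one_mul]
      rw [Finset.sum_congr rfl this] at h
      simp only [Finset.sum_const, Finset.Nat.card_antidiagonal, nsmul_eq_mul, mul_one] at h
      have h1 : (n : ℝ) + 1 ≠ 0 := by positivity
      push_cast at h
      exact mul_left_cancel₀ h1 (by rw [h, mul_one])

/-- The probability of the tree `g` at time `t`. -/
noncomputable def treeWeight (t : ℝ) (g : BinaryTree Unit) : ℝ :=
  Real.exp (-t) * (1 - Real.exp (-t)) ^ g.numNodes * treeProb g

/-- The average of `h` over the trees with `n` nodes. -/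
noncomputable def treeAverage (h : BinaryTree Unit → ℝ) (n : ℕ) : ℝ :=
  ∑ g ∈ BinaryTree.treesOfNumNodesEq n, treeProb g * h g

/-- The average of `h` over the trees with less than `N` nodes at time `t`. -/
noncomputable def wildSum (t : ℝ) (h : BinaryTree Unit → ℝ) (N : ℕ) : ℝ :=
  ∑ n ∈ Finset.range N, Real.exp (-t) * (1 - Real.exp (-t)) ^ n * treeAverage h n

theorem one_sub_exp_neg_nonneg {t : ℝ} (ht : 0 ≤ t) : 0 ≤ 1 - Real.exp (-t) :=
  sub_nonneg.2 (Real.exp_le_one_iff.2 (by linarith))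

theorem one_sub_exp_neg_lt_one (t : ℝ) : 1 - Real.exp (-t) < 1 := by
  linarith [Real.exp_pos (-t)]

theorem treeWeight_nonneg {t : ℝ} (ht : 0 ≤ t) (g : BinaryTree Unit) : 0 ≤ treeWeight t g :=
  mul_nonneg (mul_nonneg (Real.exp_pos _).le (pow_nonneg (one_sub_exp_neg_nonneg ht) _))
    (treeProb_nonneg g)

/-- The trees with less than `N` nodes. -/
def treesLT (N : ℕ) : Finset (BinaryTree Unit) :=
  (Finset.range N).biUnion BinaryTree.treesOfNumNodesEq

theorem mem_treesLT {N : ℕ} {g : BinaryTree Unit} : g ∈ treesLT N ↔ g.numNodes < N := by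
  simp [treesLT]

theorem tendsto_treesLT : Tendsto treesLT atTop atTop :=
  tendsto_atTop_finset_of_monotone
    (fun _ _ hmn _ hg => mem_treesLT.2 ((mem_treesLT.1 hg).trans_le hmn))
    fun g => ⟨g.numNodes + 1, mem_treesLT.2 (Nat.lt_succ_self _)⟩

theorem sum_treesLT (t : ℝ) (h : BinaryTree Unit → ℝ) (N : ℕ) :
    ∑ g ∈ treesLT N, treeWeight t g * h g = wildSum t h N := by
  rw [treesLT, Finset.sum_biUnion, wildSum]
  · refine Finset.sum_congr rfl fun n _ => ?_
    rw [treeAverage, Finset.mul_sum]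
    refine Finset.sum_congr rfl fun g hg => ?_
    rw [BinaryTree.mem_treesOfNumNodesEq] at hg
    rw [treeWeight, hg, mul_assoc]
  · intro x _ y _ hxy
    rw [Function.onFun, Finset.disjoint_left]
    intro g hg hg'
    rw [BinaryTree.mem_treesOfNumNodesEq] at hg hg'
    exact hxy (hg.symm.trans hg')

theorem wildSum_one (t : ℝ) (N : ℕ) : wildSum t (fun _ => 1) N = 1 - (1 - Real.exp (-t)) ^ N := by
  simp only [wildSum, treeAverage, mul_one, sum_treeProb_treesOfNumNodesEq]
  rw [← Finset.mul_sum]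
  have := mul_neg_geom_sum (1 - Real.exp (-t)) N
  rw [← this]
  ring

theorem hasSum_treeWeight {t : ℝ} (ht : 0 ≤ t) : HasSum (treeWeight t) 1 := by
  have h1 : ∀ N, ∑ g ∈ treesLT N, treeWeight t g = 1 - (1 - Real.exp (-t)) ^ N := fun N => by
    rw [← wildSum_one, ← sum_treesLT]; simp
  have hs : Summable (treeWeight t) := by
    refine summable_of_sum_le (c := 1) (treeWeight_nonneg ht) fun u => ?_
    obtain ⟨N, hN⟩ := (tendsto_atTop.1 tendsto_treesLT u).exists
    refine (Finset.sum_le_sum_of_subset_of_nonneg hN fun g _ _ => treeWeight_nonneg ht g).trans ?_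
    rw [h1]
    linarith [pow_nonneg (one_sub_exp_neg_nonneg ht) N]
  have h2 := hs.hasSum.comp tendsto_treesLT
  have h3 : Tendsto (fun N => ∑ g ∈ treesLT N, treeWeight t g) atTop (𝓝 1) := by
    simp only [h1]
    simpa using tendsto_const_nhds.sub (tendsto_pow_atTop_nhds_zero_of_lt_one
      (one_sub_exp_neg_nonneg ht) (one_sub_exp_neg_lt_one t))
  rw [← tendsto_nhds_unique h2 h3]
  exact hs.hasSum

theorem isProbabilityMeasure_treeLaw {t : ℝ} (ht : 0 ≤ t) : IsProbabilityMeasure (treeLaw t) := by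
  refine ⟨?_⟩
  rw [treeLaw, Measure.sum_apply _ MeasurableSet.univ]
  simp only [Measure.smul_apply, measure_univ, smul_eq_mul, mul_one]
  have h := hasSum_treeWeight ht
  have h2 := ENNReal.ofReal_tsum_of_nonneg (treeWeight_nonneg ht) h.summable
  rw [h.tsum_eq, ENNReal.ofReal_one] at h2
  exact h2.symm

theorem tendsto_wildSum_integral_treeLaw {t : ℝ} (ht : 0 ≤ t) {h : BinaryTree Unit → ℝ}
    (hi : Integrable h (treeLaw t)) :
    Tendsto (wildSum t h) atTop (𝓝 (∫ g, h g ∂(treeLaw t))) := by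
  have h1 := (hasSum_integral_measure (f := h) (μ := fun g : BinaryTree Unit =>
    ENNReal.ofReal (treeWeight t g) • Measure.dirac g) hi).comp tendsto_treesLT
  refine Tendsto.congr (fun N => ?_) h1
  rw [← sum_treesLT]
  refine Finset.sum_congr rfl fun g _ => ?_
  simp only
  rw [integral_smul_measure, integral_dirac, ENNReal.toReal_ofReal (treeWeight_nonneg ht g),
    smul_eq_mul]

/-! ### Random angles -/

instance : IsProbabilityMeasure angleLaw := by
  refine cond_isProbabilityMeasure_of_finite ?_ ?_
  · simp [Real.volume_Ico, Real.pi_pos]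
  · exact measure_Ico_lt_top.ne

theorem integral_angleLaw {E : Type*} [NormedAddCommGroup E] [NormedSpace ℝ E] (f : ℝ → E) :
    ∫ θ, f θ ∂angleLaw = (1 / (2 * Real.pi)) • ∫ θ in (0 : ℝ)..(2 * Real.pi), f θ := by
  rw [angleLaw, ProbabilityTheory.cond, integral_smul_measure, integral_Ico_eq_integral_Ioc,
    ← intervalIntegral.integral_of_le (by positivity), Real.volume_Ico]
  congr 1
  rw [ENNReal.toReal_inv, ENNReal.toReal_ofReal (by linarith [Real.pi_pos])]
  simp

/-- The law of a sequence of independent uniform angles. -/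
noncomputable abbrev angleSeqLaw : Measure (ℕ → ℝ) := Measure.infinitePi fun _ : ℕ => angleLaw

/-- The first `n` terms of `a`, followed by `b`. -/
def splice (n : ℕ) (z : (ℕ → ℝ) × (ℕ → ℝ)) (k : ℕ) : ℝ := if k < n then z.1 k else z.2 (k - n)

theorem measurable_splice (n : ℕ) : Measurable (splice n) := by
  refine measurable_pi_lambda _ fun k => ?_
  unfold splice
  split_ifs <;> fun_prop

/-- Gluing two independent i.i.d. sequences gives an i.i.d. sequence. This lets the angles of the
root and of the two subtrees be drawn from three independent sequences. -/
theorem measurePreserving_splice (P : Measure ℝ) [IsProbabilityMeasure P] (n : ℕ) :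
    MeasurePreserving (splice n)
      ((Measure.infinitePi fun _ : ℕ => P).prod (Measure.infinitePi fun _ : ℕ => P))
      (Measure.infinitePi fun _ : ℕ => P) := by
  refine ⟨measurable_splice n, Measure.eq_infinitePi _ fun s t ht => ?_⟩
  -- The preimage of a box is a product of boxes: the coordinates below n constrain the first
  -- sequence, the others, shifted by n, the second.
  have hpre : splice n ⁻¹' (Set.pi s t) =
      (Set.pi (s.filter (· < n) : Finset ℕ) t) ×ˢ
        (Set.pi ((s.filter fun k => ¬ k < n).image (· - n) : Finset ℕ) fun k => t (k + n)) := by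
    ext ⟨a, b⟩
    simp only [Set.mem_preimage, Set.mem_pi, Set.mem_prod, Finset.mem_coe, Finset.mem_filter,
      Finset.mem_image, splice]
    constructor
    · intro h
      refine ⟨fun k hk => ?_, ?_⟩
      · simpa [hk.2] using h k hk.1
      · rintro _ ⟨k, hk, rfl⟩
        have := h k hk.1
        rw [if_neg hk.2] at this
        rwa [Nat.sub_add_cancel (not_lt.1 hk.2)]
    · rintro ⟨h1, h2⟩ k hk
      split_ifs with hkn
      · exact h1 k ⟨hk, hkn⟩
      · have := h2 (k - n) ⟨k, ⟨hk, hkn⟩, rfl⟩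
        rwa [Nat.sub_add_cancel (not_lt.1 hkn)] at this
  rw [Measure.map_apply (measurable_splice n) (MeasurableSet.pi s.countable_toSet fun i _ => ht i),
    hpre, Measure.prod_prod, Measure.infinitePi_pi _ (fun i _ => ht i),
    Measure.infinitePi_pi _ (fun i _ => ht _), Finset.prod_image,
    ← Finset.prod_filter_mul_prod_filter_not s (· < n)]
  · congr 1
    refine Finset.prod_congr rfl fun k hk => ?_
    rw [Nat.sub_add_cancel (not_lt.1 (Finset.mem_filter.1 hk).2)]
  · intro x hx y hy hxy
    have h1 := (Finset.mem_filter.1 hx).2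
    have h2 := (Finset.mem_filter.1 hy).2
    simp only at hxy
    omega

/-! ### The weights of the leaves -/

theorem abs_cosP (p θ : ℝ) (hp : 0 < 1 + p) : |cosP p θ| = |Real.cos θ| ^ (1 + p) := by
  rw [cosP, abs_mul, abs_of_nonneg (Real.rpow_nonneg (abs_nonneg _) _),
    Real.rpow_add' (abs_nonneg _) hp.ne', Real.rpow_one]

theorem abs_sinP (p θ : ℝ) (hp : 0 < 1 + p) : |sinP p θ| = |Real.sin θ| ^ (1 + p) := by
  rw [sinP, abs_mul, abs_of_nonneg (Real.rpow_nonneg (abs_nonneg _) _),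
    Real.rpow_add' (abs_nonneg _) hp.ne', Real.rpow_one]

theorem abs_cosP_le_one (p θ : ℝ) (hp : 0 < 1 + p) : |cosP p θ| ≤ 1 := by
  rw [abs_cosP p θ hp]
  exact Real.rpow_le_one (abs_nonneg _) (Real.abs_cos_le_one θ) hp.le

theorem abs_sinP_le_one (p θ : ℝ) (hp : 0 < 1 + p) : |sinP p θ| ≤ 1 := by
  rw [abs_sinP p θ hp]
  exact Real.rpow_le_one (abs_nonneg _) (Real.abs_sin_le_one θ) hp.le

theorem measurable_cosP (p : ℝ) : Measurable (cosP p) := by unfold cosP; fun_prop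

theorem measurable_sinP (p : ℝ) : Measurable (sinP p) := by unfold sinP; fun_prop

theorem abs_cosP_rpow_add_abs_sinP_rpow {p α : ℝ} (hp : 0 < 1 + p) (hα : α = 2 / (1 + p))
    (θ : ℝ) : |cosP p θ| ^ α + |sinP p θ| ^ α = 1 := by
  rw [abs_cosP p θ hp, abs_sinP p θ hp, ← Real.rpow_mul (abs_nonneg _),
    ← Real.rpow_mul (abs_nonneg _), hα, mul_div_cancel₀ _ hp.ne', Real.rpow_two, Real.rpow_two,
    sq_abs, sq_abs, Real.cos_sq_add_sin_sq]

theorem length_weights (p : ℝ) (g : BinaryTree Unit) (θ : ℕ → ℝ) :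
    (weights p g θ).length = g.numNodes + 1 := by
  induction g generalizing θ with
  | nil => rfl
  | node _ l r ihl ihr =>
    simp only [weights, List.length_append, List.length_map, ihl, ihr, BinaryTree.numNodes]
    omega

theorem weights_congr (p : ℝ) (g : BinaryTree Unit) {θ θ' : ℕ → ℝ}
    (h : ∀ k < g.numNodes, θ k = θ' k) : weights p g θ = weights p g θ' := by
  induction g generalizing θ θ' with
  | nil => rfl
  | node _ l r ihl ihr =>
    simp only [BinaryTree.numNodes] at h
    simp only [weights]
    rw [h 0 (by omega), ihl fun k hk => h (k + 1) (by omega),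
      ihr fun k hk => h (k + 1 + l.numNodes) (by omega)]

/-- Preorder numbering: angle 0 belongs to the root, the next `l.numNodes` angles to the left
subtree, the remaining ones to the right subtree. -/
theorem weights_node_splice (p : ℝ) (u : Unit) (l r : BinaryTree Unit) (a b c : ℕ → ℝ) :
    weights p (.node u l r) (splice 1 (a, splice l.numNodes (b, c))) =
      (weights p l b).map (fun x => cosP p (a 0) * x) ++
        (weights p r c).map (fun x => sinP p (a 0) * x) := by
  have h0 : splice 1 (a, splice l.numNodes (b, c)) 0 = a 0 := by simp [splice]
  rw [weights, h0]
  congr 2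
  · refine weights_congr p l fun k hk => ?_
    simp [splice, hk]
  · refine weights_congr p r fun k _ => ?_
    have h1 : ¬ k + 1 + l.numNodes < 1 := by omega
    have h2 : ¬ k + 1 + l.numNodes - 1 < l.numNodes := by omega
    simp only [splice, h1, h2, if_false]
    congr 1
    omega

/-- The length of the list depends only on the tree, so measurability in the angles can be checked
entry by entry. The default 0 is never read for j ≤ `g.numNodes`. -/
theorem measurable_getD_weights (p : ℝ) (g : BinaryTree Unit) (j : ℕ) :
    Measurable fun θ => (weights p g θ).getD j 0 := by
  induction g generalizing j with
  | nil => simp only [weights]; exact measurable_const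
  | node _ l r ihl ihr =>
    have hl : Measurable fun θ : ℕ → ℝ => fun k : ℕ => θ (k + 1) := by fun_prop
    have hr : Measurable fun θ : ℕ → ℝ => fun k : ℕ => θ (k + 1 + l.numNodes) := by fun_prop
    simp only [weights]
    by_cases hj : j < l.numNodes + 1
    · have : ∀ θ : ℕ → ℝ, (((weights p l fun k => θ (k + 1)).map fun b => cosP p (θ 0) * b) ++
          (weights p r fun k => θ (k + 1 + l.numNodes)).map fun b => sinP p (θ 0) * b).getD j 0
          = cosP p (θ 0) * (weights p l fun k => θ (k + 1)).getD j 0 := by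
        intro θ
        rw [List.getD_append _ _ _ _ (by simpa [length_weights] using hj)]
        simpa using List.getD_map (f := fun b => cosP p (θ 0) * b) (d := 0)
          (l := weights p l fun k => θ (k + 1)) (n := j)
      simp only [this]
      exact ((measurable_cosP p).comp (measurable_pi_apply 0)).mul ((ihl j).comp hl)
    · have : ∀ θ : ℕ → ℝ, (((weights p l fun k => θ (k + 1)).map fun b => cosP p (θ 0) * b) ++
          (weights p r fun k => θ (k + 1 + l.numNodes)).map fun b => sinP p (θ 0) * b).getD j 0
          = sinP p (θ 0) *
            (weights p r fun k => θ (k + 1 + l.numNodes)).getD (j - (l.numNodes + 1)) 0 := by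
        intro θ
        rw [List.getD_append_right _ _ _ _ (by simpa [length_weights] using not_lt.1 hj)]
        rw [List.length_map, length_weights]
        simpa using List.getD_map (f := fun b => sinP p (θ 0) * b) (d := 0)
          (l := weights p r fun k => θ (k + 1 + l.numNodes)) (n := j - (l.numNodes + 1))
      simp only [this]
      exact ((measurable_sinP p).comp (measurable_pi_apply 0)).mul ((ihr _).comp hr)

theorem map_weights_eq {β : Type*} (p : ℝ) (g : BinaryTree Unit) (θ : ℕ → ℝ) (f : ℝ → β) :
    (weights p g θ).map f =
      (List.range (g.numNodes + 1)).map fun j => f ((weights p g θ).getD j 0) := by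
  refine List.ext_getElem (by simp [length_weights]) fun j h1 h2 => ?_
  simp only [List.getElem_map, List.getElem_range]
  rw [List.getD_eq_getElem]

theorem measurable_list_map_prod {Ω : Type*} [MeasurableSpace Ω] (I : List ℕ) {h : Ω → ℕ → ℝ}
    (hh : ∀ j, Measurable fun ω => h ω j) : Measurable fun ω => (I.map (h ω)).prod := by
  induction I with
  | nil => exact measurable_const
  | cons j I ih => simp only [List.map_cons, List.prod_cons]; exact (hh j).mul ih

theorem measurable_list_map_sum {Ω : Type*} [MeasurableSpace Ω] (I : List ℕ) {h : Ω → ℕ → ℝ}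
    (hh : ∀ j, Measurable fun ω => h ω j) : Measurable fun ω => (I.map (h ω)).sum := by
  induction I with
  | nil => exact measurable_const
  | cons j I ih => simp only [List.map_cons, List.sum_cons]; exact (hh j).add ih

theorem measurable_list_map_max {Ω : Type*} [MeasurableSpace Ω] (I : List ℕ) {h : Ω → ℕ → ℝ}
    (hh : ∀ j, Measurable fun ω => h ω j) : Measurable fun ω => (I.map (h ω)).foldr max 0 := by
  induction I with
  | nil => exact measurable_const
  | cons j I ih => simpa using (hh j).max ih

theorem measurable_sum_weights (p : ℝ) {f : ℝ → ℝ} (hf : Measurable f) :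
    Measurable fun ω : BinaryTree Unit × (ℕ → ℝ) => ((weights p ω.1 ω.2).map f).sum := by
  refine measurable_from_prod_countable_right fun g => ?_
  simp only [map_weights_eq]
  exact measurable_list_map_sum _ fun j => hf.comp (measurable_getD_weights p g j)

theorem measurable_max_weights (p : ℝ) {f : ℝ → ℝ} (hf : Measurable f) :
    Measurable fun ω : BinaryTree Unit × (ℕ → ℝ) => ((weights p ω.1 ω.2).map f).foldr max 0 := by
  refine measurable_from_prod_countable_right fun g => ?_
  simp only [map_weights_eq]
  exact measurable_list_map_max _ fun j => hf.comp (measurable_getD_weights p g j)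

theorem measurable_prod_weights_uncurry (p : ℝ) {u : ℝ → ℝ} (hu : Measurable u)
    (g : BinaryTree Unit) :
    Measurable fun z : ℝ × (ℕ → ℝ) => ((weights p g z.2).map fun b => u (z.1 * b)).prod := by
  simp only [map_weights_eq]
  exact measurable_list_map_prod _ fun j =>
    hu.comp (measurable_fst.mul ((measurable_getD_weights p g j).comp measurable_snd))

theorem measurable_prod_weights (p : ℝ) {u : ℝ → ℝ} (hu : Measurable u) (ξ : ℝ) :
    Measurable fun ω : BinaryTree Unit × (ℕ → ℝ) =>
      ((weights p ω.1 ω.2).map fun b => u (ξ * b)).prod :=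
  measurable_from_prod_countable_right fun g =>
    (measurable_prod_weights_uncurry p hu g).comp measurable_prodMk_left

theorem abs_prod_map_le_one {f : ℝ → ℝ} (hf : ∀ x, |f x| ≤ 1) (L : List ℝ) :
    |(L.map f).prod| ≤ 1 := by
  induction L with
  | nil => simp
  | cons a L ih =>
    rw [List.map_cons, List.prod_cons, abs_mul]
    exact mul_le_one₀ (hf a) (abs_nonneg _) ih

theorem abs_le_one_of_mem_weights {p : ℝ} (hp : 0 < 1 + p) {g : BinaryTree Unit} {θ : ℕ → ℝ}
    {b : ℝ} (hb : b ∈ weights p g θ) : |b| ≤ 1 := by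
  induction g generalizing θ b with
  | nil => simp only [weights, List.mem_singleton] at hb; simp [hb]
  | node _ l r ihl ihr =>
    simp only [weights, List.mem_append, List.mem_map] at hb
    rcases hb with ⟨x, hx, rfl⟩ | ⟨x, hx, rfl⟩
    · rw [abs_mul]; exact mul_le_one₀ (abs_cosP_le_one p _ hp) (abs_nonneg _) (ihl hx)
    · rw [abs_mul]; exact mul_le_one₀ (abs_sinP_le_one p _ hp) (abs_nonneg _) (ihr hx)

theorem sum_map_abs_mul_rpow (c s : ℝ) (L : List ℝ) :
    ((L.map fun x => c * x).map fun b => |b| ^ s).sum = |c| ^ s * (L.map fun b => |b| ^ s).sum := by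
  rw [List.map_map, ← List.sum_map_mul_left]
  congr 1
  refine List.map_congr_left fun x _ => ?_
  simp only [Function.comp]
  rw [abs_mul, Real.mul_rpow (abs_nonneg _) (abs_nonneg _)]

/-- As (1 + p)α = 2, each node splits unit mass into cos² + sin². This plays the role of the
normalization n^{-1/α} in the classical limit theorem. -/
theorem sum_weights_rpow {p α : ℝ} (hp : 0 < 1 + p) (hα : α = 2 / (1 + p)) (g : BinaryTree Unit)
    (θ : ℕ → ℝ) : ((weights p g θ).map fun b => |b| ^ α).sum = 1 := by
  induction g generalizing θ with
  | nil => simp [weights]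
  | node _ l r ihl ihr =>
    rw [weights, List.map_append, List.sum_append, sum_map_abs_mul_rpow, sum_map_abs_mul_rpow,
      ihl, ihr, mul_one, mul_one, abs_cosP_rpow_add_abs_sinP_rpow hp hα]

theorem sum_weights_rpow_le_one {p α s : ℝ} (hp : 0 < 1 + p) (hα : α = 2 / (1 + p)) (hs : α ≤ s)
    (g : BinaryTree Unit) (θ : ℕ → ℝ) : ((weights p g θ).map fun b => |b| ^ s).sum ≤ 1 := by
  have hα0 : 0 < α := by rw [hα]; positivity
  rw [← sum_weights_rpow hp hα g θ]
  refine List.sum_le_sum fun b hb => ?_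
  exact Real.rpow_le_rpow_of_exponent_ge' (abs_nonneg _) (abs_le_one_of_mem_weights hp hb)
    hα0.le hs

theorem sum_map_nonneg {f : ℝ → ℝ} (hf : ∀ x, 0 ≤ f x) (L : List ℝ) : 0 ≤ (L.map f).sum :=
  List.sum_nonneg fun x hx => by
    obtain ⟨y, _, rfl⟩ := List.mem_map.1 hx
    exact hf y

/-! ### The recursion over the root of the tree -/

theorem integral_splice (P : Measure ℝ) [IsProbabilityMeasure P] (n : ℕ) {F : (ℕ → ℝ) → ℝ}
    (hF : Measurable F) {K : ℝ} (hK : ∀ θ, |F θ| ≤ K) :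
    ∫ θ, F θ ∂(Measure.infinitePi fun _ : ℕ => P) =
      ∫ a, ∫ b, F (splice n (a, b)) ∂(Measure.infinitePi fun _ : ℕ => P)
        ∂(Measure.infinitePi fun _ : ℕ => P) := by
  have h := measurePreserving_splice P n
  conv_lhs => rw [← h.map_eq]
  rw [integral_map h.measurable.aemeasurable hF.aestronglyMeasurable]
  refine integral_prod _ ?_
  exact (integrable_const K).mono' (hF.comp h.measurable).aestronglyMeasurable
    (Eventually.of_forall fun z => hK _)

theorem integral_comp_weights_node (p : ℝ) (u : Unit) (l r : BinaryTree Unit)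
    {F : List ℝ → ℝ} (hF : Measurable fun θ => F (weights p (.node u l r) θ)) {K : ℝ}
    (hK : ∀ θ, |F (weights p (.node u l r) θ)| ≤ K) :
    ∫ θ, F (weights p (.node u l r) θ) ∂angleSeqLaw = ∫ a, ∫ b, ∫ c,
      F ((weights p l b).map (fun x => cosP p (a 0) * x) ++
        (weights p r c).map (fun x => sinP p (a 0) * x)) ∂angleSeqLaw ∂angleSeqLaw
          ∂angleSeqLaw := by
  rw [integral_splice angleLaw 1 hF hK]
  refine integral_congr_ae (Eventually.of_forall fun a => ?_)
  simp only
  rw [integral_splice angleLaw l.numNodes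
    (F := fun y => F (weights p (.node u l r) (splice 1 (a, y))))
    (hF.comp ((measurable_splice 1).comp measurable_prodMk_left)) (fun y => hK _)]
  simp only [weights_node_splice]

theorem integral_eval_zero {H : ℝ → ℝ} (hH : Measurable H) :
    ∫ a, H (a 0) ∂angleSeqLaw = ∫ x, H x ∂angleLaw := by
  have h := measurePreserving_eval_infinitePi (fun _ : ℕ => angleLaw) 0
  have h2 := integral_map (μ := angleSeqLaw) h.measurable.aemeasurable
    (f := H) hH.aestronglyMeasurable
  rw [h.map_eq] at h2
  exact h2.symm

/-- The average over the angles of `∏_j u(ξ β_j)`. -/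
noncomputable def prodAverage (p : ℝ) (u : ℝ → ℝ) (ξ : ℝ) (g : BinaryTree Unit) : ℝ :=
  ∫ θ, ((weights p g θ).map fun b => u (ξ * b)).prod ∂angleSeqLaw

theorem measurable_prodAverage (p : ℝ) {u : ℝ → ℝ} (hu : Measurable u) (g : BinaryTree Unit) :
    Measurable fun ξ => prodAverage p u ξ g :=
  (measurable_prod_weights_uncurry p hu g).stronglyMeasurable.integral_prod_right'.measurable

theorem abs_prodAverage_le_one (p : ℝ) {u : ℝ → ℝ} (hu : ∀ x, |u x| ≤ 1) (ξ : ℝ)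
    (g : BinaryTree Unit) : |prodAverage p u ξ g| ≤ 1 := by
  have h := norm_integral_le_of_norm_le_const (μ := angleSeqLaw) (C := 1)
    (f := fun θ => ((weights p g θ).map fun b => u (ξ * b)).prod)
    (Eventually.of_forall fun θ => abs_prod_map_le_one (fun x => hu _) _)
  simpa [prodAverage] using h

theorem prodAverage_nil (p : ℝ) (u : ℝ → ℝ) (ξ : ℝ) : prodAverage p u ξ .nil = u ξ := by
  simp [prodAverage, weights]

/-- Given the root angle, the two subtrees use independent angles, so the average factorizes into
the integrand of the collision integral. -/
theorem prodAverage_node (p : ℝ) {u : ℝ → ℝ} (hum : Measurable u) (hu : ∀ x, |u x| ≤ 1) (ξ : ℝ)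
    (e : Unit) (l r : BinaryTree Unit) : prodAverage p u ξ (.node e l r) =
      ∫ x, prodAverage p u (ξ * cosP p x) l * prodAverage p u (ξ * sinP p x) r ∂angleLaw := by
  have hm := (measurable_prod_weights_uncurry p hum (.node e l r)).comp
    (measurable_prodMk_left (x := ξ))
  rw [prodAverage, integral_comp_weights_node p e l r
    (F := fun L => (L.map fun b => u (ξ * b)).prod) hm (K := 1)
    (fun θ => abs_prod_map_le_one (fun x => hu _) _)]
  refine Eq.trans ?_ (integral_eval_zero (((measurable_prodAverage p hum l).comp
    ((measurable_cosP p).const_mul ξ)).mul ((measurable_prodAverage p hum r).comp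
    ((measurable_sinP p).const_mul ξ))))
  refine integral_congr_ae (Eventually.of_forall fun a => ?_)
  simp only [List.map_append, List.prod_append, List.map_map, integral_const_mul,
    integral_mul_const, prodAverage, Function.comp_def, mul_assoc]

/-- The average over the angles of `∑_j |β_j|^s`. -/
noncomputable def powerAverage (p s : ℝ) (g : BinaryTree Unit) : ℝ :=
  ∫ θ, ((weights p g θ).map fun b => |b| ^ s).sum ∂angleSeqLaw

theorem abs_sum_weights_rpow_le {p α s : ℝ} (hp : 0 < 1 + p) (hα : α = 2 / (1 + p)) (hs : α ≤ s)
    (g : BinaryTree Unit) (θ : ℕ → ℝ) : |((weights p g θ).map fun b => |b| ^ s).sum| ≤ 1 := by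
  rw [abs_of_nonneg (sum_map_nonneg (fun x => by positivity) _)]
  exact sum_weights_rpow_le_one hp hα hs g θ

theorem powerAverage_nil (p s : ℝ) : powerAverage p s .nil = 1 := by
  simp [powerAverage, weights]

theorem powerAverage_node {p α s : ℝ} (hp : 0 < 1 + p) (hα : α = 2 / (1 + p)) (hs : α ≤ s)
    (e : Unit) (l r : BinaryTree Unit) : powerAverage p s (.node e l r) =
      (∫ x, |cosP p x| ^ s ∂angleLaw) * powerAverage p s l +
        (∫ x, |sinP p x| ^ s ∂angleLaw) * powerAverage p s r := by
  have hα0 : 0 < α := by rw [hα]; positivity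
  have hm : ∀ g : BinaryTree Unit,
      Measurable fun θ => ((weights p g θ).map fun b => |b| ^ s).sum := fun g =>
    (measurable_sum_weights p (f := fun b => |b| ^ s) (by fun_prop)).comp measurable_prodMk_left
  have hi : ∀ g : BinaryTree Unit,
      Integrable (fun θ => ((weights p g θ).map fun b => |b| ^ s).sum) angleSeqLaw := fun g =>
    (integrable_const (1 : ℝ)).mono' (hm g).aestronglyMeasurable
      (Eventually.of_forall fun θ => abs_sum_weights_rpow_le hp hα hs g θ)
  have hcos : Measurable fun x => |cosP p x| ^ s :=
    ((continuous_abs.measurable.comp (measurable_cosP p)).pow_const s)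
  have hsin : Measurable fun x => |sinP p x| ^ s :=
    ((continuous_abs.measurable.comp (measurable_sinP p)).pow_const s)
  have hbd : ∀ f : ℝ → ℝ, (∀ x, |f x| ≤ 1) → Measurable (fun x => |f x| ^ s) →
      Integrable (fun x => |f x| ^ s) angleLaw := fun f hf hfm =>
    (integrable_const (1 : ℝ)).mono' hfm.aestronglyMeasurable (Eventually.of_forall fun x => by
      rw [Real.norm_of_nonneg (by positivity)]
      exact Real.rpow_le_one (abs_nonneg _) (hf x) (hα0.le.trans hs))
  rw [powerAverage, integral_comp_weights_node p e l r
    (F := fun L => (L.map fun b => |b| ^ s).sum) (hm _) (K := 1)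
    (fun θ => abs_sum_weights_rpow_le hp hα hs _ θ)]
  rw [← integral_mul_const, ← integral_mul_const,
    ← integral_add ((hbd _ (fun x => abs_cosP_le_one p x hp) hcos).mul_const _)
      ((hbd _ (fun x => abs_sinP_le_one p x hp) hsin).mul_const _)]
  refine Eq.trans ?_ (integral_eval_zero ((hcos.mul_const _).add (hsin.mul_const _)))
  refine integral_congr_ae (Eventually.of_forall fun a => ?_)
  simp only [List.map_append, List.sum_append, sum_map_abs_mul_rpow]
  have h1 : ∀ b : ℕ → ℝ, ∫ c, (|cosP p (a 0)| ^ s * ((weights p l b).map fun b => |b| ^ s).sum +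
      |sinP p (a 0)| ^ s * ((weights p r c).map fun b => |b| ^ s).sum) ∂angleSeqLaw =
      |cosP p (a 0)| ^ s * ((weights p l b).map fun b => |b| ^ s).sum +
      |sinP p (a 0)| ^ s * powerAverage p s r := fun b => by
    rw [integral_add (integrable_const _) ((hi r).const_mul _), integral_const_mul,
      integral_const_mul]
    simp [powerAverage]
  simp only [h1]
  rw [integral_add ((hi l).const_mul _) (integrable_const _), integral_const_mul, integral_const_mul]
  simp [powerAverage]

/-! ### Symmetries of the uniform angle -/

/-- Reflections preserve the uniform angle. The choices c = 0, π, π/2 respectively change the sign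
of s, change the sign of c, and exchange the two. -/
theorem integral_angleLaw_comp_sub {E : Type*} [NormedAddCommGroup E] [NormedSpace ℝ E]
    {f : ℝ → E} (hf : Function.Periodic f (2 * Real.pi)) (c : ℝ) :
    ∫ x, f (c - x) ∂angleLaw = ∫ x, f x ∂angleLaw := by
  rw [integral_angleLaw, integral_angleLaw, intervalIntegral.integral_comp_sub_left]
  have := hf.intervalIntegral_add_eq (c - 2 * Real.pi) 0
  rw [sub_add_cancel, zero_add] at this
  rw [sub_zero, this]

theorem periodic_comp_cosP_sinP {E : Type*} (p : ℝ) (F : ℝ → ℝ → E) :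
    Function.Periodic (fun x => F (cosP p x) (sinP p x)) (2 * Real.pi) := by
  intro x
  simp only [cosP, sinP, Real.cos_add_two_pi, Real.sin_add_two_pi]

theorem integral_neg_sinP (p : ℝ) (F : ℝ → ℝ → ℝ) :
    ∫ x, F (cosP p x) (-sinP p x) ∂angleLaw = ∫ x, F (cosP p x) (sinP p x) ∂angleLaw := by
  rw [← integral_angleLaw_comp_sub (periodic_comp_cosP_sinP p F) 0]
  simp only [cosP, sinP, zero_sub, Real.cos_neg, Real.sin_neg, abs_neg, neg_mul]

theorem integral_neg_cosP (p : ℝ) (F : ℝ → ℝ → ℝ) :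
    ∫ x, F (-cosP p x) (sinP p x) ∂angleLaw = ∫ x, F (cosP p x) (sinP p x) ∂angleLaw := by
  rw [← integral_angleLaw_comp_sub (periodic_comp_cosP_sinP p F) Real.pi]
  simp only [cosP, sinP, Real.cos_pi_sub, Real.sin_pi_sub, abs_neg, neg_mul]

theorem integral_swap_cosP_sinP (p : ℝ) (F : ℝ → ℝ → ℝ) :
    ∫ x, F (sinP p x) (cosP p x) ∂angleLaw = ∫ x, F (cosP p x) (sinP p x) ∂angleLaw := by
  rw [← integral_angleLaw_comp_sub (periodic_comp_cosP_sinP p F) (Real.pi / 2)]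
  simp only [cosP, sinP, Real.cos_pi_div_two_sub, Real.sin_pi_div_two_sub]

theorem integral_eq_zero_of_odd_sinP (p : ℝ) (F : ℝ → ℝ → ℝ) (h : ∀ x y, F x (-y) = -F x y) :
    ∫ x, F (cosP p x) (sinP p x) ∂angleLaw = 0 := by
  have := integral_neg_sinP p F
  simp only [h, integral_neg] at this
  linarith

theorem integral_eq_zero_of_odd_cosP (p : ℝ) (F : ℝ → ℝ → ℝ) (h : ∀ x y, F (-x) y = -F x y) :
    ∫ x, F (cosP p x) (sinP p x) ∂angleLaw = 0 := by
  have := integral_neg_cosP p F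
  simp only [h, integral_neg] at this
  linarith

/-! ### Real and imaginary part of a solution -/

theorem hasDerivAt_charFun_of_isSolution {p : ℝ} {μ₀ : Measure ℝ} {μ : ℝ → Measure ℝ}
    (hμ : IsSolution p μ₀ μ) (ξ : ℝ) {t : ℝ} (ht : 0 < t) :
    HasDerivAt (fun τ => charFun (μ τ) ξ)
      ((∫ x, charFun (μ t) (ξ * sinP p x) * charFun (μ t) (ξ * cosP p x) ∂angleLaw)
        - charFun (μ t) ξ) t := by
  refine (hμ.equation ξ t ht).congr_deriv ?_
  rw [integral_angleLaw, Complex.real_smul]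
  push_cast
  rfl

theorem integrable_angleLaw_of_bound {f : ℝ → ℝ} (hf : Measurable f) {K : ℝ}
    (hK : ∀ x, |f x| ≤ K) : Integrable f angleLaw :=
  (integrable_const K).mono' hf.aestronglyMeasurable (Eventually.of_forall hK)

/-- Im φ is an odd function, so after expanding the product each term with an imaginary factor is
odd in c(θ) or s(θ). Consequently Re φ obeys a closed equation and Im φ a linear one. -/
theorem collision_re_im (p : ℝ) (m : Measure ℝ) [IsProbabilityMeasure m] (ξ : ℝ) :
    (∫ x, charFun m (ξ * sinP p x) * charFun m (ξ * cosP p x) ∂angleLaw) =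
      ((∫ x, (charFun m (ξ * cosP p x)).re * (charFun m (ξ * sinP p x)).re ∂angleLaw : ℝ) : ℂ) := by
  have hsin := (measurable_charFun (μ := m)).comp ((measurable_sinP p).const_mul ξ)
  have hcos := (measurable_charFun (μ := m)).comp ((measurable_cosP p).const_mul ξ)
  have hint : Integrable (fun x => charFun m (ξ * sinP p x) * charFun m (ξ * cosP p x))
      angleLaw := by
    refine (integrable_const (1 : ℝ)).mono' (hsin.mul hcos).aestronglyMeasurable
      (Eventually.of_forall fun x => ?_)
    rw [norm_mul]
    exact mul_le_one₀ (norm_charFun_le_one _) (norm_nonneg _) (norm_charFun_le_one _)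
  have him : ∀ ζ, (charFun m (-ζ)).im = -(charFun m ζ).im := fun ζ => by simp
  have bre : ∀ ζ, |(charFun m ζ).re| ≤ 1 := fun ζ =>
    (Complex.abs_re_le_norm _).trans (norm_charFun_le_one _)
  have bim : ∀ ζ, |(charFun m ζ).im| ≤ 1 := fun ζ =>
    (Complex.abs_im_le_norm _).trans (norm_charFun_le_one _)
  have hmul : ∀ f g : ℝ → ℝ, Measurable f → Measurable g → (∀ x, |f x| ≤ 1) → (∀ x, |g x| ≤ 1) →
      Integrable (fun x => f x * g x) angleLaw := fun f g hf hg hf1 hg1 =>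
    integrable_angleLaw_of_bound (hf.mul hg) (K := 1) fun x => by
      rw [abs_mul]; exact mul_le_one₀ (hf1 x) (abs_nonneg _) (hg1 x)
  have rs : Measurable fun x => (charFun m (ξ * sinP p x)).re :=
    Complex.measurable_re.comp hsin
  have rc : Measurable fun x => (charFun m (ξ * cosP p x)).re :=
    Complex.measurable_re.comp hcos
  have is : Measurable fun x => (charFun m (ξ * sinP p x)).im :=
    Complex.measurable_im.comp hsin
  have ic : Measurable fun x => (charFun m (ξ * cosP p x)).im :=
    Complex.measurable_im.comp hcos
  have z1 := integral_eq_zero_of_odd_sinP p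
    (fun x y => (charFun m (ξ * y)).im * (charFun m (ξ * x)).im) (fun x y => by
      rw [mul_neg, him]; ring)
  have z2 := integral_eq_zero_of_odd_cosP p
    (fun x y => (charFun m (ξ * y)).re * (charFun m (ξ * x)).im) (fun x y => by
      rw [mul_neg, him]; ring)
  have z3 := integral_eq_zero_of_odd_sinP p
    (fun x y => (charFun m (ξ * y)).im * (charFun m (ξ * x)).re) (fun x y => by
      rw [mul_neg, him]; ring)
  refine Complex.ext ?_ ?_
  · have h1 := Complex.reCLM.integral_comp_comm hint
    simp only [Complex.reCLM_apply, Complex.mul_re] at h1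
    rw [← h1, Complex.ofReal_re, integral_sub
      (hmul _ _ rs rc (fun x => bre _) (fun x => bre _))
      (hmul _ _ is ic (fun x => bim _) (fun x => bim _)), z1, sub_zero]
    exact integral_congr_ae (Eventually.of_forall fun x => mul_comm _ _)
  · have h1 := Complex.imCLM.integral_comp_comm hint
    simp only [Complex.imCLM_apply, Complex.mul_im] at h1
    rw [← h1, Complex.ofReal_im, integral_add
      (hmul _ _ rs ic (fun x => bre _) (fun x => bim _))
      (hmul _ _ is rc (fun x => bim _) (fun x => bre _)), z2, z3, add_zero]

theorem hasDerivAt_re_of_isSolution {p : ℝ} {μ₀ : Measure ℝ} {μ : ℝ → Measure ℝ}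
    (hμ : IsSolution p μ₀ μ) (ξ : ℝ) {t : ℝ} (ht : 0 < t) :
    HasDerivAt (fun τ => (charFun (μ τ) ξ).re)
      ((∫ x, (charFun (μ t) (ξ * cosP p x)).re * (charFun (μ t) (ξ * sinP p x)).re ∂angleLaw)
        - (charFun (μ t) ξ).re) t := by
  have := hμ.isProbabilityMeasure t ht.le
  have h := hasDerivAt_charFun_of_isSolution hμ ξ ht
  rw [collision_re_im] at h
  exact (Complex.reCLM.hasFDerivAt.comp_hasDerivAt t h).congr_deriv (by simp)

theorem hasDerivAt_im_of_isSolution {p : ℝ} {μ₀ : Measure ℝ} {μ : ℝ → Measure ℝ}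
    (hμ : IsSolution p μ₀ μ) (ξ : ℝ) {t : ℝ} (ht : 0 < t) :
    HasDerivAt (fun τ => (charFun (μ τ) ξ).im) (-(charFun (μ t) ξ).im) t := by
  have := hμ.isProbabilityMeasure t ht.le
  have h := hasDerivAt_charFun_of_isSolution hμ ξ ht
  rw [collision_re_im] at h
  exact (Complex.imCLM.hasFDerivAt.comp_hasDerivAt t h).congr_deriv (by simp)

theorem abs_le_of_abs_deriv_le {f f' B B' : ℝ → ℝ} (hf : ContinuousOn f (Set.Ici 0))
    (hB : ContinuousOn B (Set.Ici 0)) (hf' : ∀ t, 0 < t → HasDerivAt f (f' t) t)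
    (hB' : ∀ t, 0 < t → HasDerivAt B (B' t) t) (h0 : |f 0| ≤ B 0)
    (h : ∀ t, 0 < t → |f' t| ≤ B' t) {t : ℝ} (ht : 0 ≤ t) : |f t| ≤ B t := by
  have hi : interior (Set.Ici (0 : ℝ)) = Set.Ioi 0 := interior_Ici
  have mono : ∀ g g' : ℝ → ℝ, ContinuousOn g (Set.Ici 0) → (∀ t, 0 < t → HasDerivAt g (g' t) t) →
      (∀ t, 0 < t → 0 ≤ g' t) → g 0 ≤ g t := fun g g' hg hg' h0 => by
    refine monotoneOn_of_deriv_nonneg (convex_Ici 0) hg ?_ ?_ (Set.mem_Ici.2 le_rfl) ht ht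
    · rw [hi]; exact fun s hs => (hg' s hs).differentiableAt.differentiableWithinAt
    · rw [hi]; exact fun s hs => by rw [(hg' s hs).deriv]; exact h0 s hs
  have h1 := mono (fun s => B s - f s) _ (hB.sub hf) (fun s hs => (hB' s hs).sub (hf' s hs))
    (fun s hs => by linarith [(abs_le.1 (h s hs)).2])
  have h2 := mono (fun s => B s + f s) _ (hB.add hf) (fun s hs => (hB' s hs).add (hf' s hs))
    (fun s hs => by linarith [(abs_le.1 (h s hs)).1])
  obtain ⟨h3, h4⟩ := abs_le.1 h0
  exact abs_le.2 ⟨by linarith, by linarith⟩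

theorem im_charFun_of_isSolution {p : ℝ} {μ₀ : Measure ℝ} {μ : ℝ → Measure ℝ}
    (hμ : IsSolution p μ₀ μ) (ξ : ℝ) {t : ℝ} (ht : 0 ≤ t) :
    (charFun (μ t) ξ).im = Real.exp (-t) * (charFun μ₀ ξ).im := by
  -- Comparison with B = 0: e^s Im φ(ξ,s) is constant.
  have h := abs_le_of_abs_deriv_le
    (f := fun s => Real.exp s * (charFun (μ s) ξ).im - (charFun μ₀ ξ).im) (B := fun _ => 0)
    (f' := fun _ => 0) (B' := fun _ => 0)
    ((Real.continuous_exp.continuousOn.mul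
      (Complex.continuous_im.comp_continuousOn (hμ.continuousOn ξ))).sub continuousOn_const)
    continuousOn_const (fun s hs => ?_) (fun s _ => hasDerivAt_const s _)
    (by simp [hμ.initial]) (by simp) ht
  · have h2 := abs_nonpos_iff.1 h
    have h3 : Real.exp (-t) * Real.exp t = 1 := by rw [← Real.exp_add]; simp
    calc (charFun (μ t) ξ).im = Real.exp (-t) * (Real.exp t * (charFun (μ t) ξ).im) := by
          rw [← mul_assoc, h3, one_mul]
      _ = _ := by rw [sub_eq_zero.1 h2]
  · refine (((Real.hasDerivAt_exp s).mul (hasDerivAt_im_of_isSolution hμ ξ hs)).sub_const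
      _).congr_deriv ?_
    ring

/-! ### The Wild sum -/

/-- Wild's recursion: the averages over trees of a given size are the coefficients of the power
series solution in 1 - e^{-t}. -/
theorem treeAverage_prodAverage_succ (p : ℝ) {u : ℝ → ℝ} (hum : Measurable u)
    (hu : ∀ x, |u x| ≤ 1) (ξ : ℝ) (n : ℕ) :
    ((n : ℝ) + 1) * treeAverage (prodAverage p u ξ) (n + 1) =
      ∫ x, ∑ k ∈ Finset.range (n + 1), treeAverage (prodAverage p u (ξ * cosP p x)) k *
        treeAverage (prodAverage p u (ξ * sinP p x)) (n - k) ∂angleLaw := by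
  have hmc := fun g => (measurable_prodAverage p hum g).comp ((measurable_cosP p).const_mul ξ)
  have hms := fun g => (measurable_prodAverage p hum g).comp ((measurable_sinP p).const_mul ξ)
  have hi : ∀ l r, Integrable (fun x => prodAverage p u (ξ * cosP p x) l *
      prodAverage p u (ξ * sinP p x) r) angleLaw := fun l r =>
    integrable_angleLaw_of_bound ((hmc l).mul (hms r)) (K := 1) fun x => by
      rw [abs_mul]
      exact mul_le_one₀ (abs_prodAverage_le_one p hu _ _) (abs_nonneg _)
        (abs_prodAverage_le_one p hu _ _)
  rw [treeAverage, sum_treesOfNumNodesEq_succ]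
  simp only [prodAverage_node p hum hu]
  have e : ∀ x, ∑ k ∈ Finset.range (n + 1), treeAverage (prodAverage p u (ξ * cosP p x)) k *
        treeAverage (prodAverage p u (ξ * sinP p x)) (n - k) =
      ∑ ij ∈ Finset.HasAntidiagonal.antidiagonal n, ∑ l ∈ BinaryTree.treesOfNumNodesEq ij.1,
        ∑ r ∈ BinaryTree.treesOfNumNodesEq ij.2, treeProb l * treeProb r *
          (prodAverage p u (ξ * cosP p x) l * prodAverage p u (ξ * sinP p x) r) := fun x => by
    rw [Finset.Nat.sum_antidiagonal_eq_sum_range_succ (fun i j =>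
      ∑ l ∈ BinaryTree.treesOfNumNodesEq i, ∑ r ∈ BinaryTree.treesOfNumNodesEq j,
        treeProb l * treeProb r *
          (prodAverage p u (ξ * cosP p x) l * prodAverage p u (ξ * sinP p x) r))]
    refine Finset.sum_congr rfl fun k _ => ?_
    rw [treeAverage, treeAverage, Finset.sum_mul_sum]
    refine Finset.sum_congr rfl fun l _ => Finset.sum_congr rfl fun r _ => ?_
    ring
  simp only [e]
  rw [integral_finsetSum _ fun ij _ => integrable_finsetSum _ fun l _ =>
    integrable_finsetSum _ fun r _ => (hi l r).const_mul _]
  refine Finset.sum_congr rfl fun ij _ => ?_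
  rw [integral_finsetSum _ fun l _ => integrable_finsetSum _ fun r _ => (hi l r).const_mul _]
  refine Finset.sum_congr rfl fun l _ => ?_
  rw [integral_finsetSum _ fun r _ => (hi l r).const_mul _]
  refine Finset.sum_congr rfl fun r _ => ?_
  rw [integral_const_mul]

theorem abs_treeAverage_le_one {h : BinaryTree Unit → ℝ} (hh : ∀ g, |h g| ≤ 1) (n : ℕ) :
    |treeAverage h n| ≤ 1 := by
  rw [← sum_treeProb_treesOfNumNodesEq n]
  refine (Finset.abs_sum_le_sum_abs _ _).trans (Finset.sum_le_sum fun g _ => ?_)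
  rw [abs_mul, abs_of_nonneg (treeProb_nonneg g)]
  exact mul_le_of_le_one_right (treeProb_nonneg g) (hh g)

/-- The error made by the truncated convolution of two approximations. -/
theorem abs_mul_sub_sum_mul_le {U V z ε : ℝ} (hz : 0 ≤ z) (hε : 0 ≤ ε) {a b : ℕ → ℝ} (N : ℕ)
    (ha : ∀ i, |a i| ≤ ε * z ^ i) (hV : |V| ≤ 1)
    (hb : ∀ m ≤ N, |V - ∑ j ∈ Finset.range m, b j| ≤ z ^ m)
    (hU : |U - ∑ i ∈ Finset.range N, a i| ≤ z ^ N) :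
    |U * V - ∑ i ∈ Finset.range N, a i * ∑ j ∈ Finset.range (N - i), b j| ≤
      z ^ N * (1 + N * ε) := by
  -- The inner sum stops at N - i, so its error z^{N-i} combines with |a i| ≤ ε z^i into ε z^N,
  -- independently of i.
  have e : U * V - ∑ i ∈ Finset.range N, a i * ∑ j ∈ Finset.range (N - i), b j =
      (U - ∑ i ∈ Finset.range N, a i) * V +
        ∑ i ∈ Finset.range N, a i * (V - ∑ j ∈ Finset.range (N - i), b j) := by
    simp only [mul_sub, Finset.sum_sub_distrib, sub_mul, Finset.sum_mul]
    ring
  have h1 : |(U - ∑ i ∈ Finset.range N, a i) * V| ≤ z ^ N := by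
    rw [abs_mul]
    exact (mul_le_of_le_one_right (abs_nonneg _) hV).trans hU
  have h2 : |∑ i ∈ Finset.range N, a i * (V - ∑ j ∈ Finset.range (N - i), b j)| ≤
      ∑ _i ∈ Finset.range N, ε * z ^ N := by
    refine (Finset.abs_sum_le_sum_abs _ _).trans (Finset.sum_le_sum fun i hi => ?_)
    have hiN : i ≤ N := (Finset.mem_range.1 hi).le
    rw [abs_mul]
    calc |a i| * |V - ∑ j ∈ Finset.range (N - i), b j| ≤ (ε * z ^ i) * z ^ (N - i) :=
          mul_le_mul (ha i) (hb _ (Nat.sub_le _ _)) (abs_nonneg _) (by positivity)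
      _ = ε * z ^ N := by rw [mul_assoc, ← pow_add, Nat.add_sub_cancel' hiN]
  rw [Finset.sum_const, Finset.card_range, nsmul_eq_mul] at h2
  rw [e]
  refine (abs_add_le _ _).trans ?_
  linarith

theorem hasDerivAt_one_sub_exp_neg (t : ℝ) :
    HasDerivAt (fun s => 1 - Real.exp (-s)) (Real.exp (-t)) t := by
  have := ((hasDerivAt_id t).neg.exp).const_sub 1
  simpa using! this

/-- Differentiation produces the combination (n+1) q(n+1) that Wild's recursion evaluates, and
lowers the truncation order by one. -/
theorem hasDerivAt_sum_pow_mul (t : ℝ) (q : ℕ → ℝ) (N : ℕ) :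
    HasDerivAt (fun s => ∑ n ∈ Finset.range (N + 1), (1 - Real.exp (-s)) ^ n * q n)
      (Real.exp (-t) * ∑ n ∈ Finset.range N, (1 - Real.exp (-t)) ^ n * (((n : ℝ) + 1) * q (n + 1)))
      t := by
  simp only [Finset.sum_range_succ']
  have h : ∀ n ∈ Finset.range N, HasDerivAt (fun s => (1 - Real.exp (-s)) ^ (n + 1) * q (n + 1))
      (Real.exp (-t) * ((1 - Real.exp (-t)) ^ n * (((n : ℝ) + 1) * q (n + 1)))) t := fun n _ => by
    refine (((hasDerivAt_one_sub_exp_neg t).pow (n + 1)).mul_const _).congr_deriv ?_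
    push_cast
    ring
  have h2 := (HasDerivAt.fun_sum h).add_const ((1 : ℝ) * q 0)
  rw [← Finset.mul_sum] at h2
  simpa using! h2

theorem exp_mul_wildSum (t : ℝ) (h : BinaryTree Unit → ℝ) (N : ℕ) :
    Real.exp t * wildSum t h N =
      ∑ n ∈ Finset.range N, (1 - Real.exp (-t)) ^ n * treeAverage h n := by
  rw [wildSum, Finset.mul_sum]
  refine Finset.sum_congr rfl fun n _ => ?_
  have h3 : Real.exp t * Real.exp (-t) = 1 := by rw [← Real.exp_add]; simp
  rw [← mul_assoc, ← mul_assoc, h3, one_mul]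

/-- The Wild sums approximate every bounded solution of the equation for real characteristic
functions. -/
theorem abs_sub_wildSum_le {p : ℝ} {u : ℝ → ℝ → ℝ} (hum : ∀ t, 0 ≤ t → Measurable (u t))
    (hu : ∀ t, 0 ≤ t → ∀ x, |u t x| ≤ 1)
    (huc : ∀ ξ, ContinuousOn (fun t => u t ξ) (Set.Ici 0))
    (hud : ∀ ξ t, 0 < t → HasDerivAt (fun τ => u τ ξ)
      ((∫ x, u t (ξ * cosP p x) * u t (ξ * sinP p x) ∂angleLaw) - u t ξ) t) (N : ℕ) :
    ∀ (ξ : ℝ) {t : ℝ}, 0 ≤ t →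
      |u t ξ - wildSum t (prodAverage p (u 0) ξ) N| ≤ (1 - Real.exp (-t)) ^ N := by
  induction N using Nat.strong_induction_on with
  | _ N ih =>
  cases N with
  | zero => intro ξ t ht; simpa [wildSum] using hu t ht ξ
  | succ N =>
  intro ξ t ht
  have h0m := hum 0 le_rfl
  have h0 := hu 0 le_rfl
  set Q : ℝ → ℕ → ℝ := fun ξ n => treeAverage (prodAverage p (u 0) ξ) n with hQ
  have hQ1 : ∀ ξ n, |Q ξ n| ≤ 1 := fun ξ n =>
    abs_treeAverage_le_one (abs_prodAverage_le_one p h0 ξ) n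
  have hQm : ∀ n, Measurable fun ξ => Q ξ n := fun n => by
    simp only [hQ, treeAverage]
    exact Finset.measurable_sum _ fun g _ => (measurable_prodAverage p h0m g).const_mul _
  have hexp : ∀ s, Real.exp s * Real.exp (-s) = 1 := fun s => by rw [← Real.exp_add]; simp
  -- The factor e^s removes the loss term. With z = 1 - e^{-s}, the derivative of e^s z^{N+1} is e^s
  -- z^N (1 + N e^{-s}), exactly e^s times the convolution error of `abs_mul_sub_sum_mul_le`; the
  -- induction thus closes without loss.
  have key := abs_le_of_abs_deriv_le (t := t)
    (f := fun s => Real.exp s * u s ξ -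
      ∑ n ∈ Finset.range (N + 1), (1 - Real.exp (-s)) ^ n * Q ξ n)
    (f' := fun s => Real.exp s * (∫ x, u s (ξ * cosP p x) * u s (ξ * sinP p x) ∂angleLaw) -
      Real.exp (-s) * ∑ n ∈ Finset.range N, (1 - Real.exp (-s)) ^ n *
        (((n : ℝ) + 1) * Q ξ (n + 1)))
    (B := fun s => Real.exp s * (1 - Real.exp (-s)) ^ (N + 1))
    (B' := fun s => Real.exp s * ((1 - Real.exp (-s)) ^ N * (1 + N * Real.exp (-s))))
    ((Real.continuous_exp.continuousOn.mul (huc ξ)).sub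
      (Continuous.continuousOn (by fun_prop)))
    (Continuous.continuousOn (by fun_prop)) (fun s hs => ?_) (fun s hs => ?_) ?_ (fun s hs => ?_) ht
  · rw [← exp_mul_wildSum, ← mul_sub, abs_mul, abs_of_pos (Real.exp_pos t)] at key
    exact le_of_mul_le_mul_left key (Real.exp_pos t)
  · refine (((Real.hasDerivAt_exp s).mul (hud ξ s hs)).sub
      (hasDerivAt_sum_pow_mul s (Q ξ) N)).congr_deriv ?_
    ring
  · refine ((Real.hasDerivAt_exp s).mul
      ((hasDerivAt_one_sub_exp_neg s).pow (N + 1))).congr_deriv ?_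
    simp only [Pi.pow_apply]
    push_cast
    ring
  · rw [Finset.sum_range_succ']
    simp [hQ, treeAverage, treeProb, prodAverage_nil]
  · set z := 1 - Real.exp (-s) with hz
    have hz0 : 0 ≤ z := one_sub_exp_neg_nonneg hs.le
    set ε := Real.exp (-s) with hε
    have hε0 : 0 < ε := Real.exp_pos _
    have hum' := hum s hs.le
    have hmc : Measurable fun x => ξ * cosP p x := (measurable_cosP p).const_mul ξ
    have hms : Measurable fun x => ξ * sinP p x := (measurable_sinP p).const_mul ξ
    have e1 : ∑ n ∈ Finset.range N, z ^ n * (((n : ℝ) + 1) * Q ξ (n + 1)) =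
        ∫ x, ∑ n ∈ Finset.range N, ∑ k ∈ Finset.range (n + 1), (z ^ k * Q (ξ * cosP p x) k) *
          (z ^ (n - k) * Q (ξ * sinP p x) (n - k)) ∂angleLaw := by
      rw [integral_finsetSum]
      · refine Finset.sum_congr rfl fun n _ => ?_
        rw [treeAverage_prodAverage_succ p h0m h0, ← integral_const_mul]
        refine integral_congr_ae (Eventually.of_forall fun x => ?_)
        simp only
        rw [Finset.mul_sum]
        refine Finset.sum_congr rfl fun k hk => ?_
        have : z ^ n = z ^ k * z ^ (n - k) := by
          rw [← pow_add, Nat.add_sub_cancel' (Nat.lt_succ_iff.1 (Finset.mem_range.1 hk))]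
        rw [this]
        ring
      · intro n _
        refine integrable_finsetSum _ fun k _ => ?_
        refine integrable_angleLaw_of_bound (K := z ^ k * z ^ (n - k))
          ((((hQm k).comp hmc).const_mul _).mul (((hQm (n - k)).comp hms).const_mul _))
          fun x => ?_
        rw [abs_mul, abs_mul, abs_mul, abs_of_nonneg (pow_nonneg hz0 _),
          abs_of_nonneg (pow_nonneg hz0 _)]
        exact mul_le_mul (mul_le_of_le_one_right (by positivity) (hQ1 _ _))
          (mul_le_of_le_one_right (by positivity) (hQ1 _ _)) (by positivity) (by positivity)
    -- Reordering the triangular sum by its first index gives the shape required by the error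
    -- estimate.
    have e2 : ∀ x, ∑ n ∈ Finset.range N, ∑ k ∈ Finset.range (n + 1), (z ^ k * Q (ξ * cosP p x) k) *
          (z ^ (n - k) * Q (ξ * sinP p x) (n - k)) =
        ∑ i ∈ Finset.range N, (z ^ i * Q (ξ * cosP p x) i) *
          ∑ j ∈ Finset.range (N - i), z ^ j * Q (ξ * sinP p x) j := fun x => by
      rw [Finset.sum_range_diag_flip N fun i j =>
        (z ^ i * Q (ξ * cosP p x) i) * (z ^ j * Q (ξ * sinP p x) j)]
      simp only [Finset.mul_sum]
    simp only [e2] at e1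
    have hS : ∀ (ζ : ℝ) (m : ℕ), wildSum s (prodAverage p (u 0) ζ) m =
        ∑ j ∈ Finset.range m, ε * (z ^ j * Q ζ j) := fun ζ m => by
      simp only [wildSum, hQ, ← hε, ← hz, mul_assoc]
    have hbound : ∀ x, |u s (ξ * cosP p x) * u s (ξ * sinP p x) -
        ε * (ε * ∑ i ∈ Finset.range N, (z ^ i * Q (ξ * cosP p x) i) *
          ∑ j ∈ Finset.range (N - i), z ^ j * Q (ξ * sinP p x) j)| ≤ z ^ N * (1 + N * ε) := by
      intro x
      have h := abs_mul_sub_sum_mul_le (U := u s (ξ * cosP p x)) (V := u s (ξ * sinP p x)) hz0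
        hε0.le (a := fun i => ε * (z ^ i * Q (ξ * cosP p x) i))
        (b := fun j => ε * (z ^ j * Q (ξ * sinP p x) j)) N (fun i => ?_) (hu s hs.le _)
        (fun m hm => ?_) ?_
      · refine le_trans (le_of_eq ?_) h
        congr 2
        simp only [Finset.mul_sum]
        refine Finset.sum_congr rfl fun i _ => Finset.sum_congr rfl fun j _ => ?_
        ring
      · rw [abs_mul, abs_mul, abs_of_pos hε0, abs_of_nonneg (pow_nonneg hz0 _)]
        exact mul_le_mul_of_nonneg_left (mul_le_of_le_one_right (by positivity) (hQ1 _ _)) hε0.le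
      · rw [← hS]
        exact ih m (by omega) _ hs.le
      · rw [← hS]
        exact ih N (by omega) _ hs.le
    have hi1 : Integrable (fun x => u s (ξ * cosP p x) * u s (ξ * sinP p x)) angleLaw :=
      integrable_angleLaw_of_bound ((hum'.comp hmc).mul (hum'.comp hms)) (K := 1) fun x => by
        rw [abs_mul]
        exact mul_le_one₀ (hu s hs.le _) (abs_nonneg _) (hu s hs.le _)
    have hmR : Measurable fun x => ∑ i ∈ Finset.range N, (z ^ i * Q (ξ * cosP p x) i) *
          ∑ j ∈ Finset.range (N - i), z ^ j * Q (ξ * sinP p x) j :=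
      Finset.measurable_sum _ fun i _ => (((hQm i).comp hmc).const_mul _).mul
        (Finset.measurable_sum _ fun j _ => ((hQm j).comp hms).const_mul _)
    have hi3 : Integrable (fun x => u s (ξ * cosP p x) * u s (ξ * sinP p x) -
        ε * (ε * ∑ i ∈ Finset.range N, (z ^ i * Q (ξ * cosP p x) i) *
          ∑ j ∈ Finset.range (N - i), z ^ j * Q (ξ * sinP p x) j)) angleLaw :=
      integrable_angleLaw_of_bound (((hum'.comp hmc).mul (hum'.comp hms)).sub
        ((hmR.const_mul _).const_mul _)) hbound
    have hi2 : Integrable (fun x => ε * (ε * ∑ i ∈ Finset.range N, (z ^ i * Q (ξ * cosP p x) i) *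
          ∑ j ∈ Finset.range (N - i), z ^ j * Q (ξ * sinP p x) j)) angleLaw := by
      have := hi1.sub hi3
      refine this.congr (Eventually.of_forall fun x => ?_)
      simp
    -- Each of the two Wild sums in the product carries a factor e^{-s}, whereas the differentiated
    -- sum carries only one.
    have hε2 : ε = Real.exp s * (ε * ε) := by rw [← mul_assoc, hexp, one_mul]
    rw [e1]
    conv_lhs => rw [show ∀ I J : ℝ, Real.exp s * I - ε * J = Real.exp s * (I - ε * (ε * J)) by
      intro I J; rw [mul_sub]; congr 1; nth_rewrite 1 [hε2]; ring]
    rw [abs_mul, abs_of_pos (Real.exp_pos s)]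
    refine mul_le_mul_of_nonneg_left ?_ (Real.exp_pos s).le
    rw [← integral_const_mul, ← integral_const_mul, ← integral_sub hi1 hi2]
    have := norm_integral_le_of_norm_le_const (μ := angleLaw)
      (f := fun x => u s (ξ * cosP p x) * u s (ξ * sinP p x) -
        ε * (ε * ∑ i ∈ Finset.range N, (z ^ i * Q (ξ * cosP p x) i) *
          ∑ j ∈ Finset.range (N - i), z ^ j * Q (ξ * sinP p x) j))
      (Eventually.of_forall hbound)
    simpa using this

/-! ### Probabilistic representation of the solution -/

theorem isProbabilityMeasure_treeAngleLaw {t : ℝ} (ht : 0 ≤ t) :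
    IsProbabilityMeasure (treeAngleLaw t) := by
  have := isProbabilityMeasure_treeLaw ht
  unfold treeAngleLaw
  infer_instance

theorem integral_treeAngleLaw {t : ℝ} (ht : 0 ≤ t) {F : BinaryTree Unit × (ℕ → ℝ) → ℝ}
    (hF : Measurable F) {K : ℝ} (hK : ∀ ω, |F ω| ≤ K) :
    Tendsto (wildSum t fun g => ∫ θ, F (g, θ) ∂angleSeqLaw) atTop
      (𝓝 (∫ ω, F ω ∂(treeAngleLaw t))) := by
  have := isProbabilityMeasure_treeLaw ht
  have := isProbabilityMeasure_treeAngleLaw ht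
  have hi : Integrable F ((treeLaw t).prod angleSeqLaw) :=
    (integrable_const K).mono' hF.aestronglyMeasurable (Eventually.of_forall hK)
  have h := integral_prod F hi
  rw [treeAngleLaw, h]
  exact tendsto_wildSum_integral_treeLaw ht hi.integral_prod_left

/-- The Wild sums converge to the solution geometrically, and to the expectation because they
exhaust the law of the tree. -/
theorem re_charFun_of_isSolution {p : ℝ} {μ₀ : Measure ℝ} [IsProbabilityMeasure μ₀]
    {μ : ℝ → Measure ℝ} (hμ : IsSolution p μ₀ μ) {t : ℝ} (ht : 0 ≤ t) (ξ : ℝ) :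
    (charFun (μ t) ξ).re =
      ∫ ω, ((weights p ω.1 ω.2).map fun b => (charFun μ₀ (ξ * b)).re).prod ∂(treeAngleLaw t) := by
  have hm : ∀ m : Measure ℝ, [IsProbabilityMeasure m] → Measurable fun x => (charFun m x).re :=
    fun m _ => Complex.measurable_re.comp measurable_charFun
  have hb : ∀ m : Measure ℝ, [IsProbabilityMeasure m] → ∀ x, |(charFun m x).re| ≤ 1 :=
    fun m _ x => (Complex.abs_re_le_norm _).trans (norm_charFun_le_one _)
  have h1 := integral_treeAngleLaw ht (measurable_prod_weights p (hm μ₀) ξ)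
    (fun ω => abs_prod_map_le_one (fun x => hb μ₀ (ξ * x)) _)
  have h2 : ∀ N, |(charFun (μ t) ξ).re -
      wildSum t (prodAverage p (fun x => (charFun μ₀ x).re) ξ) N| ≤ (1 - Real.exp (-t)) ^ N :=
    fun N => by
    have := abs_sub_wildSum_le (p := p) (u := fun t x => (charFun (μ t) x).re)
      (fun s hs => by have := hμ.isProbabilityMeasure s hs; exact hm (μ s))
      (fun s hs => by have := hμ.isProbabilityMeasure s hs; exact hb (μ s))
      (fun x => Complex.continuous_re.comp_continuousOn (hμ.continuousOn x))
      (fun x s hs => hasDerivAt_re_of_isSolution hμ x hs) N ξ ht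
    simpa only [hμ.initial] using this
  have h3 : Tendsto (wildSum t (prodAverage p (fun x => (charFun μ₀ x).re) ξ)) atTop
      (𝓝 (charFun (μ t) ξ).re) := by
    rw [tendsto_iff_dist_tendsto_zero]
    refine squeeze_zero (fun _ => dist_nonneg) (fun N => ?_)
      (tendsto_pow_atTop_nhds_zero_of_lt_one (one_sub_exp_neg_nonneg ht)
        (one_sub_exp_neg_lt_one t))
    rw [dist_comm, Real.dist_eq]
    exact h2 N
  exact tendsto_nhds_unique h3 h1

/-! ### The symmetrized law and the conditional law -/

/-- The symmetrization of a law. -/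
noncomputable def evenPart (m : Measure ℝ) : Measure ℝ :=
  (2⁻¹ : ℝ≥0∞) • (m + m.map fun x => -x)

instance (m : Measure ℝ) [IsProbabilityMeasure m] : IsProbabilityMeasure (evenPart m) := by
  have : IsProbabilityMeasure (m.map fun x => -x) :=
    Measure.isProbabilityMeasure_map measurable_neg.aemeasurable
  refine ⟨?_⟩
  rw [evenPart, Measure.smul_apply, Measure.add_apply, measure_univ, measure_univ, smul_eq_mul,
    one_add_one_eq_two]
  exact ENNReal.inv_mul_cancel (by simp) (by simp)

theorem charFun_evenPart (m : Measure ℝ) [IsProbabilityMeasure m] (ξ : ℝ) :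
    charFun (evenPart m) ξ = ((charFun m ξ).re : ℂ) := by
  have : IsProbabilityMeasure (m.map fun x => -x) :=
    Measure.isProbabilityMeasure_map measurable_neg.aemeasurable
  have hi : ∀ n : Measure ℝ, [IsProbabilityMeasure n] →
      Integrable (fun x : ℝ => Complex.exp (ξ * x * Complex.I)) n := fun n _ => by
    refine (integrable_const (1 : ℝ)).mono' (by fun_prop) (Eventually.of_forall fun x => ?_)
    rw [← Complex.ofReal_mul, Complex.norm_exp_ofReal_mul_I]
  have h1 : charFun (m.map fun x => -x) ξ = charFun m (-ξ) := by
    rw [charFun_apply_real, charFun_apply_real, integral_map measurable_neg.aemeasurable (by fun_prop)]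
    simp
  rw [charFun_apply_real, evenPart, integral_smul_measure, integral_add_measure (hi _) (hi _),
    ← charFun_apply_real, ← charFun_apply_real, h1, charFun_neg, Complex.add_conj]
  simp

theorem cdf_evenPart (m : Measure ℝ) [IsProbabilityMeasure m] (x : ℝ) :
    cdf (evenPart m) x = cdfStar m x := by
  have h1 : (fun y : ℝ => -y) ⁻¹' Set.Iic x = (Set.Iio (-x))ᶜ := by
    ext y
    simp only [Set.mem_preimage, Set.mem_Iic, Set.mem_compl_iff, Set.mem_Iio, not_lt]
    exact neg_le
  rw [cdf_eq_real, cdfStar, cdf_eq_real, evenPart, measureReal_ennreal_smul_apply,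
    measureReal_add_apply, map_measureReal_apply measurable_neg measurableSet_Iic, h1,
    probReal_compl_eq_one_sub measurableSet_Iio]
  simp
  ring

/-- The sum of independent random variables of law `m`, weighted by `weights p ω.1 ω.2`. -/
noncomputable def weightedSum (p : ℝ) (ω : BinaryTree Unit × (ℕ → ℝ)) (x : ℕ → ℝ) : ℝ :=
  ∑ j ∈ Finset.range (ω.1.numNodes + 1), (weights p ω.1 ω.2).getD j 0 * x j

theorem measurable_weightedSum (p : ℝ) :
    Measurable fun z : (BinaryTree Unit × (ℕ → ℝ)) × (ℕ → ℝ) => weightedSum p z.1 z.2 := by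
  have h : Measurable fun z : BinaryTree Unit × ((ℕ → ℝ) × (ℕ → ℝ)) =>
      weightedSum p (z.1, z.2.1) z.2.2 := by
    refine measurable_from_prod_countable_right fun g => ?_
    simp only [weightedSum]
    exact Finset.measurable_sum _ fun j _ =>
      ((measurable_getD_weights p g j).comp measurable_fst).mul
        ((measurable_pi_apply j).comp measurable_snd)
  exact h.comp MeasurableEquiv.prodAssoc.measurable

/-- The law of the weighted sum, for given weights. -/
noncomputable def weightedLaw (p : ℝ) (m : Measure ℝ) (ω : BinaryTree Unit × (ℕ → ℝ)) :
    Measure ℝ :=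
  (Measure.infinitePi fun _ : ℕ => m).map (weightedSum p ω)

theorem measurable_weightedSum_right (p : ℝ) (ω : BinaryTree Unit × (ℕ → ℝ)) :
    Measurable (weightedSum p ω) :=
  (measurable_weightedSum p).comp measurable_prodMk_left

instance (p : ℝ) (m : Measure ℝ) [IsProbabilityMeasure m] (ω : BinaryTree Unit × (ℕ → ℝ)) :
    IsProbabilityMeasure (weightedLaw p m ω) :=
  Measure.isProbabilityMeasure_map (measurable_weightedSum_right p ω).aemeasurable

theorem charFun_weightedLaw (p : ℝ) (m : Measure ℝ) [IsProbabilityMeasure m]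
    (ω : BinaryTree Unit × (ℕ → ℝ)) (ξ : ℝ) :
    charFun (weightedLaw p m ω) ξ =
      ((weights p ω.1 ω.2).map fun b => charFun m (ξ * b)).prod := by
  have hind : iIndepFun (fun (i : ℕ) (x : ℕ → ℝ) => (weights p ω.1 ω.2).getD i 0 * x i)
      (Measure.infinitePi fun _ : ℕ => m) :=
    iIndepFun_infinitePi (P := fun _ : ℕ => m)
      (X := fun i y => (weights p ω.1 ω.2).getD i 0 * y) (fun i => measurable_const_mul _)
  have h := (hind.restrict (Finset.range (ω.1.numNodes + 1))).charFun_map_fun_finsetSum_eq_prod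
    (fun i _ => (by fun_prop :
      Measurable fun x : ℕ → ℝ => (weights p ω.1 ω.2).getD i 0 * x i).aemeasurable)
  have h2 := congrFun h ξ
  rw [Finset.prod_apply] at h2
  rw [weightedLaw]
  refine Eq.trans h2 ?_
  rw [map_weights_eq]
  refine Eq.trans (Finset.prod_congr rfl fun j _ => ?_) (rfl : ∏ j ∈ Finset.range
    (ω.1.numNodes + 1), charFun m (ξ * (weights p ω.1 ω.2).getD j 0) = _)
  have h3 : (Measure.infinitePi fun _ : ℕ => m).map (fun x => (weights p ω.1 ω.2).getD j 0 * x j) =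
      m.map fun y => (weights p ω.1 ω.2).getD j 0 * y := by
    conv_rhs => rw [← (measurePreserving_eval_infinitePi (fun _ : ℕ => m) j).map_eq]
    rw [Measure.map_map (by fun_prop) (by fun_prop)]
    rfl
  rw [h3, charFun_map_mul, mul_comm]

theorem charFun_weightedLaw_evenPart (p : ℝ) (m : Measure ℝ) [IsProbabilityMeasure m]
    (ω : BinaryTree Unit × (ℕ → ℝ)) (ξ : ℝ) : charFun (weightedLaw p (evenPart m) ω) ξ =
      (((weights p ω.1 ω.2).map fun b => (charFun m (ξ * b)).re).prod : ℝ) := by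
  rw [charFun_weightedLaw, ← Complex.ofRealHom_eq_coe, map_list_prod, List.map_map]
  simp only [charFun_evenPart, Function.comp_def, Complex.ofRealHom_eq_coe]

/-- The law of the weighted sum with random weights. -/
noncomputable def mixedLaw (p t : ℝ) (m : Measure ℝ) : Measure ℝ :=
  ((treeAngleLaw t).prod (Measure.infinitePi fun _ : ℕ => m)).map
    fun z => weightedSum p z.1 z.2

theorem isProbabilityMeasure_mixedLaw (p : ℝ) {t : ℝ} (ht : 0 ≤ t) (m : Measure ℝ)
    [IsProbabilityMeasure m] : IsProbabilityMeasure (mixedLaw p t m) := by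
  have := isProbabilityMeasure_treeAngleLaw ht
  exact Measure.isProbabilityMeasure_map (measurable_weightedSum p).aemeasurable

theorem charFun_mixedLaw (p : ℝ) {t : ℝ} (ht : 0 ≤ t) (m : Measure ℝ) [IsProbabilityMeasure m]
    (ξ : ℝ) : charFun (mixedLaw p t m) ξ =
      ∫ ω, charFun (weightedLaw p m ω) ξ ∂(treeAngleLaw t) := by
  have := isProbabilityMeasure_treeAngleLaw ht
  rw [charFun_apply_real, mixedLaw,
    integral_map (measurable_weightedSum p).aemeasurable (by fun_prop), integral_prod]
  · refine integral_congr_ae (Eventually.of_forall fun ω => ?_)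
    simp only
    rw [charFun_apply_real, weightedLaw,
      integral_map (measurable_weightedSum_right p ω).aemeasurable (by fun_prop)]
  · refine (integrable_const (1 : ℝ)).mono' ?_ (Eventually.of_forall fun x => ?_)
    · exact (Measurable.comp (by fun_prop :
        Measurable fun y : ℝ => Complex.exp (ξ * y * Complex.I))
          (measurable_weightedSum p)).aestronglyMeasurable
    · rw [← Complex.ofReal_mul, Complex.norm_exp_ofReal_mul_I]

theorem cdf_weightedLaw (p : ℝ) (m : Measure ℝ) [IsProbabilityMeasure m] (x : ℝ)
    (ω : BinaryTree Unit × (ℕ → ℝ)) : cdf (weightedLaw p m ω) x =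
      ((Measure.infinitePi fun _ : ℕ => m) (Prod.mk ω ⁻¹'
        ((fun z : (BinaryTree Unit × (ℕ → ℝ)) × (ℕ → ℝ) => weightedSum p z.1 z.2) ⁻¹'
          Set.Iic x))).toReal := by
  rw [cdf_eq_real, measureReal_def, weightedLaw,
    Measure.map_apply (measurable_weightedSum_right p ω) measurableSet_Iic]
  rfl

theorem measurable_cdf_weightedLaw (p : ℝ) (m : Measure ℝ) [IsProbabilityMeasure m] (x : ℝ) :
    Measurable fun ω => cdf (weightedLaw p m ω) x := by
  simp only [cdf_weightedLaw]
  exact (measurable_measure_prodMk_left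
    (measurable_weightedSum p measurableSet_Iic)).ennreal_toReal

theorem cdf_mixedLaw (p : ℝ) {t : ℝ} (ht : 0 ≤ t) (m : Measure ℝ) [IsProbabilityMeasure m]
    (x : ℝ) : cdf (mixedLaw p t m) x = ∫ ω, cdf (weightedLaw p m ω) x ∂(treeAngleLaw t) := by
  have := isProbabilityMeasure_treeAngleLaw ht
  have := isProbabilityMeasure_mixedLaw p ht m
  have hs := measurable_weightedSum p (measurableSet_Iic (a := x))
  simp only [cdf_weightedLaw]
  rw [cdf_eq_real, measureReal_def, mixedLaw, Measure.map_apply (measurable_weightedSum p)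
    measurableSet_Iic, Measure.prod_apply hs, integral_toReal
      (measurable_measure_prodMk_left hs).aemeasurable
      (Eventually.of_forall fun ω => measure_lt_top _ _)]

/-- The e^{-t}-multiple of the symmetrized law is moved to the other side, so that both sides are
finite positive measures. Their characteristic functions agree in real part by the tree
representation and in imaginary part by exact exponential decay. -/
theorem cdf_of_isSolution {p : ℝ} {μ₀ : Measure ℝ} [IsProbabilityMeasure μ₀]
    {μ : ℝ → Measure ℝ} (hμ : IsSolution p μ₀ μ) {t : ℝ} (ht : 0 ≤ t) (x : ℝ) :
    cdf (μ t) x = (∫ ω, cdf (weightedLaw p (evenPart μ₀) ω) x ∂(treeAngleLaw t)) +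
      Real.exp (-t) * (cdf μ₀ x - cdfStar μ₀ x) := by
  have := isProbabilityMeasure_treeAngleLaw ht
  have := isProbabilityMeasure_mixedLaw p ht (evenPart μ₀)
  have := hμ.isProbabilityMeasure t ht
  have hsm : ∀ m : Measure ℝ, [IsProbabilityMeasure m] →
      IsFiniteMeasure (ENNReal.ofReal (Real.exp (-t)) • m) :=
    fun m _ => Measure.smul_finite m ENNReal.ofReal_ne_top
  have := hsm (evenPart μ₀)
  have := hsm μ₀
  have hi : ∀ (n : Measure ℝ) (ξ : ℝ), [IsFiniteMeasure n] →
      Integrable (fun x : ℝ => Complex.exp (ξ * x * Complex.I)) n := fun n ξ _ => by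
    refine (integrable_const (1 : ℝ)).mono' (by fun_prop) (Eventually.of_forall fun x => ?_)
    rw [← Complex.ofReal_mul, Complex.norm_exp_ofReal_mul_I]
  have hadd : ∀ (m n : Measure ℝ) (ξ : ℝ), [IsProbabilityMeasure m] → [IsProbabilityMeasure n] →
      charFun (m + ENNReal.ofReal (Real.exp (-t)) • n) ξ =
        charFun m ξ + Real.exp (-t) * charFun n ξ := fun m n ξ _ _ => by
    have := hsm n
    rw [charFun_apply_real, integral_add_measure (hi _ ξ) (hi _ ξ), integral_smul_measure,
      ← charFun_apply_real, ← charFun_apply_real, ENNReal.toReal_ofReal (Real.exp_pos _).le,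
      Complex.real_smul]
  have key : μ t + ENNReal.ofReal (Real.exp (-t)) • evenPart μ₀ =
      mixedLaw p t (evenPart μ₀) + ENNReal.ofReal (Real.exp (-t)) • μ₀ := by
    refine Measure.ext_of_charFun (funext fun ξ => ?_)
    have h1 : charFun (mixedLaw p t (evenPart μ₀)) ξ = ((charFun (μ t) ξ).re : ℂ) := by
      rw [charFun_mixedLaw p ht, re_charFun_of_isSolution hμ ht, ← integral_complex_ofReal]
      exact integral_congr_ae (Eventually.of_forall fun ω =>
        charFun_weightedLaw_evenPart p μ₀ ω ξ)
    rw [hadd, hadd, h1, charFun_evenPart]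
    have him := im_charFun_of_isSolution hμ ξ ht
    generalize Real.exp (-t) = r at him
    refine Complex.ext ?_ ?_
    · simp
    · simp [him]
  have h2 : (μ t + ENNReal.ofReal (Real.exp (-t)) • evenPart μ₀).real (Set.Iic x) =
      (mixedLaw p t (evenPart μ₀) + ENNReal.ofReal (Real.exp (-t)) • μ₀).real (Set.Iic x) := by
    rw [key]
  rw [measureReal_add_apply, measureReal_add_apply, measureReal_ennreal_smul_apply,
    measureReal_ennreal_smul_apply, ENNReal.toReal_ofReal (Real.exp_pos (-t)).le, ← cdf_eq_real,
    ← cdf_eq_real, ← cdf_eq_real, ← cdf_eq_real, cdf_evenPart, cdf_mixedLaw p ht] at h2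
  linarith

/-! ### Moments of the weights -/

theorem integral_abs_sinP_rpow {p : ℝ} (hp : 0 < 1 + p) (s : ℝ) :
    ∫ x, |sinP p x| ^ s ∂angleLaw = bigA ((1 + p) * s) := by
  rw [integral_angleLaw, bigA, smul_eq_mul]
  simp only [abs_sinP p _ hp, ← Real.rpow_mul (abs_nonneg _)]

theorem integral_abs_cosP_rpow {p : ℝ} (hp : 0 < 1 + p) (s : ℝ) :
    ∫ x, |cosP p x| ^ s ∂angleLaw = bigA ((1 + p) * s) := by
  rw [← integral_abs_sinP_rpow hp]
  exact (integral_swap_cosP_sinP p fun x _ => |x| ^ s).symm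

theorem bigA_nonneg (m : ℝ) : 0 ≤ bigA m :=
  mul_nonneg (by positivity) (intervalIntegral.integral_nonneg (by positivity)
    fun x _ => Real.rpow_nonneg (abs_nonneg _) _)

theorem powerAverage_nonneg (p s : ℝ) (g : BinaryTree Unit) : 0 ≤ powerAverage p s g :=
  integral_nonneg fun _ => sum_map_nonneg (fun _ => Real.rpow_nonneg (abs_nonneg _) _) _

theorem treeAverage_nonneg {h : BinaryTree Unit → ℝ} (hh : ∀ g, 0 ≤ h g) (n : ℕ) :
    0 ≤ treeAverage h n :=
  Finset.sum_nonneg fun g _ => mul_nonneg (treeProb_nonneg g) (hh g)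

/-- The root multiplies the contribution of either subtree by the same constant, and exchanging k
with n - k makes the two sums equal. -/
theorem treeAverage_powerAverage_succ {p α s : ℝ} (hp : 0 < 1 + p) (hα : α = 2 / (1 + p))
    (hs : α ≤ s) (n : ℕ) :
    ((n : ℝ) + 1) * treeAverage (powerAverage p s) (n + 1) =
      2 * bigA ((1 + p) * s) * ∑ k ∈ Finset.range (n + 1), treeAverage (powerAverage p s) k := by
  have hprob := sum_treeProb_treesOfNumNodesEq
  rw [treeAverage, sum_treesOfNumNodesEq_succ]
  simp only [powerAverage_node hp hα hs, integral_abs_sinP_rpow hp, integral_abs_cosP_rpow hp]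
  have e : ∀ ij : ℕ × ℕ, ∑ l ∈ BinaryTree.treesOfNumNodesEq ij.1,
      ∑ r ∈ BinaryTree.treesOfNumNodesEq ij.2, treeProb l * treeProb r *
        (bigA ((1 + p) * s) * powerAverage p s l + bigA ((1 + p) * s) * powerAverage p s r) =
      bigA ((1 + p) * s) * (treeAverage (powerAverage p s) ij.1 +
        treeAverage (powerAverage p s) ij.2) := fun ij => by
    have h1 : treeAverage (powerAverage p s) ij.1 = ∑ l ∈ BinaryTree.treesOfNumNodesEq ij.1,
        ∑ r ∈ BinaryTree.treesOfNumNodesEq ij.2,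
          (treeProb l * powerAverage p s l) * treeProb r := by
      rw [← Finset.sum_mul_sum, hprob, mul_one, treeAverage]
    have h2 : treeAverage (powerAverage p s) ij.2 = ∑ l ∈ BinaryTree.treesOfNumNodesEq ij.1,
        ∑ r ∈ BinaryTree.treesOfNumNodesEq ij.2,
          treeProb l * (treeProb r * powerAverage p s r) := by
      rw [← Finset.sum_mul_sum, hprob, one_mul, treeAverage]
    rw [h1, h2, ← Finset.sum_add_distrib, Finset.mul_sum]
    refine Finset.sum_congr rfl fun l _ => ?_
    rw [← Finset.sum_add_distrib, Finset.mul_sum]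
    refine Finset.sum_congr rfl fun r _ => ?_
    ring
  simp only [e]
  rw [← Finset.mul_sum, Finset.sum_add_distrib,
    Finset.Nat.sum_antidiagonal_eq_sum_range_succ_mk,
    Finset.Nat.sum_antidiagonal_eq_sum_range_succ_mk]
  have h3 := Finset.sum_range_reflect (fun k => treeAverage (powerAverage p s) k) (n + 1)
  have h4 : ∑ k ∈ Finset.range n.succ, treeAverage (powerAverage p s) (n - k) =
      ∑ k ∈ Finset.range (n + 1), treeAverage (powerAverage p s) k := by
    rw [← h3]
    exact Finset.sum_congr rfl fun k _ => by congr 1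
  simp only
  rw [h4]
  ring

/-- Summation by parts. At z = 1 - e^{-t} the factor 1 - z is the e^{-t} that comes from
differentiating z. -/
theorem one_sub_mul_sum_pow_mul_sum (z : ℝ) (m : ℕ → ℝ) (N : ℕ) :
    (1 - z) * ∑ n ∈ Finset.range N, z ^ n * ∑ k ∈ Finset.range (n + 1), m k =
      ∑ n ∈ Finset.range N, z ^ n * m n - z ^ N * ∑ k ∈ Finset.range N, m k := by
  induction N with
  | zero => simp
  | succ N ih =>
    rw [Finset.sum_range_succ, mul_add, ih, Finset.sum_range_succ _ N,
      Finset.sum_range_succ fun n => z ^ n * m n]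
    ring

/-- Up to the factor e^{-t} the full series would solve S' = 2aS. Truncation drops nonnegative terms
only and leaves S' ≤ 2aS, so e^{-2aτ}S(τ) decreases from S(0) = 1, where only the one-leaf tree
contributes. -/
theorem wildSum_powerAverage_le {p α s : ℝ} (hp : 0 < 1 + p) (hα : α = 2 / (1 + p))
    (hs : α ≤ s) {t : ℝ} (ht : 0 ≤ t) (N : ℕ) :
    wildSum t (powerAverage p s) (N + 1) ≤ Real.exp (-t * (1 - 2 * bigA ((1 + p) * s))) := by
  set a := bigA ((1 + p) * s) with ha
  have ha0 : 0 ≤ a := bigA_nonneg _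
  set m := treeAverage (powerAverage p s) with hm
  have hm0 : ∀ n, 0 ≤ m n := treeAverage_nonneg (powerAverage_nonneg p s)
  set S : ℝ → ℝ := fun τ => ∑ n ∈ Finset.range (N + 1), (1 - Real.exp (-τ)) ^ n * m n with hS
  have hd : ∀ τ, HasDerivAt (fun τ => Real.exp (-(2 * a) * τ) * S τ)
      (Real.exp (-(2 * a) * τ) * (-(2 * a)) * S τ + Real.exp (-(2 * a) * τ) *
        (Real.exp (-τ) * ∑ n ∈ Finset.range N, (1 - Real.exp (-τ)) ^ n *
          (((n : ℝ) + 1) * m (n + 1)))) τ := fun τ =>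
    (by simpa using ((hasDerivAt_id τ).const_mul (-(2 * a))).exp :
      HasDerivAt (fun τ => Real.exp (-(2 * a) * τ)) (Real.exp (-(2 * a) * τ) * (-(2 * a))) τ).mul
      (hasDerivAt_sum_pow_mul τ m N)
  have hanti : AntitoneOn (fun τ => Real.exp (-(2 * a) * τ) * S τ) (Set.Ici 0) := by
    refine antitoneOn_of_deriv_nonpos (convex_Ici 0)
      (fun τ _ => (hd τ).continuousAt.continuousWithinAt)
      (fun τ _ => (hd τ).differentiableAt.differentiableWithinAt) fun τ hτ => ?_
    rw [interior_Ici] at hτ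
    rw [(hd τ).deriv]
    have hz := one_sub_exp_neg_nonneg (le_of_lt hτ)
    have hsum : Real.exp (-τ) * ∑ n ∈ Finset.range N, (1 - Real.exp (-τ)) ^ n *
          (((n : ℝ) + 1) * m (n + 1)) ≤ 2 * a * S τ := by
      simp only [hm, treeAverage_powerAverage_succ hp hα hs]
      have h1 := one_sub_mul_sum_pow_mul_sum (1 - Real.exp (-τ)) m N
      rw [sub_sub_cancel] at h1
      have h2 : ∑ n ∈ Finset.range N, (1 - Real.exp (-τ)) ^ n * m n ≤ S τ := by
        simp only [hS]
        rw [Finset.sum_range_succ]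
        exact le_add_of_nonneg_right (mul_nonneg (pow_nonneg hz _) (hm0 _))
      have h3 : 0 ≤ (1 - Real.exp (-τ)) ^ N * ∑ k ∈ Finset.range N, m k :=
        mul_nonneg (pow_nonneg hz _) (Finset.sum_nonneg fun k _ => hm0 k)
      calc _ = 2 * a * (Real.exp (-τ) * ∑ n ∈ Finset.range N, (1 - Real.exp (-τ)) ^ n *
            ∑ k ∈ Finset.range (n + 1), m k) := by
            rw [Finset.mul_sum, Finset.mul_sum, Finset.mul_sum]
            refine Finset.sum_congr rfl fun n _ => ?_
            ring
        _ ≤ _ := by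
            rw [h1]
            exact mul_le_mul_of_nonneg_left (by linarith) (by positivity)
    have : Real.exp (-(2 * a) * τ) * (-(2 * a)) * S τ + Real.exp (-(2 * a) * τ) *
        (Real.exp (-τ) * ∑ n ∈ Finset.range N, (1 - Real.exp (-τ)) ^ n *
          (((n : ℝ) + 1) * m (n + 1))) = Real.exp (-(2 * a) * τ) * (Real.exp (-τ) *
        ∑ n ∈ Finset.range N, (1 - Real.exp (-τ)) ^ n * (((n : ℝ) + 1) * m (n + 1)) -
          2 * a * S τ) := by ring
    rw [this]
    exact mul_nonpos_of_nonneg_of_nonpos (Real.exp_pos _).le (by linarith)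
  have h0 := hanti (Set.mem_Ici.2 le_rfl) (Set.mem_Ici.2 ht) ht
  have hS0 : S 0 = 1 := by
    simp only [hS]
    rw [Finset.sum_range_succ']
    simp [hm, treeAverage, treeProb, powerAverage_nil]
  simp only [mul_zero, Real.exp_zero, one_mul, hS0] at h0
  have e1 : wildSum t (powerAverage p s) (N + 1) = Real.exp (-t) * S t := by
    rw [show S t = _ from (exp_mul_wildSum t (powerAverage p s) (N + 1)).symm, ← mul_assoc,
      ← Real.exp_add]
    simp
  have e2 : Real.exp (-t * (1 - 2 * a)) * (Real.exp (-(2 * a) * t) * S t) =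
      Real.exp (-t) * S t := by
    rw [← mul_assoc, ← Real.exp_add]
    congr 2
    ring
  rw [e1, ← e2]
  exact mul_le_of_le_one_right (Real.exp_pos _).le h0

theorem integral_sum_weights_rpow_le {p α s : ℝ} (hp : 0 < 1 + p) (hα : α = 2 / (1 + p))
    (hs : α ≤ s) {t : ℝ} (ht : 0 ≤ t) :
    ∫ ω, ((weights p ω.1 ω.2).map fun b => |b| ^ s).sum ∂(treeAngleLaw t) ≤
      Real.exp (-t * (1 - 2 * bigA ((1 + p) * s))) := by
  have h := integral_treeAngleLaw ht (measurable_sum_weights p (f := fun b => |b| ^ s)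
    (by fun_prop)) (K := 1) (fun ω => abs_sum_weights_rpow_le hp hα hs _ _)
  exact le_of_tendsto ((tendsto_add_atTop_iff_nat 1).2 h)
    (Eventually.of_forall fun N => wildSum_powerAverage_le hp hα hs ht N)

/-! ### The remainder `v₀*` -/

theorem charFun_re_neg (m : Measure ℝ) (ξ : ℝ) : (charFun m (-ξ)).re = (charFun m ξ).re := by simp

theorem charFun_re_abs (m : Measure ℝ) (ξ : ℝ) : (charFun m |ξ|).re = (charFun m ξ).re := by
  rcases abs_choice ξ with h | h <;> rw [h]
  exact charFun_re_neg m ξ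

theorem vStar_abs (m : Measure ℝ) (α a₀ ξ : ℝ) : vStar m α a₀ |ξ| = vStar m α a₀ ξ := by
  simp only [vStar, abs_eq_zero, abs_abs, charFun_re_abs]

theorem one_sub_charFun_re_eq {m : Measure ℝ} [IsProbabilityMeasure m] {α : ℝ} (hα : 0 < α)
    (a₀ ξ : ℝ) : 1 - (charFun m ξ).re = (a₀ + vStar m α a₀ ξ) * |ξ| ^ α := by
  rcases eq_or_ne ξ 0 with rfl | h
  · simp [Real.zero_rpow hα.ne']
  · have : |ξ| ^ α ≠ 0 := (Real.rpow_pos_of_pos (abs_pos.2 h) _).ne'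
    rw [vStar, if_neg h]
    field_simp
    ring

theorem one_sub_charFun_re_nonneg (m : Measure ℝ) [IsProbabilityMeasure m] (ξ : ℝ) :
    0 ≤ 1 - (charFun m ξ).re :=
  sub_nonneg.2 ((Complex.re_le_norm _).trans (norm_charFun_le_one _))

theorem abs_vStar_le_vBar {m : Measure ℝ} {α a₀ : ℝ} (hb : ∃ K, ∀ ξ, |vStar m α a₀ ξ| ≤ K) (ξ : ℝ) :
    |vStar m α a₀ ξ| ≤ vBar m α a₀ |ξ| := by
  obtain ⟨K, hK⟩ := hb
  refine le_csSup ⟨K, ?_⟩ ⟨|ξ|, ⟨abs_nonneg _, le_rfl⟩, ?_⟩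
  · rintro _ ⟨x, _, rfl⟩; exact hK x
  · simp only [vStar_abs]

theorem add_abs_vStar_le_bigM {m : Measure ℝ} {α a₀ : ℝ} (hb : ∃ K, ∀ ξ, |vStar m α a₀ ξ| ≤ K) (ξ : ℝ) :
    a₀ + |vStar m α a₀ ξ| ≤ bigM m α a₀ := by
  obtain ⟨K, hK⟩ := hb
  refine add_le_add le_rfl (le_csSup ⟨K, ?_⟩ ⟨|ξ|, Set.mem_Ici.2 (abs_nonneg _), ?_⟩)
  · rintro _ ⟨x, _, rfl⟩; exact hK x
  · simp only [vStar_abs]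

section Bounds

variable {m : Measure ℝ} {α a₀ C : ℝ}

/-- This boundedness makes `vBar` and `bigM` genuine suprema; `sSup` of an unbounded set would be 0.
-/
theorem exists_abs_vStar_le [IsProbabilityMeasure m] (hα2 : α < 2)
    (hC : ∀ x, 0 < x → m.real {y | x < |y|} ≤ C * x ^ (-α)) (a₀ : ℝ) :
    ∃ K, ∀ ξ, |vStar m α a₀ ξ| ≤ K := by
  refine ⟨max (C * 2 ^ (2 - α) / (2 - α)) 0 + |a₀|, fun ξ => ?_⟩
  rcases eq_or_ne ξ 0 with rfl | h
  · simp only [vStar, if_true, abs_zero]; positivity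
  have h1 := one_sub_charFun_re_le hα2 m hC (abs_pos.2 h)
  rw [charFun_re_abs] at h1
  rw [vStar, if_neg h]
  have hpos := Real.rpow_pos_of_pos (abs_pos.2 h) α
  refine (abs_sub _ _).trans (add_le_add ?_ le_rfl)
  rw [abs_of_nonneg (div_nonneg (one_sub_charFun_re_nonneg m ξ) hpos.le)]
  exact ((div_le_iff₀ hpos).2 h1).trans (le_max_left _ _)

theorem bigM_pos (ha₀ : 0 < a₀) (hb : ∃ K, ∀ ξ, |vStar m α a₀ ξ| ≤ K) : 0 < bigM m α a₀ :=
  ha₀.trans_le (by linarith [add_abs_vStar_le_bigM hb 0, abs_nonneg (vStar m α a₀ 0)])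

theorem dTilde_pos (ha₀ : 0 < a₀) (hb : ∃ K, ∀ ξ, |vStar m α a₀ ξ| ≤ K) {d : ℝ} (hd : 0 < d) :
    0 < dTilde m α a₀ d := by
  have := bigM_pos ha₀ hb
  unfold dTilde
  positivity

/-- By construction M d̃^α = 3d/8, so 1 - Re φ₀ stays in the range [0, 3/8] where
`exists_eq_exp_neg` applies. -/
theorem bigM_mul_rpow_le (hα : 0 < α) (ha₀ : 0 < a₀) (hb : ∃ K, ∀ ξ, |vStar m α a₀ ξ| ≤ K)
    {d : ℝ} (hd : d ∈ Set.Ioo (0 : ℝ) 1) {x : ℝ} (hx : |x| ≤ dTilde m α a₀ d) :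
    bigM m α a₀ * |x| ^ α ≤ 3 / 8 := by
  have hM := bigM_pos ha₀ hb
  have hd0 := hd.1
  have h1 : |x| ^ α ≤ 3 * d / (8 * bigM m α a₀) := by
    calc |x| ^ α ≤ dTilde m α a₀ d ^ α := Real.rpow_le_rpow (abs_nonneg _) hx hα.le
      _ = _ := by
        rw [dTilde, ← Real.rpow_mul (by positivity), one_div_mul_cancel hα.ne', Real.rpow_one]
  rw [le_div_iff₀ (by positivity)] at h1
  nlinarith [hd.2]

/-- r = y²/2 + y³/3 + y⁴/4 + ⋯, with the terms from y⁵ on bounded by y⁵/(1-y). At y ≤ 3/8 the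
coefficients of y² add up to less than 0.75, hence the 4/5. -/
theorem exists_eq_exp_neg {y : ℝ} (h0 : 0 ≤ y) (h1 : y ≤ 3 / 8) :
    ∃ r, 0 ≤ r ∧ r ≤ 4 / 5 * y ^ 2 ∧ 1 - y = Real.exp (-y - r) := by
  have hpos : 0 < 1 - y := by linarith
  refine ⟨-y - Real.log (1 - y), ?_, ?_, ?_⟩
  · linarith [Real.log_le_sub_one_of_pos hpos]
  · have h := Real.abs_log_sub_add_sum_range_le (x := y) (by rw [abs_of_nonneg h0]; linarith) 4
    rw [abs_of_nonneg h0] at h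
    have h2 := (abs_le.1 h).1
    simp only [Finset.sum_range_succ, Finset.sum_range_zero] at h2
    norm_num at h2
    have h3 : y ^ 5 / (1 - y) ≤ 8 / 5 * y ^ 5 := by
      rw [div_le_iff₀ hpos]
      nlinarith [pow_nonneg h0 5]
    have h4 : y ^ 3 ≤ 3 / 8 * y ^ 2 := by nlinarith [pow_nonneg h0 2]
    have h5 : y ^ 4 ≤ 9 / 64 * y ^ 2 := by nlinarith [pow_nonneg h0 3]
    have h6 : y ^ 5 ≤ 27 / 512 * y ^ 2 := by nlinarith [pow_nonneg h0 4]
    nlinarith [pow_nonneg h0 2]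
  · rw [sub_sub_cancel, Real.exp_log hpos]

/-- The bound of the first order error at `x`. -/
noncomputable def localError (m : Measure ℝ) (α a₀ x : ℝ) : ℝ :=
  |vStar m α a₀ x| * |x| ^ α + 4 / 5 * bigM m α a₀ ^ 2 * |x| ^ (2 * α)

theorem exists_charFun_re_eq_exp [IsProbabilityMeasure m] (hα : 0 < α) (ha₀ : 0 < a₀)
    (hb : ∃ K, ∀ ξ, |vStar m α a₀ ξ| ≤ K) {d : ℝ} (hd : d ∈ Set.Ioo (0 : ℝ) 1) {x : ℝ}
    (hx : |x| ≤ dTilde m α a₀ d) : ∃ Y, |Y| ≤ localError m α a₀ x ∧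
      (charFun m x).re = Real.exp (-a₀ * |x| ^ α + Y) := by
  have h1 := one_sub_charFun_re_eq (m := m) hα a₀ x
  have hx0 : 0 ≤ |x| ^ α := Real.rpow_nonneg (abs_nonneg _) _
  have hM : a₀ + vStar m α a₀ x ≤ bigM m α a₀ :=
    le_trans (by linarith [le_abs_self (vStar m α a₀ x)]) (add_abs_vStar_le_bigM hb x)
  have hle : 1 - (charFun m x).re ≤ bigM m α a₀ * |x| ^ α := by
    rw [h1]; exact mul_le_mul_of_nonneg_right hM hx0
  have h0 := one_sub_charFun_re_nonneg m x
  obtain ⟨r, hr0, hr, he⟩ := exists_eq_exp_neg h0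
    (hle.trans (bigM_mul_rpow_le hα ha₀ hb hd hx))
  refine ⟨-(vStar m α a₀ x * |x| ^ α) - r, ?_, ?_⟩
  · have h2 : r ≤ 4 / 5 * bigM m α a₀ ^ 2 * |x| ^ (2 * α) := by
      refine hr.trans ?_
      have h3 := pow_le_pow_left₀ h0 hle 2
      rw [mul_pow, ← Real.rpow_mul_natCast (abs_nonneg _)] at h3
      push_cast at h3
      rw [mul_comm α] at h3
      linarith
    refine (abs_sub _ _).trans ?_
    rw [abs_neg, abs_mul, abs_of_nonneg hx0, abs_of_nonneg hr0, localError]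
    linarith
  · rw [sub_sub_cancel] at he
    rw [he, h1]
    congr 1
    ring

theorem localError_le (hα : 0 < α) (hb : ∃ K, ∀ ξ, |vStar m α a₀ ξ| ≤ K) {d η : ℝ}
    (hd' : ∀ x : ℝ, |x| ≤ dTilde m α a₀ d →
      4 / 5 * bigM m α a₀ ^ 2 * |x| ^ α + vBar m α a₀ |x| ≤ η) {x : ℝ}
    (hx : |x| ≤ dTilde m α a₀ d) : localError m α a₀ x ≤ η * |x| ^ α := by
  have h1 : |x| ^ (2 * α) = |x| ^ α * |x| ^ α := by
    rw [two_mul, Real.rpow_add' (abs_nonneg _) (by positivity)]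
  have h2 : 0 ≤ |x| ^ α := Real.rpow_nonneg (abs_nonneg _) _
  calc localError m α a₀ x
      = (4 / 5 * bigM m α a₀ ^ 2 * |x| ^ α + |vStar m α a₀ x|) * |x| ^ α := by
        rw [localError, h1]; ring
    _ ≤ _ := mul_le_mul_of_nonneg_right
        (le_trans (by linarith [abs_vStar_le_vBar hb x]) (hd' x hx)) h2

theorem exists_prod_eq_exp [IsProbabilityMeasure m] (hα : 0 < α) (ha₀ : 0 < a₀)
    (hb : ∃ K, ∀ ξ, |vStar m α a₀ ξ| ≤ K) {d : ℝ} (hd : d ∈ Set.Ioo (0 : ℝ) 1) (ξ : ℝ)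
    (L : List ℝ) (hL : ∀ b ∈ L, |ξ * b| ≤ dTilde m α a₀ d) :
    ∃ Y, |Y| ≤ (L.map fun b => localError m α a₀ (ξ * b)).sum ∧
      (L.map fun b => (charFun m (ξ * b)).re).prod =
        Real.exp (-a₀ * |ξ| ^ α * (L.map fun b => |b| ^ α).sum + Y) := by
  induction L with
  | nil => exact ⟨0, by simp, by simp⟩
  | cons b L ih =>
    obtain ⟨Y, hY, he⟩ := ih fun x hx => hL x (List.mem_cons_of_mem _ hx)
    obtain ⟨Z, hZ, he'⟩ := exists_charFun_re_eq_exp hα ha₀ hb hd (hL b List.mem_cons_self)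
    refine ⟨Z + Y, ?_, ?_⟩
    · rw [List.map_cons, List.sum_cons]
      exact (abs_add_le _ _).trans (add_le_add hZ hY)
    · rw [List.map_cons, List.prod_cons, List.map_cons, List.sum_cons, he, he', ← Real.exp_add,
        abs_mul, Real.mul_rpow (abs_nonneg _) (abs_nonneg _)]
      congr 1
      ring

theorem abs_exp_sub_one_le (y : ℝ) : |Real.exp y - 1| ≤ |y| * Real.exp |y| := by
  rcases le_total 0 y with h | h
  · rw [abs_of_nonneg h, abs_of_nonneg (by linarith [Real.add_one_le_exp y])]
    have h1 := Real.add_one_le_exp (-y)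
    have h2 : Real.exp y * Real.exp (-y) = 1 := by rw [← Real.exp_add]; simp
    nlinarith [Real.exp_pos y]
  · rw [abs_of_nonpos h, abs_of_nonpos (by linarith [Real.exp_le_one_iff.2 h])]
    have h1 := Real.add_one_le_exp y
    have h2 : 1 ≤ Real.exp (-y) := Real.one_le_exp (by linarith)
    nlinarith

/-- In |e^Y - 1| ≤ |Y| e^{|Y|} the first factor is kept as the sum of local errors. The second is
absorbed through |Y| ≤ η|ξ|^α, which lowers a₀ to a₀ - η in the exponential. -/
theorem abs_prod_sub_exp_le [IsProbabilityMeasure m] (hα : 0 < α) (ha₀ : 0 < a₀)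
    (hb : ∃ K, ∀ ξ, |vStar m α a₀ ξ| ≤ K) {d η : ℝ} (hd : d ∈ Set.Ioo (0 : ℝ) 1)
    (hd' : ∀ x : ℝ, |x| ≤ dTilde m α a₀ d →
      4 / 5 * bigM m α a₀ ^ 2 * |x| ^ α + vBar m α a₀ |x| ≤ η) (ξ : ℝ)
    {L : List ℝ} (hL : ∀ b ∈ L, |ξ * b| ≤ dTilde m α a₀ d)
    (hL1 : (L.map fun b => |b| ^ α).sum = 1) :
    |(L.map fun b => (charFun m (ξ * b)).re).prod - Real.exp (-a₀ * |ξ| ^ α)| ≤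
      Real.exp (-(a₀ - η) * |ξ| ^ α) * (L.map fun b => localError m α a₀ (ξ * b)).sum := by
  obtain ⟨Y, hY, he⟩ := exists_prod_eq_exp hα ha₀ hb hd ξ L hL
  have hW : (L.map fun b => localError m α a₀ (ξ * b)).sum ≤ η * |ξ| ^ α := by
    calc _ ≤ (L.map fun b => η * |ξ| ^ α * |b| ^ α).sum := List.sum_le_sum fun b hbL => by
          refine (localError_le hα hb hd' (hL b hbL)).trans (le_of_eq ?_)
          rw [abs_mul, Real.mul_rpow (abs_nonneg _) (abs_nonneg _), mul_assoc]
      _ = _ := by rw [List.sum_map_mul_left, hL1, mul_one]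
  rw [he, hL1, mul_one, Real.exp_add]
  have e : Real.exp (-a₀ * |ξ| ^ α) * Real.exp Y - Real.exp (-a₀ * |ξ| ^ α) =
      Real.exp (-a₀ * |ξ| ^ α) * (Real.exp Y - 1) := by ring
  rw [e, abs_mul, abs_of_pos (Real.exp_pos _)]
  have h1 : |Real.exp Y - 1| ≤ (L.map fun b => localError m α a₀ (ξ * b)).sum *
      Real.exp (η * |ξ| ^ α) :=
    (abs_exp_sub_one_le Y).trans (mul_le_mul hY (Real.exp_le_exp.2 (hY.trans hW))
      (Real.exp_pos _).le ((abs_nonneg _).trans hY))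
  have h2 : Real.exp (-(a₀ - η) * |ξ| ^ α) =
      Real.exp (-a₀ * |ξ| ^ α) * Real.exp (η * |ξ| ^ α) := by
    rw [← Real.exp_add]; congr 1; ring
  calc _ ≤ Real.exp (-a₀ * |ξ| ^ α) * ((L.map fun b => localError m α a₀ (ξ * b)).sum *
      Real.exp (η * |ξ| ^ α)) := mul_le_mul_of_nonneg_left h1 (Real.exp_pos _).le
    _ = _ := by rw [h2]; ring

end Bounds

/-! ### The remainder of the tail -/

theorem measureReal_abs_gt (m : Measure ℝ) [IsProbabilityMeasure m] {x : ℝ} (hx : 0 ≤ x) :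
    m.real {y | x < |y|} = 2 * (1 - cdfStar m x) := by
  have h1 : ({y | x < |y|} : Set ℝ) = Set.Ioi x ∪ Set.Iio (-x) := by
    ext y
    simp only [Set.mem_ofPred_eq, Set.mem_union, Set.mem_Ioi, Set.mem_Iio, lt_abs]
    exact or_congr Iff.rfl lt_neg
  have h2 : Disjoint (Set.Ioi x) (Set.Iio (-x)) :=
    Set.disjoint_left.2 fun y hy hy' => by
      simp only [Set.mem_Ioi, Set.mem_Iio] at hy hy'; linarith
  rw [h1, measureReal_union h2 measurableSet_Iio, ← Set.compl_Iic,
    probReal_compl_eq_one_sub measurableSet_Iic, cdfStar, cdf_eq_real]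
  ring

theorem measurable_cdfStar (m : Measure ℝ) [IsProbabilityMeasure m] : Measurable (cdfStar m) := by
  have h : Antitone fun x => m.real (Set.Iio (-x)) := fun x y hxy =>
    measureReal_mono (Set.Iio_subset_Iio (neg_le_neg hxy))
  exact (((monotone_cdf m).measurable.add_const 1).sub h.measurable).div_const 2

theorem measurable_sStar (m : Measure ℝ) [IsProbabilityMeasure m] (α c₀ : ℝ) :
    Measurable (sStar m α c₀) :=
  ((measurable_cdfStar m).const_sub 1).sub ((measurable_id.pow_const α).const_div c₀)

theorem measurable_hStar (m : Measure ℝ) [IsProbabilityMeasure m] (α c₀ : ℝ) :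
    Measurable (hStar m α c₀) :=
  (measurable_id.pow_const α).mul (measurable_sStar m α c₀)

theorem sStar_eq (m : Measure ℝ) (α c₀ : ℝ) {x : ℝ} (hx : 0 < x) :
    sStar m α c₀ x = x ^ (-α) * hStar m α c₀ x := by
  rw [hStar, ← mul_assoc, ← Real.rpow_add hx]
  simp

section

variable {m : Measure ℝ} {α C : ℝ}

theorem abs_hStar_le [IsProbabilityMeasure m]
    (hC : ∀ x, 0 < x → m.real {y | x < |y|} ≤ C * x ^ (-α)) (c₀ : ℝ) {x : ℝ}
    (hx : 0 < x) : |hStar m α c₀ x| ≤ C + |c₀| := by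
  have h1 := hC x hx
  have h0 : 0 ≤ m.real {y | x < |y|} := measureReal_nonneg
  rw [measureReal_abs_gt m hx.le] at h1 h0
  have hp := Real.rpow_pos_of_pos hx α
  rw [Real.rpow_neg hx.le, ← div_eq_mul_inv, le_div_iff₀ hp] at h1
  have e : hStar m α c₀ x = x ^ α * (1 - cdfStar m x) - c₀ := by
    rw [hStar, sStar]; field_simp
  have h2 : 0 ≤ x ^ α * (1 - cdfStar m x) := mul_nonneg hp.le (by linarith)
  rw [e]
  refine (abs_sub _ _).trans (add_le_add ?_ le_rfl)
  rw [abs_of_nonneg h2]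
  nlinarith

theorem integrableOn_hStar_Ioc [IsProbabilityMeasure m] (hα2 : α < 2)
    (hC : ∀ x, 0 < x → m.real {y | x < |y|} ≤ C * x ^ (-α)) (c₀ : ℝ) {q : ℝ} (hq : 0 < q) :
    IntegrableOn (fun y => y ^ (1 - α) * |hStar m α c₀ (y / q)|) (Set.Ioc 0 1) := by
  have h1 : IntegrableOn (fun y : ℝ => y ^ (1 - α) * (C + |c₀|)) (Set.Ioc 0 1) :=
    ((intervalIntegrable_iff_integrableOn_Ioc_of_le zero_le_one).1
      (intervalIntegral.intervalIntegrable_rpow' (by linarith))).mul_const _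
  refine h1.mono' ?_ ((ae_restrict_iff' measurableSet_Ioc).2 (Eventually.of_forall fun y hy => ?_))
  · exact ((measurable_id.pow_const _).mul ((measurable_hStar m α c₀).comp
      (measurable_id.div_const q)).abs).aestronglyMeasurable
  · rw [norm_mul, Real.norm_of_nonneg (Real.rpow_nonneg hy.1.le _), Real.norm_eq_abs, abs_abs]
    exact mul_le_mul_of_nonneg_left (abs_hStar_le hC c₀ (div_pos hy.1 hq))
      (Real.rpow_nonneg hy.1.le _)

theorem H1_nonneg (m : Measure ℝ) (α c₀ q : ℝ) : 0 ≤ H1 m α c₀ q :=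
  setIntegral_nonneg measurableSet_Ioc fun _ hy =>
    mul_nonneg (Real.rpow_nonneg hy.1.le _) (abs_nonneg _)

theorem H2_nonneg (m : Measure ℝ) (α c₀ q : ℝ) : 0 ≤ H2 m α c₀ q :=
  setIntegral_nonneg measurableSet_Ioi fun _ hy =>
    mul_nonneg (Real.rpow_nonneg (zero_le_one.trans (le_of_lt hy)) _) (abs_nonneg _)

theorem H1_le [IsProbabilityMeasure m] (hα2 : α < 2)
    (hC : ∀ x, 0 < x → m.real {y | x < |y|} ≤ C * x ^ (-α)) (c₀ : ℝ) {q : ℝ} (hq : 0 < q) :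
    H1 m α c₀ q ≤ ∫ y in Set.Ioc (0 : ℝ) 1, y ^ (1 - α) * (C + |c₀|) := by
  have h1 : IntegrableOn (fun y : ℝ => y ^ (1 - α) * (C + |c₀|)) (Set.Ioc 0 1) :=
    ((intervalIntegrable_iff_integrableOn_Ioc_of_le zero_le_one).1
      (intervalIntegral.intervalIntegrable_rpow' (by linarith))).mul_const _
  exact setIntegral_mono_on (integrableOn_hStar_Ioc hα2 hC c₀ hq) h1 measurableSet_Ioc
    fun y hy => mul_le_mul_of_nonneg_left (abs_hStar_le hC c₀ (div_pos hy.1 hq))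
      (Real.rpow_nonneg hy.1.le _)

theorem rpow_mul_abs_hStar_div (m : Measure ℝ) (c₀ : ℝ) {y q : ℝ} (hy : 0 < y) (hq : 0 < q) :
    y ^ (-(1 : ℝ)) * |hStar m 1 c₀ (y / q)| = q⁻¹ * |sStar m 1 c₀ (q⁻¹ * y)| := by
  rw [hStar, Real.rpow_one, abs_mul, abs_of_pos (div_pos hy hq), Real.rpow_neg_one,
    div_eq_inv_mul]
  field_simp

theorem integrableOn_sStar_Ioi [IsProbabilityMeasure m]
    (hC : ∀ x, 0 < x → m.real {y | x < |y|} ≤ C * x ^ (-α)) (hα : 0 < α) (c₀ : ℝ) {D : ℝ}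
    (hS : IntegrableOn (sStar m α c₀) (Set.Ioi D)) {a : ℝ} (ha : 0 < a) :
    IntegrableOn (sStar m α c₀) (Set.Ioi a) := by
  have h1 : IntegrableOn (sStar m α c₀) (Set.Ioc a D) := by
    refine Measure.integrableOn_of_bounded (M := a ^ (-α) * (C + |c₀|)) (by simp)
      (measurable_sStar m α c₀).aestronglyMeasurable
      ((ae_restrict_iff' measurableSet_Ioc).2 (Eventually.of_forall fun x hx => ?_))
    have hx0 : 0 < x := ha.trans hx.1
    rw [sStar_eq m α c₀ hx0, norm_mul, Real.norm_of_nonneg (Real.rpow_nonneg hx0.le _)]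
    exact mul_le_mul (Real.rpow_le_rpow_of_nonpos ha hx.1.le (by linarith))
      (abs_hStar_le hC c₀ hx0) (norm_nonneg _) (Real.rpow_nonneg ha.le _)
  refine (h1.union hS).mono_set fun x hx => ?_
  rcases le_or_gt x D with h | h
  · exact Or.inl ⟨hx, h⟩
  · exact Or.inr h

/-- For α > 1, h* is bounded and y^{-α} integrable at infinity. For α = 1 the power fails, but there
the integrand is a rescaling of |S*|, integrable by assumption. -/
theorem integrableOn_hStar_Ioi [IsProbabilityMeasure m] (hα : 1 ≤ α)
    (hC : ∀ x, 0 < x → m.real {y | x < |y|} ≤ C * x ^ (-α)) (c₀ : ℝ) {D : ℝ}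
    (hS : α = 1 → IntegrableOn (sStar m α c₀) (Set.Ioi D)) {q : ℝ} (hq : 0 < q) :
    IntegrableOn (fun y => y ^ (-α) * |hStar m α c₀ (y / q)|) (Set.Ioi 1) := by
  rcases hα.eq_or_lt with rfl | hα
  · have h1 := integrableOn_sStar_Ioi hC one_pos c₀ (hS rfl) (inv_pos.2 hq)
    have h2 := (integrableOn_Ioi_comp_mul_left_iff (sStar m 1 c₀) 1 (inv_pos.2 hq)).2
      (by rwa [mul_one])
    refine IntegrableOn.congr_fun (h2.abs.const_mul q⁻¹) (fun y hy => ?_) measurableSet_Ioi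
    exact (rpow_mul_abs_hStar_div m c₀ (one_pos.trans hy) hq).symm
  · refine ((integrableOn_Ioi_rpow_of_lt (a := -α) (by linarith) one_pos).mul_const
      (C + |c₀|)).mono' ?_ ((ae_restrict_iff' measurableSet_Ioi).2
        (Eventually.of_forall fun y hy => ?_))
    · exact ((measurable_id.pow_const _).mul ((measurable_hStar m α c₀).comp
        (measurable_id.div_const q)).abs).aestronglyMeasurable
    · have hy0 : 0 < y := one_pos.trans hy
      rw [norm_mul, Real.norm_of_nonneg (Real.rpow_nonneg hy0.le _), Real.norm_eq_abs, abs_abs]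
      exact mul_le_mul_of_nonneg_left (abs_hStar_le hC c₀ (div_pos hy0 hq))
        (Real.rpow_nonneg hy0.le _)

/-- At α = 1 the substitution u = y/q turns H₂* into ∫_{1/q}^∞ |S*|, at most ∫_1^∞ |S*| for q ≤ 1.
Uniformity in q is what makes the expectation over the weights finite. -/
theorem exists_H2_le [IsProbabilityMeasure m] (hα : 1 ≤ α)
    (hC : ∀ x, 0 < x → m.real {y | x < |y|} ≤ C * x ^ (-α)) (c₀ : ℝ) {D : ℝ}
    (hS : α = 1 → IntegrableOn (sStar m α c₀) (Set.Ioi D)) :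
    ∃ K, ∀ q ∈ Set.Ioc (0 : ℝ) 1, H2 m α c₀ q ≤ K := by
  have hi := fun q hq => integrableOn_hStar_Ioi hα hC c₀ hS (q := q) hq
  rcases hα.eq_or_lt with rfl | hα
  · have h1 := integrableOn_sStar_Ioi hC one_pos c₀ (hS rfl) one_pos
    refine ⟨∫ u in Set.Ioi 1, |sStar m 1 c₀ u|, fun q hq => ?_⟩
    have hq' := inv_pos.2 hq.1
    have h2 : H2 m 1 c₀ q = ∫ u in Set.Ioi q⁻¹, |sStar m 1 c₀ u| := by
      rw [H2, setIntegral_congr_fun measurableSet_Ioi fun y hy =>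
        rpow_mul_abs_hStar_div m c₀ (one_pos.trans hy) hq.1, integral_const_mul,
        integral_comp_mul_left_Ioi (fun u => |sStar m 1 c₀ u|) 1 hq', smul_eq_mul, inv_inv,
        mul_one, inv_mul_cancel_left₀ hq.1.ne']
    rw [h2]
    exact setIntegral_mono_set h1.abs (Eventually.of_forall fun u => abs_nonneg _)
      (LE.le.eventuallyLE (Set.Ioi_subset_Ioi ((one_le_inv₀ hq.1).2 hq.2)))
  · refine ⟨∫ y in Set.Ioi (1 : ℝ), y ^ (-α) * (C + |c₀|), fun q hq => ?_⟩
    refine setIntegral_mono_on (hi q hq.1)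
      ((integrableOn_Ioi_rpow_of_lt (a := -α) (by linarith) one_pos).mul_const (C + |c₀|))
      measurableSet_Ioi fun y hy => ?_
    have hy0 : 0 < y := one_pos.trans hy
    exact mul_le_mul_of_nonneg_left (abs_hStar_le hC c₀ (div_pos hy0 hq.1))
      (Real.rpow_nonneg hy0.le _)

theorem measurable_H1 (m : Measure ℝ) [IsProbabilityMeasure m] (α c₀ : ℝ) :
    Measurable (H1 m α c₀) :=
  StronglyMeasurable.measurable (StronglyMeasurable.integral_prod_right'
    (f := fun z : ℝ × ℝ => z.2 ^ (1 - α) * |hStar m α c₀ (z.2 / z.1)|)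
    ((measurable_snd.pow_const _).mul ((measurable_hStar m α c₀).comp
      (measurable_snd.div measurable_fst)).abs).stronglyMeasurable)

theorem measurable_H2 (m : Measure ℝ) [IsProbabilityMeasure m] (α c₀ : ℝ) :
    Measurable (H2 m α c₀) :=
  StronglyMeasurable.measurable (StronglyMeasurable.integral_prod_right'
    (f := fun z : ℝ × ℝ => z.2 ^ (-α) * |hStar m α c₀ (z.2 / z.1)|)
    ((measurable_snd.pow_const _).mul ((measurable_hStar m α c₀).comp
      (measurable_snd.div measurable_fst)).abs).stronglyMeasurable)

end

/-! ### The remainder of the characteristic function in terms of the remainder of the tail -/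

theorem abs_sin_mul_rpow_le {α ξ y : ℝ} (hξ : 0 ≤ ξ) (hy : 0 < y) :
    |Real.sin (ξ * y) * y ^ (-α)| ≤ ξ * y ^ (1 - α) := by
  have h1 : |Real.sin (ξ * y)| ≤ ξ * y := by
    have := Real.abs_sin_le_abs (x := ξ * y)
    rwa [abs_of_nonneg (mul_nonneg hξ hy.le)] at this
  rw [abs_mul, abs_of_nonneg (Real.rpow_nonneg hy.le _)]
  calc _ ≤ ξ * y * y ^ (-α) := mul_le_mul_of_nonneg_right h1 (Real.rpow_nonneg hy.le _)
    _ = ξ * y ^ (1 - α) := by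
      rw [sub_eq_add_neg, Real.rpow_add hy, Real.rpow_one, mul_assoc]

theorem intervalIntegrable_sin_mul_rpow {α ξ R : ℝ} (hα2 : α < 2) (hξ : 0 ≤ ξ) (hR : 0 ≤ R) :
    IntervalIntegrable (fun y => Real.sin (ξ * y) * y ^ (-α)) volume 0 R := by
  refine (intervalIntegrable_iff_integrableOn_Ioc_of_le hR).2 ?_
  have h := ((intervalIntegrable_iff_integrableOn_Ioc_of_le hR).1
      (intervalIntegral.intervalIntegrable_rpow' (r := 1 - α) (by linarith))).const_mul ξ
  refine h.mono' (Measurable.aestronglyMeasurable (by fun_prop))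
    ((ae_restrict_iff' measurableSet_Ioc).2 (Eventually.of_forall fun y hy => ?_))
  exact abs_sin_mul_rpow_le hξ hy.1

/-- This is what a pure tail 2c₀y^{-α} contributes to 1 - Re φ₀; the relation between a₀ and c₀
enters only here. -/
theorem tendsto_integral_sin_mul_rpow {α a₀ c₀ ξ : ℝ} (hξ : 0 < ξ)
    (hc₀ : Tendsto (fun R : ℝ => 2 * c₀ * ∫ x in (0 : ℝ)..R, Real.sin x / x ^ α)
      atTop (𝓝 a₀)) :
    Tendsto (fun R => 2 * c₀ * ∫ y in (0 : ℝ)..R, ξ * (Real.sin (ξ * y) * y ^ (-α))) atTop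
      (𝓝 (a₀ * ξ ^ α)) := by
  have h1 := (hc₀.comp (tendsto_id.const_mul_atTop hξ)).mul_const (ξ ^ α)
  refine h1.congr' ((eventually_ge_atTop 0).mono fun R hR => ?_)
  have h2 := intervalIntegral.integral_comp_mul_left (fun x => Real.sin x / x ^ α) hξ.ne'
    (a := 0) (b := R)
  rw [mul_zero, smul_eq_mul] at h2
  have h3 : ∫ y in (0 : ℝ)..R, ξ * (Real.sin (ξ * y) * y ^ (-α)) =
      ξ ^ α * (ξ * ∫ y in (0 : ℝ)..R, Real.sin (ξ * y) / (ξ * y) ^ α) := by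
    rw [← mul_assoc, ← intervalIntegral.integral_const_mul]
    refine intervalIntegral.integral_congr fun y hy => ?_
    rw [Set.uIcc_of_le hR] at hy
    have hp := (Real.rpow_pos_of_pos hξ α).ne'
    rw [Real.mul_rpow hξ.le hy.1, Real.rpow_neg hy.1]
    field_simp
  simp only [Function.comp, id]
  rw [h3, h2, mul_inv_cancel_left₀ hξ.ne']
  ring

section

variable {m : Measure ℝ} [IsProbabilityMeasure m] {α a₀ c₀ C : ℝ}

theorem tail_div_eq (α c₀ : ℝ) {q y : ℝ} (hq : 0 < q) (hy : 0 < y) :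
    m.real {x | y < q * |x|} =
      2 * c₀ * q ^ α * y ^ (-α) + 2 * q ^ α * (y ^ (-α) * hStar m α c₀ (y / q)) := by
  have h1 : ({x | y < q * |x|} : Set ℝ) = {x | y / q < |x|} := by
    ext x
    simp only [Set.mem_ofPred_eq]
    rw [div_lt_iff₀ hq, mul_comm]
  have hyq := div_pos hy hq
  have hp := (Real.rpow_pos_of_pos hy α).ne'
  have hp' := (Real.rpow_pos_of_pos hq α).ne'
  rw [h1, measureReal_abs_gt m hyq.le, hStar, sStar, Real.div_rpow hy.le hq.le, Real.rpow_neg hy.le]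
  field_simp
  ring

/-- |sin(ξy)| ≤ ξy on (0,1] gives H₁*, and |sin| ≤ 1 beyond gives H₂*. The bound is uniform in R, so
it survives the improper limit. -/
theorem abs_integral_sin_mul_hStar_le (hα : 1 ≤ α) (hα2 : α < 2)
    (hC : ∀ x, 0 < x → m.real {y | x < |y|} ≤ C * x ^ (-α)) {D : ℝ}
    (hS : α = 1 → IntegrableOn (sStar m α c₀) (Set.Ioi D)) {q ξ R : ℝ} (hq : 0 < q)
    (hξ : 0 < ξ) (hR : 1 ≤ R) :
    IntervalIntegrable (fun y => Real.sin (ξ * y) * (y ^ (-α) * hStar m α c₀ (y / q)))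
      volume 0 R ∧
    |∫ y in (0 : ℝ)..R, Real.sin (ξ * y) * (y ^ (-α) * hStar m α c₀ (y / q))| ≤
      ξ * H1 m α c₀ q + H2 m α c₀ q := by
  have hm : Measurable fun y => Real.sin (ξ * y) * (y ^ (-α) * hStar m α c₀ (y / q)) :=
    (by fun_prop : Measurable fun y => Real.sin (ξ * y)).mul ((measurable_id.pow_const _).mul
      ((measurable_hStar m α c₀).comp (measurable_id.div_const q)))
  have i1 := (integrableOn_hStar_Ioc hα2 hC c₀ hq).const_mul ξ
  have i2 := integrableOn_hStar_Ioi hα hC c₀ hS hq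
  have b1 : ∀ y ∈ Set.Ioc (0 : ℝ) 1, ‖Real.sin (ξ * y) * (y ^ (-α) * hStar m α c₀ (y / q))‖ ≤
      ξ * (y ^ (1 - α) * |hStar m α c₀ (y / q)|) := fun y hy => by
    rw [← mul_assoc, ← mul_assoc, norm_mul, Real.norm_eq_abs]
    exact mul_le_mul_of_nonneg_right (abs_sin_mul_rpow_le hξ.le hy.1) (norm_nonneg _)
  have b2 : ∀ y ∈ Set.Ioi (1 : ℝ), ‖Real.sin (ξ * y) * (y ^ (-α) * hStar m α c₀ (y / q))‖ ≤
      y ^ (-α) * |hStar m α c₀ (y / q)| := fun y hy => by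
    rw [norm_mul, norm_mul, Real.norm_of_nonneg (Real.rpow_nonneg (one_pos.trans hy).le _)]
    exact mul_le_of_le_one_left (mul_nonneg (Real.rpow_nonneg (one_pos.trans hy).le _)
      (norm_nonneg _)) (Real.abs_sin_le_one _)
  have j1 : IntegrableOn (fun y => Real.sin (ξ * y) * (y ^ (-α) * hStar m α c₀ (y / q)))
      (Set.Ioc 0 1) := i1.mono' hm.aestronglyMeasurable
    ((ae_restrict_iff' measurableSet_Ioc).2 (Eventually.of_forall b1))
  have i2' := i2.mono_set (Set.Ioc_subset_Ioi_self : Set.Ioc 1 R ⊆ _)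
  have j2 : IntegrableOn (fun y => Real.sin (ξ * y) * (y ^ (-α) * hStar m α c₀ (y / q)))
      (Set.Ioc 1 R) := i2'.mono' hm.aestronglyMeasurable
    ((ae_restrict_iff' measurableSet_Ioc).2 (Eventually.of_forall fun y hy => b2 y hy.1))
  have k1 := (intervalIntegrable_iff_integrableOn_Ioc_of_le (zero_le_one' ℝ)).2 j1
  have k2 := (intervalIntegrable_iff_integrableOn_Ioc_of_le hR).2 j2
  refine ⟨k1.trans k2, ?_⟩
  rw [← intervalIntegral.integral_add_adjacent_intervals k1 k2]
  refine (abs_add_le _ _).trans (add_le_add ?_ ?_)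
  · rw [intervalIntegral.integral_of_le zero_le_one, H1, ← integral_const_mul]
    exact norm_integral_le_of_norm_le i1
      ((ae_restrict_iff' measurableSet_Ioc).2 (Eventually.of_forall b1))
  · rw [intervalIntegral.integral_of_le hR, H2]
    refine (norm_integral_le_of_norm_le i2'
      ((ae_restrict_iff' measurableSet_Ioc).2 (Eventually.of_forall fun y hy => b2 y hy.1))).trans ?_
    refine setIntegral_mono_set i2 ((ae_restrict_iff' measurableSet_Ioi).2
      (Eventually.of_forall fun y hy => mul_nonneg (Real.rpow_nonneg (one_pos.trans hy).le _)
        (abs_nonneg _))) (LE.le.eventuallyLE Set.Ioc_subset_Ioi_self)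

/-- Integration by parts for q|X|, minus the pure power contribution, leaves the integral of h*.
Splitting at y = 1 in the variable rescaled by q, rather than by ξ, separates powers of ξ from
functions of q, so integrating over ξ and summing over the weights decouple. -/
theorem abs_vStar_mul_le (hα : 1 ≤ α) (hα2 : α < 2)
    (hc₀ : Tendsto (fun R : ℝ => 2 * c₀ * ∫ x in (0 : ℝ)..R, Real.sin x / x ^ α)
      atTop (𝓝 a₀))
    (hC : ∀ x, 0 < x → m.real {y | x < |y|} ≤ C * x ^ (-α)) {D : ℝ}
    (hS : α = 1 → IntegrableOn (sStar m α c₀) (Set.Ioi D)) {q ξ : ℝ} (hq : 0 < q)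
    (hξ : 0 < ξ) : |vStar m α a₀ (ξ * q)| * (ξ * q) ^ α ≤
      2 * q ^ α * (ξ ^ 2 * H1 m α c₀ q + ξ * H2 m α c₀ q) := by
  have hα0 : 0 < α := one_pos.trans_le hα
  have hqα := Real.rpow_pos_of_pos hq α
  have t1 := tendsto_integral_sin_mul_tail m (Y := fun x => q * |x|) (by fun_prop)
    (fun x => by positivity) ξ
  have t2 := (tendsto_integral_sin_mul_rpow hξ hc₀).const_mul (q ^ α)
  have t3 := (t1.sub t2).abs
  have e1 : ∫ x, (1 - Real.cos (ξ * (q * |x|))) ∂m = 1 - (charFun m (ξ * q)).re := by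
    rw [one_sub_charFun_re]
    refine integral_congr_ae (Eventually.of_forall fun x => ?_)
    simp only
    rw [← mul_assoc, ← Real.cos_abs (ξ * q * x), abs_mul (ξ * q),
      abs_of_pos (mul_pos hξ hq)]
  have e2 : |(1 - (charFun m (ξ * q)).re) - q ^ α * (a₀ * ξ ^ α)| =
      |vStar m α a₀ (ξ * q)| * (ξ * q) ^ α := by
    have hpos := mul_pos hξ hq
    rw [one_sub_charFun_re_eq hα0 a₀, abs_of_pos hpos, Real.mul_rpow hξ.le hq.le,
      ← abs_of_pos (mul_pos (Real.rpow_pos_of_pos hξ α) hqα), ← abs_mul]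
    congr 1
    rw [abs_of_pos (mul_pos (Real.rpow_pos_of_pos hξ α) hqα)]
    ring
  rw [e1, e2] at t3
  refine le_of_tendsto t3 ((eventually_ge_atTop 1).mono fun R hR => ?_)
  obtain ⟨hi, hle⟩ := abs_integral_sin_mul_hStar_le hα hα2 hC hS hq hξ hR
  have hR0 : (0 : ℝ) ≤ R := zero_le_one.trans hR
  have e3 : ∫ x in (0 : ℝ)..R, ξ * Real.sin (ξ * x) * m.real {ω | x < q * |ω|} =
      q ^ α * (2 * c₀ * ∫ y in (0 : ℝ)..R, ξ * (Real.sin (ξ * y) * y ^ (-α))) +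
        2 * q ^ α * ξ * ∫ y in (0 : ℝ)..R, Real.sin (ξ * y) *
          (y ^ (-α) * hStar m α c₀ (y / q)) := by
    rw [← intervalIntegral.integral_const_mul, ← intervalIntegral.integral_const_mul,
      ← intervalIntegral.integral_const_mul, ← intervalIntegral.integral_add
        ((((intervalIntegrable_sin_mul_rpow hα2 hξ.le hR0).const_mul ξ).const_mul _).const_mul _)
        (hi.const_mul _)]
    refine intervalIntegral.integral_congr_ae (Eventually.of_forall fun y hy => ?_)
    rw [Set.uIoc_of_le hR0] at hy
    rw [tail_div_eq α c₀ hq hy.1]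
    ring
  rw [e3, add_sub_cancel_left, abs_mul, abs_of_pos (by positivity)]
  calc _ ≤ 2 * q ^ α * ξ * (ξ * H1 m α c₀ q + H2 m α c₀ q) :=
        mul_le_mul_of_nonneg_left hle (by positivity)
    _ = _ := by ring

theorem localError_mul_le (hα : 1 ≤ α) (hα2 : α < 2)
    (hc₀ : Tendsto (fun R : ℝ => 2 * c₀ * ∫ x in (0 : ℝ)..R, Real.sin x / x ^ α)
      atTop (𝓝 a₀))
    (hC : ∀ x, 0 < x → m.real {y | x < |y|} ≤ C * x ^ (-α)) {D : ℝ}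
    (hS : α = 1 → IntegrableOn (sStar m α c₀) (Set.Ioi D)) (b ξ : ℝ) :
    localError m α a₀ (ξ * b) ≤ |b| ^ α * (2 * (|ξ| ^ 2 * H1 m α c₀ |b| + |ξ| * H2 m α c₀ |b|)) +
      4 / 5 * bigM m α a₀ ^ 2 * |ξ| ^ (2 * α) * |b| ^ (2 * α) := by
  have hα0 : 0 < α := one_pos.trans_le hα
  have h2 : |ξ * b| ^ (2 * α) = |ξ| ^ (2 * α) * |b| ^ (2 * α) := by
    rw [abs_mul, Real.mul_rpow (abs_nonneg _) (abs_nonneg _)]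
  rw [localError, h2, ← mul_assoc (4 / 5 * bigM m α a₀ ^ 2)]
  refine add_le_add ?_ le_rfl
  rcases eq_or_ne b 0 with rfl | hb
  · simp [Real.zero_rpow hα0.ne']
  rcases eq_or_ne ξ 0 with rfl | hξ
  · simp [Real.zero_rpow hα0.ne']
  · have := abs_vStar_mul_le hα hα2 hc₀ hC hS (abs_pos.2 hb) (abs_pos.2 hξ)
    rw [← abs_mul, vStar_abs] at this
    refine this.trans (le_of_eq ?_)
    ring

end

/-! ### Integration of the error bound -/

theorem integrable_comp_abs_of_integrableOn_Ioi {f : ℝ → ℝ} (hf : IntegrableOn f (Set.Ioi 0)) :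
    Integrable fun x => f |x| := by
  have h1 : IntegrableOn (fun x => f |x|) (Set.Ioi 0) :=
    hf.congr_fun (fun x hx => by rw [abs_of_pos hx]) measurableSet_Ioi
  have h2 : IntegrableOn (fun x => f |x|) (Set.Iio 0) := by
    have h := (Measure.measurePreserving_neg (volume : Measure ℝ)).integrableOn_comp_preimage
      (Homeomorph.neg ℝ).measurableEmbedding (f := fun x => f |x|) (s := Set.Ioi 0)
    have h3 := h.2 h1
    have h4 : (Neg.neg ⁻¹' Set.Ioi 0 : Set ℝ) = Set.Iio 0 := by ext x; simp
    rw [h4] at h3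
    refine h3.congr_fun (fun x _ => ?_) measurableSet_Iio
    simp only [Function.comp, abs_neg]
  rw [← integrableOn_univ, ← Set.Iic_union_Ioi (a := (0 : ℝ))]
  exact (integrableOn_Iic_iff_integrableOn_Iio (by simp) |>.2 h2).union h1

theorem integrableOn_bigN {α κ l : ℝ} (hα : 0 < α) (hκ : 0 < κ) (hl : 0 < l) :
    IntegrableOn (fun ξ : ℝ => Real.exp (-κ * ξ ^ α) * ξ ^ (l - 1)) (Set.Ioi 0) :=
  (integrableOn_rpow_mul_exp_neg_mul_rpow (s := l - 1) (by linarith) hα hκ).congr_fun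
    (fun x _ => mul_comm _ _) measurableSet_Ioi

theorem bigN_nonneg (α a₀ η l : ℝ) : 0 ≤ bigN α a₀ η l :=
  setIntegral_nonneg measurableSet_Ioi fun _ hx =>
    mul_nonneg (Real.exp_pos _).le (Real.rpow_nonneg (le_of_lt hx) _)

/-- Division by |ξ| lowers each power by one, matching ξ^{l-1} in N_l. The factor 2 counts the two
half-lines. -/
theorem setIntegral_div_abs_le {α a₀ η : ℝ} (hα : 0 < α) (hη : η < a₀) {f : ℝ → ℝ}
    (hf : Measurable f) (hf0 : ∀ ξ, 0 ≤ f ξ) {A B K T : ℝ} (hA : 0 ≤ A) (hB : 0 ≤ B) (hK : 0 ≤ K)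
    (h : ∀ ξ ∈ Set.Icc (-T) T, f ξ ≤ Real.exp (-(a₀ - η) * |ξ| ^ α) *
      (A * |ξ| ^ 2 + B * |ξ| + K * |ξ| ^ (2 * α))) :
    IntegrableOn (fun ξ => f ξ / |ξ|) (Set.Icc (-T) T) ∧ ∫ ξ in Set.Icc (-T) T, f ξ / |ξ| ≤
      2 * (A * bigN α a₀ η 2 + B * bigN α a₀ η 1 + K * bigN α a₀ η (2 * α)) := by
  have hκ : 0 < a₀ - η := sub_pos.2 hη
  set e : ℝ → ℝ → ℝ := fun l ξ => Real.exp (-(a₀ - η) * ξ ^ α) * ξ ^ (l - 1) with he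
  have hi : ∀ l, 0 < l → IntegrableOn (e l) (Set.Ioi 0) := fun l hl => integrableOn_bigN hα hκ hl
  set G : ℝ → ℝ := fun ξ => A * e 2 ξ + B * e 1 ξ + K * e (2 * α) ξ with hG
  have hGi : IntegrableOn G (Set.Ioi 0) := (((hi 2 two_pos).const_mul A).add
    ((hi 1 one_pos).const_mul B)).add ((hi (2 * α) (by positivity)).const_mul K)
  have hGI : ∫ ξ in Set.Ioi 0, G ξ =
      A * bigN α a₀ η 2 + B * bigN α a₀ η 1 + K * bigN α a₀ η (2 * α) := by
    have hi2 : IntegrableOn (fun ξ => A * e 2 ξ + B * e 1 ξ) (Set.Ioi 0) :=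
      ((hi 2 two_pos).const_mul A).add ((hi 1 one_pos).const_mul B)
    simp only [hG]
    rw [integral_add hi2 ((hi (2 * α) (by positivity)).const_mul K), integral_add ((hi 2 two_pos).const_mul A)
      ((hi 1 one_pos).const_mul B), integral_const_mul, integral_const_mul, integral_const_mul]
    rfl
  have hG0 : ∀ ξ, 0 ≤ G |ξ| := fun ξ => by simp only [hG, he]; positivity
  have hGa := integrable_comp_abs_of_integrableOn_Ioi hGi
  have hle : ∀ ξ ∈ Set.Icc (-T) T, f ξ / |ξ| ≤ G |ξ| := fun ξ hξ => by
    rcases eq_or_ne ξ 0 with rfl | h0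
    · simpa using hG0 0
    · have hp := abs_pos.2 h0
      rw [div_le_iff₀ hp]
      refine (h ξ hξ).trans (le_of_eq ?_)
      have e1 : |ξ| ^ ((2 : ℝ) - 1) = |ξ| := by norm_num
      have e2 : |ξ| ^ ((1 : ℝ) - 1) = 1 := by norm_num
      have e3 : |ξ| ^ (2 * α) = |ξ| ^ (2 * α - 1) * |ξ| := by
        rw [Real.rpow_sub_one hp.ne']; field_simp
      simp only [hG, he]
      rw [e1, e2, e3]
      ring
  have hfi : IntegrableOn (fun ξ => f ξ / |ξ|) (Set.Icc (-T) T) :=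
    hGa.integrableOn.mono' (hf.div measurable_norm).aestronglyMeasurable
      ((ae_restrict_iff' measurableSet_Icc).2 (Eventually.of_forall fun ξ hξ => by
        rw [Real.norm_of_nonneg (div_nonneg (hf0 ξ) (abs_nonneg ξ))]; exact hle ξ hξ))
  refine ⟨hfi, ?_⟩
  calc _ ≤ ∫ ξ in Set.Icc (-T) T, G |ξ| :=
        setIntegral_mono_on hfi hGa.integrableOn measurableSet_Icc hle
    _ ≤ ∫ ξ, G |ξ| := setIntegral_le_integral hGa (Eventually.of_forall hG0)
    _ = _ := by rw [integral_comp_abs, hGI]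

/-! ### The stable law -/

/-- The characteristic function is integrable, so the density is bounded and `densityNorm` is a
genuine supremum. -/
theorem isSymmStable_cdf {α a₀ : ℝ} (hα : 0 < α) (ha₀ : 0 < a₀) {ν : Measure ℝ}
    (hν : IsSymmStable α a₀ ν) : Differentiable ℝ (cdf ν) ∧
      ∀ x, |deriv (cdf ν) x| ≤ densityNorm ν := by
  have := hν.1
  have h1 : Integrable fun ξ : ℝ => charFun ν ξ := by
    have h2 := integrable_comp_abs_of_integrableOn_Ioi (integrableOn_bigN hα ha₀ one_pos)
    refine h2.mono' measurable_charFun.aestronglyMeasurable (Eventually.of_forall fun ξ => ?_)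
    rw [hν.2, Complex.norm_real, Real.norm_of_nonneg (Real.exp_pos _).le]
    simp
  obtain ⟨hd, hb⟩ := differentiable_cdf_of_integrable_charFun ν
    (h1.comp_mul_left' (by positivity))
  refine ⟨hd, fun x => ?_⟩
  exact le_ciSup (f := fun x => |deriv (cdf ν) x|)
    ⟨∫ ξ : ℝ, ‖charFun ν (2 * Real.pi * ξ)‖, by rintro _ ⟨y, rfl⟩; exact hb y⟩ x

/-! ### The conditional estimate -/

theorem abs_le_foldr_max {L : List ℝ} {b : ℝ} (hb : b ∈ L) :
    |b| ≤ (L.map fun b => |b|).foldr max 0 := by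
  induction L with
  | nil => simp at hb
  | cons a L ih =>
    rw [List.map_cons, List.foldr_cons]
    rcases List.mem_cons.1 hb with rfl | h
    · exact le_max_left _ _
    · exact (ih h).trans (le_max_right _ _)

theorem foldr_max_le {L : List ℝ} {K : ℝ} (hK : 0 ≤ K) (hL : ∀ b ∈ L, |b| ≤ K) :
    (L.map fun b => |b|).foldr max 0 ≤ K := by
  induction L with
  | nil => exact hK
  | cons a L ih =>
    rw [List.map_cons, List.foldr_cons]
    exact max_le (hL a List.mem_cons_self) (ih fun b hb => hL b (List.mem_cons_of_mem _ hb))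

theorem foldr_max_pos {α : ℝ} (hα : 0 < α) {L : List ℝ}
    (hL : (L.map fun b => |b| ^ α).sum = 1) : 0 < (L.map fun b => |b|).foldr max 0 := by
  by_contra h
  have h0 : ∀ b ∈ L, |b| ^ α = 0 := fun b hb => by
    rw [le_antisymm ((abs_le_foldr_max hb).trans (not_lt.1 h)) (abs_nonneg b),
      Real.zero_rpow hα.ne']
  rw [List.map_congr_left h0] at hL
  simp at hL

theorem abs_cdf_weightedLaw_sub_le {p α a₀ c₀ η d D C : ℝ} (hp : 0 < 1 + p)
    (hαp : α = 2 / (1 + p)) (hα : 1 ≤ α) (hα2 : α < 2) {μ₀ : Measure ℝ}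
    [IsProbabilityMeasure μ₀] {ν : Measure ℝ} (hν : IsSymmStable α a₀ ν)
    (hc₀ : Tendsto (fun R : ℝ => 2 * c₀ * ∫ x in (0 : ℝ)..R, Real.sin x / x ^ α)
      atTop (𝓝 a₀)) (hη : η ∈ Set.Ioo 0 a₀) (hd : d ∈ Set.Ioo (0 : ℝ) 1)
    (hd' : ∀ x : ℝ, |x| ≤ dTilde μ₀ α a₀ d →
      4 / 5 * bigM μ₀ α a₀ ^ 2 * |x| ^ α + vBar μ₀ α a₀ |x| ≤ η)
    (hC : ∀ x, 0 < x → μ₀.real {y | x < |y|} ≤ C * x ^ (-α))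
    (hS : α = 1 → IntegrableOn (sStar μ₀ α c₀) (Set.Ioi D)) {c : ℝ} (hc : IsBerryEsseenConst c)
    (ω : BinaryTree Unit × (ℕ → ℝ)) (x : ℝ) :
    |cdf (weightedLaw p (evenPart μ₀) ω) x - cdf ν x| ≤
      2 / Real.pi * ((weights p ω.1 ω.2).map fun b => |b| ^ α *
        (2 * bigN α a₀ η 2 * H1 μ₀ α c₀ |b| + 2 * bigN α a₀ η 1 * H2 μ₀ α c₀ |b|)).sum
      + c * densityNorm ν / dTilde μ₀ α a₀ d *
        ((weights p ω.1 ω.2).map fun b => |b|).foldr max 0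
      + 2 / Real.pi * (B5 μ₀ α a₀ η *
        ((weights p ω.1 ω.2).map fun b => |b| ^ (2 * α)).sum) := by
  have := hν.1
  have hα0 : 0 < α := one_pos.trans_le hα
  have ha₀ : 0 < a₀ := hη.1.trans hη.2
  have hb := exists_abs_vStar_le hα2 hC a₀
  have hdt := dTilde_pos ha₀ hb hd.1
  set L := weights p ω.1 ω.2 with hL
  set β := (L.map fun b => |b|).foldr max 0 with hβ
  have hL1 : (L.map fun b => |b| ^ α).sum = 1 := sum_weights_rpow hp hαp _ _
  have hβ0 : 0 < β := foldr_max_pos hα0 hL1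
  obtain ⟨hdiff, hA⟩ := isSymmStable_cdf hα0 ha₀ hν
  -- The largest T for which |ξ| ≤ T keeps every |ξ β_j| within d̃. The Berry-Esseen remainder
  -- c‖g_α‖/T becomes linear in the largest weight.
  set T := dTilde μ₀ α a₀ d / β with hT
  have hT0 : 0 < T := div_pos hdt hβ0
  set S1 := (L.map fun b => |b| ^ α * H1 μ₀ α c₀ |b|).sum with hS1
  set S2 := (L.map fun b => |b| ^ α * H2 μ₀ α c₀ |b|).sum with hS2
  set S3 := (L.map fun b => |b| ^ (2 * α)).sum with hS3
  have hS1' : 0 ≤ S1 := sum_map_nonneg (fun b => mul_nonneg (by positivity) (H1_nonneg _ _ _ _)) _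
  have hS2' : 0 ≤ S2 := sum_map_nonneg (fun b => mul_nonneg (by positivity) (H2_nonneg _ _ _ _)) _
  have hS3' : 0 ≤ S3 := sum_map_nonneg (fun b => by positivity) _
  have hbound : ∀ ξ ∈ Set.Icc (-T) T,
      ‖charFun (weightedLaw p (evenPart μ₀) ω) ξ - charFun ν ξ‖ ≤
        Real.exp (-(a₀ - η) * |ξ| ^ α) * (2 * S1 * |ξ| ^ 2 + 2 * S2 * |ξ| +
          4 / 5 * bigM μ₀ α a₀ ^ 2 * S3 * |ξ| ^ (2 * α)) := fun ξ hξ => by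
    have h1 : ∀ b ∈ L, |ξ * b| ≤ dTilde μ₀ α a₀ d := fun b hbL => by
      have h2 : |ξ| ≤ T := abs_le.2 hξ
      rw [hT, le_div_iff₀ hβ0] at h2
      rw [abs_mul]
      exact (mul_le_mul_of_nonneg_left (abs_le_foldr_max hbL) (abs_nonneg _)).trans h2
    have h2 := abs_prod_sub_exp_le hα0 ha₀ hb hd hd' ξ h1 hL1
    have h3 : charFun (weightedLaw p (evenPart μ₀) ω) ξ - charFun ν ξ =
        (((L.map fun b => (charFun μ₀ (ξ * b)).re).prod - Real.exp (-a₀ * |ξ| ^ α) : ℝ) : ℂ) := by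
      rw [hν.2, charFun_weightedLaw_evenPart, Complex.ofReal_sub]
    rw [h3, Complex.norm_real]
    refine h2.trans (mul_le_mul_of_nonneg_left ?_ (Real.exp_pos _).le)
    refine (List.sum_le_sum fun b _ => localError_mul_le hα hα2 hc₀ hC hS b ξ).trans
      (le_of_eq ?_)
    rw [List.sum_map_add, List.sum_map_mul_left]
    have e : (L.map fun b => |b| ^ α * (2 * (|ξ| ^ 2 * H1 μ₀ α c₀ |b| +
        |ξ| * H2 μ₀ α c₀ |b|))).sum = 2 * |ξ| ^ 2 * S1 + 2 * |ξ| * S2 := by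
      rw [hS1, hS2, ← List.sum_map_mul_left, ← List.sum_map_mul_left, ← List.sum_map_add]
      congr 1
      refine List.map_congr_left fun b _ => ?_
      ring
    rw [e]
    ring
  obtain ⟨hint, hle⟩ := setIntegral_div_abs_le hα0 hη.2
    (f := fun ξ => ‖charFun (weightedLaw p (evenPart μ₀) ω) ξ - charFun ν ξ‖)
    (measurable_charFun.sub measurable_charFun).norm (fun ξ => norm_nonneg _)
    (by positivity) (by positivity) (by positivity) hbound
  have hBE := hc (weightedLaw p (evenPart μ₀) ω) ν inferInstance inferInstance (densityNorm ν) T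
    hT0 hdiff hA hint x
  have e1 : c * densityNorm ν / T = c * densityNorm ν / dTilde μ₀ α a₀ d * β := by
    rw [hT]; field_simp
  have e2 : (L.map fun b => |b| ^ α * (2 * bigN α a₀ η 2 * H1 μ₀ α c₀ |b| +
      2 * bigN α a₀ η 1 * H2 μ₀ α c₀ |b|)).sum =
        2 * bigN α a₀ η 2 * S1 + 2 * bigN α a₀ η 1 * S2 := by
    rw [hS1, hS2, ← List.sum_map_mul_left, ← List.sum_map_mul_left, ← List.sum_map_add]
    congr 1
    refine List.map_congr_left fun b _ => ?_
    ring
  rw [e1] at hBE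
  rw [e2, B5]
  have h4 := mul_le_mul_of_nonneg_left hle (by positivity : 0 ≤ 1 / Real.pi)
  refine hBE.trans ?_
  calc _ ≤ 1 / Real.pi * (2 * (2 * S1 * bigN α a₀ η 2 + 2 * S2 * bigN α a₀ η 1 +
        4 / 5 * bigM μ₀ α a₀ ^ 2 * S3 * bigN α a₀ η (2 * α))) +
          c * densityNorm ν / dTilde μ₀ α a₀ d * β := by linarith
    _ = _ := by ring

/-! ### Integration over the weights -/

theorem k1_nonneg (m : Measure ℝ) (α c₀ D : ℝ) : 0 ≤ k1 m α c₀ D :=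
  setIntegral_nonneg measurableSet_Ioc fun _ hx => mul_nonneg hx.1.le (abs_nonneg _)

theorem k2_nonneg (m : Measure ℝ) (α c₀ D : ℝ) : 0 ≤ k2 m α c₀ D :=
  Real.sSup_nonneg (by
    rintro _ ⟨x, hx, rfl⟩
    exact div_nonneg (abs_nonneg _) (Real.rpow_nonneg (le_of_lt hx) _))

theorem abs_cdf_sub_cdfStar_le (m : Measure ℝ) [IsProbabilityMeasure m] (x : ℝ) :
    |cdf m x - cdfStar m x| ≤ asymmetry m / 2 := by
  have h : |cdf m x + m.real (Set.Iio (-x)) - 1| ≤ asymmetry m := by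
    refine le_ciSup (f := fun x => |cdf m x + m.real (Set.Iio (-x)) - 1|) ⟨1, ?_⟩ x
    rintro _ ⟨y, rfl⟩
    have h1 := cdf_nonneg m y
    have h2 := cdf_le_one m y
    have h3 : m.real (Set.Iio (-y)) ≤ 1 := measureReal_le_one
    have h4 : 0 ≤ m.real (Set.Iio (-y)) := measureReal_nonneg
    exact abs_le.2 ⟨by linarith, by linarith⟩
  have e : cdf m x - cdfStar m x = (cdf m x + m.real (Set.Iio (-x)) - 1) / 2 := by
    rw [cdfStar]; ring
  rw [e, abs_div, abs_two]
  linarith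

theorem abs_sum_map_le (g : ℝ → ℝ) (L : List ℝ) :
    |(L.map g).sum| ≤ (L.map fun b => |g b|).sum := by
  induction L with
  | nil => simp
  | cons b L ih =>
    rw [List.map_cons, List.sum_cons, List.map_cons, List.sum_cons]
    exact (abs_add_le _ _).trans (add_le_add le_rfl ih)

/-- The |b|^α are convex weights, so the sum is an average of values of f. Zero weights do not
contribute, hence a bound on (0, 1] is enough. -/
theorem abs_sum_map_rpow_mul_le {α K : ℝ} {f : ℝ → ℝ} (hα : 0 < α)
    (hf : ∀ q ∈ Set.Ioc (0 : ℝ) 1, |f q| ≤ K) {L : List ℝ} (hL : ∀ b ∈ L, |b| ≤ 1)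
    (hL1 : (L.map fun b => |b| ^ α).sum = 1) :
    |(L.map fun b => |b| ^ α * f |b|).sum| ≤ K := by
  have h : ∀ b ∈ L, |(|b| ^ α * f |b|)| ≤ |b| ^ α * K := fun b hb => by
    rcases eq_or_ne b 0 with rfl | h0
    · simp [Real.zero_rpow hα.ne']
    · rw [abs_mul, abs_of_nonneg (Real.rpow_nonneg (abs_nonneg b) α)]
      exact mul_le_mul_of_nonneg_left (hf _ ⟨abs_pos.2 h0, hL b hb⟩)
        (Real.rpow_nonneg (abs_nonneg b) α)
  have h1 := List.sum_le_sum h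
  rw [List.sum_map_mul_right, hL1, one_mul] at h1
  refine le_trans ?_ h1
  exact abs_sum_map_le _ L

theorem integrable_treeAngleLaw_of_bound {t : ℝ} (ht : 0 ≤ t) {F : BinaryTree Unit × (ℕ → ℝ) → ℝ}
    (hF : Measurable F) {K : ℝ} (hK : ∀ ω, |F ω| ≤ K) : Integrable F (treeAngleLaw t) := by
  have := isProbabilityMeasure_treeAngleLaw ht
  exact (integrable_const K).mono' hF.aestronglyMeasurable (Eventually.of_forall hK)

theorem abs_integral_cdf_weightedLaw_sub_le {p α a₀ c₀ η d D C : ℝ} (hp : 0 < 1 + p)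
    (hαp : α = 2 / (1 + p)) (hα : 1 ≤ α) (hα2 : α < 2) {μ₀ : Measure ℝ}
    [IsProbabilityMeasure μ₀] {ν : Measure ℝ} (hν : IsSymmStable α a₀ ν)
    (hc₀ : Tendsto (fun R : ℝ => 2 * c₀ * ∫ x in (0 : ℝ)..R, Real.sin x / x ^ α)
      atTop (𝓝 a₀)) (hη : η ∈ Set.Ioo 0 a₀) (hd : d ∈ Set.Ioo (0 : ℝ) 1)
    (hd' : ∀ x : ℝ, |x| ≤ dTilde μ₀ α a₀ d →
      4 / 5 * bigM μ₀ α a₀ ^ 2 * |x| ^ α + vBar μ₀ α a₀ |x| ≤ η)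
    (hC : ∀ x, 0 < x → μ₀.real {y | x < |y|} ≤ C * x ^ (-α))
    (hS : α = 1 → IntegrableOn (sStar μ₀ α c₀) (Set.Ioi D)) {c : ℝ} (hc : IsBerryEsseenConst c)
    {t : ℝ} (ht : 0 ≤ t) (x : ℝ) :
    |(∫ ω, cdf (weightedLaw p (evenPart μ₀) ω) x ∂(treeAngleLaw t)) - cdf ν x| ≤
      2 / Real.pi * expSum p t (fun q => q ^ α *
        (B3 μ₀ α a₀ c₀ η D * H1 μ₀ α c₀ q + B4 μ₀ α a₀ c₀ η D * H2 μ₀ α c₀ q))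
      + c * densityNorm ν / dTilde μ₀ α a₀ d * expMax p t
      + 2 / Real.pi * (B5 μ₀ α a₀ η * Real.exp (-t * (1 - 2 * bigA 4))) := by
  have := isProbabilityMeasure_treeAngleLaw ht
  have hα0 : 0 < α := one_pos.trans_le hα
  obtain ⟨K2, hK2⟩ := exists_H2_le hα hC c₀ hS
  set K1 := ∫ y in Set.Ioc (0 : ℝ) 1, y ^ (1 - α) * (C + |c₀|) with hK1
  set N1 := bigN α a₀ η 1 with hN1
  set N2 := bigN α a₀ η 2 with hN2
  have hN1' : 0 ≤ N1 := bigN_nonneg _ _ _ _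
  have hN2' : 0 ≤ N2 := bigN_nonneg _ _ _ _
  -- The conditional estimate holds with 2N_2 and 2N_1; the k₂ summands of B₃ and B₄ are
  -- nonnegative.
  have hB3 : 2 * N2 ≤ B3 μ₀ α a₀ c₀ η D := by
    have := mul_nonneg (k2_nonneg μ₀ α c₀ D) (bigN_nonneg α a₀ η (2 + α))
    rw [B3]; linarith
  have hB4 : 2 * N1 ≤ B4 μ₀ α a₀ c₀ η D := by
    have := mul_nonneg (k2_nonneg μ₀ α c₀ D) (bigN_nonneg α a₀ η (1 + α))
    rw [B4]; linarith
  set b3 := B3 μ₀ α a₀ c₀ η D with hb3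
  set b4 := B4 μ₀ α a₀ c₀ η D with hb4
  have hB5 : 0 ≤ B5 μ₀ α a₀ η := by
    have := bigN_nonneg α a₀ η (2 * α)
    rw [B5]; positivity
  have hfm : Measurable fun b : ℝ => |b| ^ α * (b3 * H1 μ₀ α c₀ |b| + b4 * H2 μ₀ α c₀ |b|) :=
    (measurable_norm.pow_const _).mul
      ((((measurable_H1 μ₀ α c₀).comp measurable_norm).const_mul _).add
        (((measurable_H2 μ₀ α c₀).comp measurable_norm).const_mul _))
  -- Boundedness gives integrability over trees and angles, so the expectations are true integrals
  -- and not the default 0.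
  have hfb : ∀ q ∈ Set.Ioc (0 : ℝ) 1,
      |b3 * H1 μ₀ α c₀ q + b4 * H2 μ₀ α c₀ q| ≤ b3 * K1 + b4 * K2 := fun q hq => by
    have h1 := H1_nonneg μ₀ α c₀ q
    have h2 := H2_nonneg μ₀ α c₀ q
    have h3 : 0 ≤ b3 := by linarith
    have h4 : 0 ≤ b4 := by linarith
    rw [abs_of_nonneg (by positivity)]
    exact add_le_add (mul_le_mul_of_nonneg_left (H1_le hα2 hC c₀ hq.1) h3)
      (mul_le_mul_of_nonneg_left (hK2 q hq) h4)
  have i1 := integrable_treeAngleLaw_of_bound ht (measurable_sum_weights p hfm) fun ω =>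
    abs_sum_map_rpow_mul_le hα0 hfb (fun b hb => abs_le_one_of_mem_weights hp hb)
      (sum_weights_rpow hp hαp ω.1 ω.2)
  have i2 := integrable_treeAngleLaw_of_bound ht (measurable_max_weights p measurable_norm)
    (K := 1) fun ω => by
      have h := foldr_max_le zero_le_one
        fun b hb => abs_le_one_of_mem_weights (g := ω.1) (θ := ω.2) hp hb
      have h0 := foldr_max_pos hα0 (sum_weights_rpow hp hαp ω.1 ω.2)
      exact (abs_of_nonneg h0.le).trans_le h
  have i3 := integrable_treeAngleLaw_of_bound ht (measurable_sum_weights p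
    (f := fun b => |b| ^ (2 * α)) (by fun_prop)) (K := 1)
    fun ω => abs_sum_weights_rpow_le hp hαp (by linarith) ω.1 ω.2
  have iF := integrable_treeAngleLaw_of_bound ht
    (measurable_cdf_weightedLaw p (evenPart μ₀) x) (K := 1) fun ω => by
      rw [abs_of_nonneg (cdf_nonneg _ _)]; exact cdf_le_one _ _
  have hpt : ∀ ω, ‖cdf (weightedLaw p (evenPart μ₀) ω) x - cdf ν x‖ ≤
      2 / Real.pi * ((weights p ω.1 ω.2).map fun b => |b| ^ α *
        (b3 * H1 μ₀ α c₀ |b| + b4 * H2 μ₀ α c₀ |b|)).sum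
      + c * densityNorm ν / dTilde μ₀ α a₀ d *
        ((weights p ω.1 ω.2).map fun b => ‖b‖).foldr max 0
      + 2 / Real.pi * (B5 μ₀ α a₀ η *
        ((weights p ω.1 ω.2).map fun b => |b| ^ (2 * α)).sum) := fun ω => by
    refine (abs_cdf_weightedLaw_sub_le hp hαp hα hα2 hν hc₀ hη hd hd' hC hS hc ω x).trans ?_
    refine add_le_add (add_le_add (mul_le_mul_of_nonneg_left (List.sum_le_sum fun b _ => ?_)
      (by positivity)) le_rfl) le_rfl
    exact mul_le_mul_of_nonneg_left (add_le_add
      (mul_le_mul_of_nonneg_right hB3 (H1_nonneg _ _ _ _))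
      (mul_le_mul_of_nonneg_right hB4 (H2_nonneg _ _ _ _))) (Real.rpow_nonneg (abs_nonneg _) _)
  have e1 : (∫ ω, cdf (weightedLaw p (evenPart μ₀) ω) x ∂(treeAngleLaw t)) - cdf ν x =
      ∫ ω, (cdf (weightedLaw p (evenPart μ₀) ω) x - cdf ν x) ∂(treeAngleLaw t) := by
    rw [integral_sub iF (integrable_const _)]
    simp
  have j1 := i1.const_mul (2 / Real.pi)
  have j2 := i2.const_mul (c * densityNorm ν / dTilde μ₀ α a₀ d)
  have j3 := (i3.const_mul (B5 μ₀ α a₀ η)).const_mul (2 / Real.pi)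
  rw [e1]
  refine (norm_integral_le_of_norm_le ((j1.add j2).add j3) (Eventually.of_forall hpt)).trans ?_
  refine (integral_add (j1.add j2) j3).trans_le ?_
  refine add_le_add ((integral_add j1 j2).trans_le (add_le_add ?_ ?_)) ?_
  · exact (integral_const_mul _ _).le
  · exact (integral_const_mul _ _).le
  · rw [integral_const_mul, integral_const_mul]
    refine mul_le_mul_of_nonneg_left (mul_le_mul_of_nonneg_left ?_ hB5) (by positivity)
    have h := integral_sum_weights_rpow_le hp hαp (s := 2 * α) (by linarith) ht
    -- (1 + p)α = 2, so the moment of order 2α of the weights is governed by A_4.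
    have e4 : (1 + p) * (2 * α) = 4 := by rw [hαp]; field_simp; norm_num
    rwa [e4] at h

theorem theorem6
    (p α : ℝ) (hα : α = 2 / (1 + p)) (hα_mem : α ∈ Set.Ico (1 : ℝ) 2)
    -- the initial law, the solution started there, and the stable law
    (μ₀ : Measure ℝ) [IsProbabilityMeasure μ₀]
    (μ : ℝ → Measure ℝ) (hμ : IsSolution p μ₀ μ)
    (a₀ : ℝ) (ν : Measure ℝ) (hν : IsSymmStable α a₀ ν)
    (hdna : InNormalDomain α μ₀ ν)
    -- the tail constant: `a₀ = 2 c₀ ∫_0^∞ sin x / x^α dx`, an improper integral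
    (c₀ : ℝ) (hc₀ : Tendsto (fun R : ℝ => 2 * c₀ * ∫ x in (0 : ℝ)..R, Real.sin x / x ^ α)
      atTop (𝓝 a₀))
    -- the auxiliary parameters
    (η : ℝ) (hη : η ∈ Set.Ioo 0 a₀)
    (d : ℝ) (hd : d ∈ Set.Ioo (0 : ℝ) 1)
    (hd' : ∀ x : ℝ, |x| ≤ dTilde μ₀ α a₀ d →
      4 / 5 * bigM μ₀ α a₀ ^ 2 * |x| ^ α + vBar μ₀ α a₀ |x| ≤ η)
    (D : ℝ) (hD : 0 < D)
    (hS : α = 1 → IntegrableOn (sStar μ₀ α c₀) (Set.Ioi D)) :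
    (∃ c, IsBerryEsseenConst c) ∧
    ∀ c, IsBerryEsseenConst c → ∀ t : ℝ, 0 ≤ t →
      kolmogorovDist (μ t) ν ≤
        2 / Real.pi * expSum p t (fun q => q ^ α *
            (B3 μ₀ α a₀ c₀ η D * H1 μ₀ α c₀ q + B4 μ₀ α a₀ c₀ η D * H2 μ₀ α c₀ q))
        + c * densityNorm ν / dTilde μ₀ α a₀ d * expMax p t
        + 2 / Real.pi *
          (B1 μ₀ α a₀ c₀ η D * Real.exp (-t * (1 - 2 * bigA (4 / α)))
            + B2 μ₀ α a₀ c₀ η D * Real.exp (-t * (1 - 2 * bigA ((8 - 2 * α) / α)))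
            + B5 μ₀ α a₀ η * Real.exp (-t * (1 - 2 * bigA 4))
            + B6 μ₀ α a₀ η * Real.exp (-t * (1 - 2 * bigA 6)))
        + Real.exp (-t) / 2 * asymmetry μ₀ := by
  have hα1 := hα_mem.1
  have hα2 := hα_mem.2
  -- Otherwise 2/(1+p) ≤ 0, also at p = -1 where the quotient is 0 by convention, against α ≥ 1.
  have hp : 0 < 1 + p := by
    by_contra h
    have : 2 / (1 + p) ≤ 0 := div_nonpos_of_nonneg_of_nonpos two_pos.le (not_lt.1 h)
    linarith
  refine ⟨⟨_, isBerryEsseenConst_eight_mul_pi⟩, fun c hc t ht => ?_⟩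
  obtain ⟨C, _, hC⟩ := exists_tail_le (one_pos.trans_le hα1) hν hdna
  have hk1 := k1_nonneg μ₀ α c₀ D
  have hk2 := k2_nonneg μ₀ α c₀ D
  have hB1 : 0 ≤ B1 μ₀ α a₀ c₀ η D * Real.exp (-t * (1 - 2 * bigA (4 / α))) := by
    have h2 := bigN_nonneg α a₀ η 2
    have h3 := bigN_nonneg α a₀ η (2 + α)
    rw [B1]; positivity
  have hB2 : 0 ≤ B2 μ₀ α a₀ c₀ η D * Real.exp (-t * (1 - 2 * bigA ((8 - 2 * α) / α))) := by
    have h4 := bigN_nonneg α a₀ η 4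
    rw [B2]; positivity
  have hB6 : 0 ≤ B6 μ₀ α a₀ η * Real.exp (-t * (1 - 2 * bigA 6)) := by
    have h4 := bigN_nonneg α a₀ η (4 * α)
    have : 0 ≤ bigM μ₀ α a₀ ^ 4 := by positivity
    rw [B6]; positivity
  refine ciSup_le fun x => ?_
  have h1 := abs_integral_cdf_weightedLaw_sub_le hp hα hα1 hα2 hν hc₀ hη hd hd' hC hS hc ht x
  have h2 := mul_le_mul_of_nonneg_left (abs_cdf_sub_cdfStar_le μ₀ x) (Real.exp_pos (-t)).le
  have e : cdf (μ t) x - cdf ν x =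
      ((∫ ω, cdf (weightedLaw p (evenPart μ₀) ω) x ∂(treeAngleLaw t)) - cdf ν x) +
        Real.exp (-t) * (cdf μ₀ x - cdfStar μ₀ x) := by
    rw [cdf_of_isSolution hμ ht]; ring
  -- The B₁, B₂ and B₆ terms are nonnegative, so the bound through B₅ alone implies the one with all
  -- four.
  have h3 : 2 / Real.pi * (B5 μ₀ α a₀ η * Real.exp (-t * (1 - 2 * bigA 4))) ≤ 2 / Real.pi *
      (B1 μ₀ α a₀ c₀ η D * Real.exp (-t * (1 - 2 * bigA (4 / α)))
        + B2 μ₀ α a₀ c₀ η D * Real.exp (-t * (1 - 2 * bigA ((8 - 2 * α) / α)))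
        + B5 μ₀ α a₀ η * Real.exp (-t * (1 - 2 * bigA 4))
        + B6 μ₀ α a₀ η * Real.exp (-t * (1 - 2 * bigA 6))) :=
    mul_le_mul_of_nonneg_left (by linarith) (by positivity)
  rw [e]
  refine (abs_add_le _ _).trans ?_
  rw [abs_mul (Real.exp (-t)), abs_of_pos (Real.exp_pos (-t))]
  linarith
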